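/- Let $p_1=(0,0)$, $p_2=(\tfrac12,0)$, $p_3=(1,0)$, $p_4=(1,\tfrac12)$, $p_5=(1,1)$, $p_6=(\tfrac12,1)$, $p_7=(0,1)$, $p_8=(0,\tfrac12)$, let $F_i(x)=(x+2p_i)/3$ for $x\in\mathbb R^2$ and $i=1,\dots,8$, and let $K$ be the Sierpinski carpet, i.e. the unique nonempty compact subset of $\mathbb R^2$ with $K=\bigcup_{i=1}^8F_i(K)$. For a finite (possibly empty) word $w=w_1\cdots w_n$ over $\{1,\dots,8\}$ put $K_w=F_{w_1}\circ\cdots\circ F_{w_n}(K)$. A chain between $x,y\in K$ is a nonempty finite sequence of words $(w(1),\dots,w(m))$ with $K_{w(i)}\cap K_{w(i+1)}\neq\emptyset$ for $1\le i<m$, $x\in K_{w(1)}$ and $y\in K_{w(m)}$. For $a,b\in(0,1)$ let $g_{a,b}(w)=\prod_{k=1}^n r_{w_k}$, where $r_j=a$ for $j\in\{1,3,5,7\}$ and $r_j=b$ for $j\in\{2,4,6,8\}$, and for $x,y\in K$ let $$D_{g_{a,b}}(x,y)=\inf\Big\{\sum_{i=1}^m g_{a,b}(w(i)) : (w(1),\dots,w(m))\text{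 is a chain between }x\text{ and }y\Big\}.$$ For two metrics $\rho,d$ on a set $M$, say that $\rho$ is quasisymmetric to $d$ with control function $h$ if $h$ is a homeomorphism of $[0,\infty)$ onto itself with $h(0)=0$ such that, for all $t>0$ and $p,q,s\in M$, $d(p,s)<t\,d(p,q)$ implies $\rho(p,s)<h(t)\,\rho(p,q)$; $\rho$ is quasisymmetric to $d$ if such an $h$ exists. **Proposition.** Let $(a,b)\in\sigma=\{(a,b)\in(0,1)^2: 2a+b\ge1\text{ and }a+2b\ge1\}$. Then $D_{g_{a,b}}$ is a metric on $K$, and it is quasisymmetric to the sup-metric $d_\infty(p,q)=\|p-q\|_\infty$ on $K$ and to the Euclidean metric on $K$. Moreover there is a constant $C>0$, depending only on $a$ and $b$, such that $$h(t)=C\max\{t^{\kappa_1},t^{\kappa_2}\},\qquad \kappa_1=\frac{\log(a\vee b)}{-\log3},\quad \kappa_2=\frac{\log(a\wedge b)}{-\log3},$$ is a control function for both, where $a\vee b=\max\{a,b\}$ and $a\wedge b=\min\{a,b\}$. -/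

import Mathlib

open scoped NNReal

namespace SierpinskiCarpet

/-- The points `p₁, …, p₈` on the boundary of the unit square. The index `i : Fin 8` stands for the
label `i + 1 ∈ {1, …, 8}`; corners have even index and midpoints of sides have odd index. -/
noncomputable def vertex : Fin 8 → ℝ × ℝ :=
  ![(0, 0), (1 / 2, 0), (1, 0), (1, 1 / 2), (1, 1), (1 / 2, 1), (0, 1), (0, 1 / 2)]

/-- The contractions `F_i(x) = (x + 2 p_i) / 3` of the plane. -/
noncomputable def contr (i : Fin 8) (x : ℝ × ℝ) : ℝ × ℝ :=
  ((x.1 + 2 * (vertex i).1) / 3, (x.2 + 2 * (vertex i).2) / 3)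

/-- The `n`-th approximation of the carpet: start from the unit square and apply
`A ↦ F_1(A) ∪ ⋯ ∪ F_8(A)` `n` times. -/
noncomputable def preCarpet : ℕ → Set (ℝ × ℝ)
  | 0 => Set.Icc 0 1 ×ˢ Set.Icc 0 1
  | n + 1 => ⋃ i, contr i '' preCarpet n

/-- The Sierpinski carpet `K`. By `carpet_isCompact`, `carpet_nonempty`, `carpet_selfSimilar` and
`carpet_unique` below, it is the unique nonempty compact subset of the plane with
`K = F_1(K) ∪ ⋯ ∪ F_8(K)`. -/
noncomputable def carpet : Set (ℝ × ℝ) := ⋂ n, preCarpet n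

theorem vertex_mem (i : Fin 8) :
    0 ≤ (vertex i).1 ∧ (vertex i).1 ≤ 1 ∧ 0 ≤ (vertex i).2 ∧ (vertex i).2 ≤ 1 := by
  fin_cases i <;> norm_num [vertex]

theorem continuous_contr (i : Fin 8) : Continuous (contr i) := by
  unfold contr
  fun_prop

theorem preCarpet_isCompact (n : ℕ) : IsCompact (preCarpet n) := by
  induction n with
  | zero => exact isCompact_Icc.prod isCompact_Icc
  | succ n ih => exact isCompact_iUnion fun i => ih.image (continuous_contr i)

theorem preCarpet_succ_subset (n : ℕ) : preCarpet (n + 1) ⊆ preCarpet n := by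
  induction n with
  | zero =>
    intro x hx
    obtain ⟨i, y, hy, rfl⟩ := Set.mem_iUnion.1 hx
    obtain ⟨⟨h1, h2⟩, h3, h4⟩ := hy
    obtain ⟨v1, v2, v3, v4⟩ := vertex_mem i
    refine ⟨⟨?_, ?_⟩, ?_, ?_⟩ <;> simp only [contr] <;> linarith
  | succ n ih => exact Set.iUnion_mono fun i => Set.image_mono ih

theorem preCarpet_antitone : Antitone preCarpet := antitone_nat_of_succ_le preCarpet_succ_subset

theorem zero_mem_carpet : ((0, 0) : ℝ × ℝ) ∈ carpet := by
  refine Set.mem_iInter.2 fun n => ?_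
  induction n with
  | zero => simp [preCarpet]
  | succ n ih => exact Set.mem_iUnion.2 ⟨0, _, ih, by simp [contr, vertex]⟩

theorem carpet_nonempty : carpet.Nonempty := ⟨_, zero_mem_carpet⟩

theorem carpet_isCompact : IsCompact carpet :=
  (preCarpet_isCompact 0).of_isClosed_subset
    (isClosed_iInter fun n => (preCarpet_isCompact n).isClosed) (Set.iInter_subset _ 0)

theorem carpet_selfSimilar : carpet = ⋃ i, contr i '' carpet := by
  apply Set.Subset.antisymm
  · intro x hx
    by_contra hcon
    have h1 : ∀ i, ∃ n, x ∉ contr i '' preCarpet n := by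
      intro i
      by_contra! hi
      refine hcon (Set.mem_iUnion.2
        ⟨i, ((3 * x.1 - 2 * (vertex i).1, 3 * x.2 - 2 * (vertex i).2) : ℝ × ℝ),
          Set.mem_iInter.2 fun n => ?_, ?_⟩)
      · obtain ⟨y, hy, rfl⟩ := hi n
        convert hy using 1
        ext <;> simp only [contr] <;> ring
      · ext <;> simp only [contr] <;> ring
    choose N hN using h1
    have hx' := Set.mem_iInter.1 hx ((Finset.univ.sup N) + 1)
    obtain ⟨i, y, hy, hxy⟩ := Set.mem_iUnion.1 hx'
    exact hN i ⟨y, preCarpet_antitone (Finset.le_sup (Finset.mem_univ i)) hy, hxy⟩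
  · refine Set.iUnion_subset fun i => ?_
    rintro _ ⟨y, hy, rfl⟩
    refine Set.mem_iInter.2 fun n => preCarpet_succ_subset n ?_
    exact Set.mem_iUnion.2 ⟨i, y, Set.mem_iInter.1 hy n, rfl⟩

theorem carpet_unique (E : Set (ℝ × ℝ)) (hc : IsCompact E) (hne : E.Nonempty)
    (hE : E = ⋃ i, contr i '' E) : E = carpet := by
  have hpre : ∀ x ∈ E, ∃ i, ∃ y ∈ E, contr i y = x := by
    intro x hx
    rw [hE] at hx
    simpa using hx
  have hsq : E ⊆ preCarpet 0 := by
    obtain ⟨u, hu, hu'⟩ := hc.exists_isMaxOn hne continuous_fst.continuousOn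
    obtain ⟨v, hv, hv'⟩ := hc.exists_isMinOn hne continuous_fst.continuousOn
    obtain ⟨s, hs, hs'⟩ := hc.exists_isMaxOn hne continuous_snd.continuousOn
    obtain ⟨t, ht, ht'⟩ := hc.exists_isMinOn hne continuous_snd.continuousOn
    have e1 : u.1 ≤ 1 := by
      obtain ⟨i, y, hy, hyx⟩ := hpre u hu
      have h := hu' hy
      simp only [Set.mem_ofPred_eq, ← hyx, contr] at h ⊢
      linarith [vertex_mem i]
    have e2 : 0 ≤ v.1 := by
      obtain ⟨i, y, hy, hyx⟩ := hpre v hv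
      have h := hv' hy
      simp only [Set.mem_ofPred_eq, ← hyx, contr] at h ⊢
      linarith [vertex_mem i]
    have e3 : s.2 ≤ 1 := by
      obtain ⟨i, y, hy, hyx⟩ := hpre s hs
      have h := hs' hy
      simp only [Set.mem_ofPred_eq, ← hyx, contr] at h ⊢
      linarith [vertex_mem i]
    have e4 : 0 ≤ t.2 := by
      obtain ⟨i, y, hy, hyx⟩ := hpre t ht
      have h := ht' hy
      simp only [Set.mem_ofPred_eq, ← hyx, contr] at h ⊢
      linarith [vertex_mem i]
    intro x hx
    exact ⟨⟨e2.trans (hv' hx), (hu' hx).trans e1⟩, e4.trans (ht' hx), (hs' hx).trans e3⟩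
  apply Set.Subset.antisymm
  · refine Set.subset_iInter fun n => ?_
    induction n with
    | zero => exact hsq
    | succ n ih =>
      rw [hE]
      exact Set.iUnion_mono fun i => Set.image_mono ih
  · intro x hx
    have key : ∀ n, ∀ z ∈ preCarpet n, ∃ y ∈ E, dist z y ≤ (1 / 3 : ℝ) ^ n := by
      intro n
      induction n with
      | zero =>
        rintro z ⟨⟨h1, h2⟩, h3, h4⟩
        obtain ⟨y, hy⟩ := hne
        obtain ⟨⟨k1, k2⟩, k3, k4⟩ := hsq hy
        refine ⟨y, hy, ?_⟩
        rw [Prod.dist_eq, Real.dist_eq, Real.dist_eq, pow_zero]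
        exact max_le (abs_le.2 ⟨by linarith, by linarith⟩) (abs_le.2 ⟨by linarith, by linarith⟩)
      | succ n ih =>
        intro z hz
        obtain ⟨i, w, hw, rfl⟩ := Set.mem_iUnion.1 hz
        obtain ⟨y, hy, hd⟩ := ih w hw
        refine ⟨contr i y, ?_, ?_⟩
        · rw [hE]
          exact Set.mem_iUnion.2 ⟨i, y, hy, rfl⟩
        · rw [Prod.dist_eq, Real.dist_eq, Real.dist_eq] at hd ⊢
          have h1 := abs_le.1 ((le_max_left _ _).trans hd)
          have h2 := abs_le.1 ((le_max_right _ _).trans hd)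
          simp only [contr, pow_succ]
          exact max_le (abs_le.2 ⟨by linarith, by linarith⟩) (abs_le.2 ⟨by linarith, by linarith⟩)
    rw [← hc.isClosed.closure_eq, Metric.mem_closure_iff]
    intro ε hε
    obtain ⟨n, hn⟩ := exists_pow_lt_of_lt_one hε (show (1 / 3 : ℝ) < 1 by norm_num)
    obtain ⟨y, hy, hd⟩ := key n x (Set.mem_iInter.1 hx n)
    exact ⟨y, hy, hd.trans_lt hn⟩

/-- Finite words over the alphabet of eight letters (the empty word included). -/
abbrev Word : Type := List (Fin 8)

/-- `F_w = F_{w_1} ∘ ⋯ ∘ F_{w_n}`. -/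
noncomputable def wordMap (w : Word) (x : ℝ × ℝ) : ℝ × ℝ := w.foldr contr x

/-- The cell `K_w = F_w(K)`. -/
noncomputable def cell (w : Word) : Set (ℝ × ℝ) := wordMap w '' carpet

/-- A chain between `x` and `y`: a nonempty finite sequence of words such that consecutive cells
intersect, `x` lies in the first cell and `y` lies in the last one. -/
structure IsChainBetween (γ : List Word) (x y : ℝ × ℝ) : Prop where
  ne_nil : γ ≠ []
  chain : γ.IsChain fun w v => (cell w ∩ cell v).Nonempty
  left_mem : x ∈ cell (γ.head ne_nil)
  right_mem : y ∈ cell (γ.getLast ne_nil)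

/-- `D_g(x, y)` is the infimum of the total weights of the chains between the points `x` and `y`
of the carpet. -/
noncomputable def chainDist (g : Word → ℝ) (x y : carpet) : ℝ :=
  sInf {r : ℝ | ∃ γ : List Word, IsChainBetween γ x y ∧ r = (γ.map g).sum}

/-- The ratio `r_j`: it is `a` on the labels `1, 3, 5, 7` (corners, even index) and `b` on the
labels `2, 4, 6, 8` (midpoints, odd index). -/
def ratio (a b : ℝ) (j : Fin 8) : ℝ := if Even j.val then a else b

/-- The self-similar weight function `g_{a,b}(w) = r_{w_1} ⋯ r_{w_n}`. -/
def weight (a b : ℝ) (w : Word) : ℝ := (w.map (ratio a b)).prod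

/-- The parameter set `σ`. -/
def paramSet : Set (ℝ × ℝ) :=
  {q | 0 < q.1 ∧ q.1 < 1 ∧ 0 < q.2 ∧ q.2 < 1 ∧ 1 ≤ 2 * q.1 + q.2 ∧ 1 ≤ q.1 + 2 * q.2}

/-- The sup-metric on the carpet. -/
def supDist (p q : carpet) : ℝ := max |p.1.1 - q.1.1| |p.1.2 - q.1.2|

/-- The Euclidean metric on the carpet. -/
noncomputable def euclDist (p q : carpet) : ℝ :=
  √((p.1.1 - q.1.1) ^ 2 + (p.1.2 - q.1.2) ^ 2)

/-- `ρ` is a metric on `M`. -/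
structure IsMetric {M : Type*} (ρ : M → M → ℝ) : Prop where
  nonneg : ∀ p q, 0 ≤ ρ p q
  eq_zero_iff : ∀ p q, ρ p q = 0 ↔ p = q
  symm : ∀ p q, ρ p q = ρ q p
  triangle : ∀ p q s, ρ p s ≤ ρ p q + ρ q s

/-- `ρ` is quasisymmetric to `d` with the control function `h`, a homeomorphism of `[0, ∞)` onto
itself with `h 0 = 0`. -/
structure QuasisymmetricWith {M : Type*} (h : ℝ≥0 ≃ₜ ℝ≥0) (ρ d : M → M → ℝ) : Prop where
  map_zero : h 0 = 0
  control : ∀ t : ℝ≥0, 0 < t → ∀ p q s : M, d p s < t * d p q → ρ p s < h t * ρ p q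

/-- `ρ` is quasisymmetric to `d`. -/
def Quasisymmetric {M : Type*} (ρ d : M → M → ℝ) : Prop :=
  ∃ h : ℝ≥0 ≃ₜ ℝ≥0, QuasisymmetricWith h ρ d

end SierpinskiCarpet

open SierpinskiCarpet

namespace SierpinskiCarpet

/-! Upper bounds for the chain distance are cheap: two points at sup-distance less than `3 ^ (-n)`
lie in two level-`n` cells that meet, and squares of equal level that touch have comparable weights
(`weight_le_of_adjacent`). The substance is the lower bound `exists_le_weight_sum`: a chain that
starts in `K_w` and ends more than two side lengths away has total weight at least `δ * weight a b
w`, with `δ` independent of `w` and of the chain.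

The lower bound is obtained by duality. Suppose that on every grid of level `N` there is a function
that is `0` on the left side of the square, a constant `c > 0` on the right side, and oscillates on
the square of each word `w` by at most a constant, independent of `N`, times the weight of `w`
(`HasCrossingPotentials`). Reflected copies of it are assembled around the square of `w` into a
function `tent` that vanishes on this square and equals `c` beyond its neighbours, with oscillation
on the square of `v` of order `weight v / weight w` (`exists_tent_osc`). Consecutive cells of a
chain share a grid point after refinement, so the increments telescope and the chain must pay for
the total rise `c`.

The potentials are built by subdivision. Finite data on the four sides of a square, admissible at
scale `r`, are extended to the eight subsquares so that the data there are admissible at the scales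
`a * r` and `b * r`; no condition is imposed in the central hole. Once this single step is possible
(`EdgeSystem.Extends`), iteration and a geometric series give the potential
(`EdgeSystem.Extends.exists_potential`). The step is carried out in three regimes. For `b ≥ 1/3`
functions of the first coordinate suffice, by `2a + b ≥ 1`. For `b < 1/3` the condition `a + 2b ≥ 1`
and monotonicity in `a` reduce to `a = 1 - 2b`. If `b ≤ 1/4`, the data are corner values and one
value on the middle third of each side, and the new values are found by Helly's theorem on the line
and on a four-cycle (`MidAdmissible.exists_children`). If `1/4 < b < 1/3`, the data are values at
the points dividing the sides into thirds, Lipschitz for a combination of two integer distances; the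
extension is of McShane type, and its hypotheses are finitely many integer inequalities
(`potential_le`, `transportCost_le`).

Quasisymmetry follows by comparing the prefixes of one address of `p` at the scales of the two
distances: the weights of the prefixes differ by one factor between `a ∧ b` and `a ∨ b` per level,
whence the two exponents. -/

/-! ### Regime `b ≤ 1/4`: the value on an edge of the hole -/

/-- Helly's theorem in dimension one: the intervals with centres `c i` and radii `ρ i` meet
pairwise, and the largest left end point lies in all of them. -/
theorem exists_forall_abs_sub_le {ι : Type*} [Fintype ι] [Nonempty ι] (c ρ : ι → ℝ)
    (H : ∀ i j, c i - c j ≤ ρ i + ρ j) : ∃ s, ∀ i, |s - c i| ≤ ρ i := by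
  refine ⟨Finset.univ.sup' Finset.univ_nonempty fun i => c i - ρ i, fun i => abs_le.2 ⟨?_, ?_⟩⟩
  · linarith [Finset.le_sup' (fun i => c i - ρ i) (Finset.mem_univ i)]
  · have : (Finset.univ.sup' Finset.univ_nonempty fun i => c i - ρ i) ≤ c i + ρ i :=
      Finset.sup'_le _ _ fun j _ => by linarith [H j i]
    linarith

-- This is the choice of the middle value on the side of a middle subsquare that faces the hole. In
-- normalized form the outer side carries the value `0`, the hole vertices are `h` and `k`, and the
-- two lateral sides carry `2 * b * h + d` and `2 * b * k + d'`, that is, interpolated values with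
-- errors `d`, `d'`. The nine conclusions are the conditions of `MidAdmissible` that involve the new
-- value `s`; each confines `s` to an interval, and Helly's theorem applies.
set_option maxHeartbeats 1600000 in
theorem exists_mid_of_hole_edge {b h k d d' : ℝ} (hb : 0 < b) (hb4 : b ≤ 1 / 4)
    (h1 : |h| ≤ 1) (h2 : |k| ≤ 1) (h3 : |h - k| ≤ 1) (h4 : |d| ≤ 2 * b ^ 2) (h5 : |d'| ≤ 2 * b ^ 2)
    (h6 : |2 * b * h + d| ≤ 2 * b) (h7 : |2 * b * k + d'| ≤ 2 * b)
    (h8 : |2 * b * h + d - h| ≤ 1 - 2 * b) (h9 : |2 * b * k + d' - k| ≤ 1 - 2 * b)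
    (h10 : |2 * b * h + d - k| ≤ 1) (h11 : |2 * b * k + d' - h| ≤ 1) :
    ∃ s, |s| ≤ 3 * b ∧ |s - h| ≤ 1 - 2 * b ∧ |s - k| ≤ 1 - 2 * b ∧
      |s - (2 * b * h + d)| ≤ 2 * b ∧ |s - (2 * b * k + d')| ≤ 2 * b ∧
      |s - (2 * b * h + (1 - 2 * b) * (2 * b * h + d))| ≤ 2 * b ∧
      |s - (2 * b * k + (1 - 2 * b) * (2 * b * k + d'))| ≤ 2 * b ∧
      |(1 - 2 * b) * s - d| ≤ 2 * b ∧ |(1 - 2 * b) * s - d'| ≤ 2 * b := by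
  have ha : 0 < 1 - 2 * b := by linarith
  -- Dividing the last two constraints by `1 - 2 * b` turns them into intervals with centres `D`,
  -- `D'` and radius `R`.
  obtain ⟨D, rfl⟩ : ∃ D, d = (1 - 2 * b) * D := ⟨d / (1 - 2 * b), by field_simp⟩
  obtain ⟨D', rfl⟩ : ∃ D', d' = (1 - 2 * b) * D' := ⟨d' / (1 - 2 * b), by field_simp⟩
  obtain ⟨R, hR⟩ : ∃ R, 2 * b = (1 - 2 * b) * R := ⟨2 * b / (1 - 2 * b), by field_simp⟩
  have hR1 : R ≤ 1 := by nlinarith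
  have hR0 : 2 * b ≤ R := by nlinarith
  have hD : |D| ≤ b := by
    rw [abs_mul, abs_of_pos ha] at h4
    nlinarith [abs_nonneg D]
  have hD' : |D'| ≤ b := by
    rw [abs_mul, abs_of_pos ha] at h5
    nlinarith [abs_nonneg D']
  rw [abs_le] at *
  obtain ⟨h1, h1'⟩ := h1
  obtain ⟨h2, h2'⟩ := h2
  obtain ⟨h3, h3'⟩ := h3
  obtain ⟨h4, h4'⟩ := h4
  obtain ⟨h5, h5'⟩ := h5
  obtain ⟨h6, h6'⟩ := h6
  obtain ⟨h7, h7'⟩ := h7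
  obtain ⟨h8, h8'⟩ := h8
  obtain ⟨h9, h9'⟩ := h9
  obtain ⟨h10, h10'⟩ := h10
  obtain ⟨h11, h11'⟩ := h11
  obtain ⟨hD, hd⟩ := hD
  obtain ⟨hD', hd'⟩ := hD'
  have k1 : -(b * R) ≤ D := by nlinarith
  have k2 : D ≤ b * R := by nlinarith
  have k3 : -(b * R) ≤ D' := by nlinarith
  have k4 : D' ≤ b * R := by nlinarith
  have k5 : 2 * b + b * R ≤ R := by nlinarith
  have hbb : b * b ≤ b / 4 := by nlinarith
  have hbbb : b * b * b ≤ b * b / 4 := by nlinarith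
  obtain ⟨s, hs⟩ := exists_forall_abs_sub_le
    ![0, h, k, 2 * b * h + (1 - 2 * b) * D, 2 * b * k + (1 - 2 * b) * D',
      2 * b * h + (1 - 2 * b) * (2 * b * h + (1 - 2 * b) * D),
      2 * b * k + (1 - 2 * b) * (2 * b * k + (1 - 2 * b) * D'), D, D']
    ![3 * b, 1 - 2 * b, 1 - 2 * b, 2 * b, 2 * b, 2 * b, 2 * b, R, R] (by
      have e1 := mul_le_mul_of_nonneg_left h3 hb.le
      have e2 := mul_le_mul_of_nonneg_left h3' hb.le
      have e3 := mul_le_mul_of_nonneg_left h3 (mul_nonneg hb.le ha.le)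
      have e4 := mul_le_mul_of_nonneg_left h3' (mul_nonneg hb.le ha.le)
      have e5 := mul_le_mul_of_nonneg_left h1 hb.le
      have e6 := mul_le_mul_of_nonneg_left h1' hb.le
      have e7 := mul_le_mul_of_nonneg_left h2 hb.le
      have e8 := mul_le_mul_of_nonneg_left h2' hb.le
      have f4 := mul_le_mul_of_nonneg_left h4 ha.le
      have f4' := mul_le_mul_of_nonneg_left h4' ha.le
      have f5 := mul_le_mul_of_nonneg_left h5 ha.le
      have f5' := mul_le_mul_of_nonneg_left h5' ha.le
      have f6 := mul_le_mul_of_nonneg_left h6 ha.le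
      have f6' := mul_le_mul_of_nonneg_left h6' ha.le
      have f7 := mul_le_mul_of_nonneg_left h7 ha.le
      have f7' := mul_le_mul_of_nonneg_left h7' ha.le
      have f8 := mul_le_mul_of_nonneg_left h8 ha.le
      have f8' := mul_le_mul_of_nonneg_left h8' ha.le
      have f9 := mul_le_mul_of_nonneg_left h9 ha.le
      have f9' := mul_le_mul_of_nonneg_left h9' ha.le
      have f10 := mul_le_mul_of_nonneg_left h10 ha.le
      have f10' := mul_le_mul_of_nonneg_left h10' ha.le
      have f11 := mul_le_mul_of_nonneg_left h11 ha.le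
      have f11' := mul_le_mul_of_nonneg_left h11' ha.le
      have g1 := mul_le_mul_of_nonneg_left hD hb.le
      have g2 := mul_le_mul_of_nonneg_left hd hb.le
      have g3 := mul_le_mul_of_nonneg_left hD' hb.le
      have g4 := mul_le_mul_of_nonneg_left hd' hb.le
      have g5 := mul_le_mul_of_nonneg_left g1 hb.le
      have g6 := mul_le_mul_of_nonneg_left g2 hb.le
      have g7 := mul_le_mul_of_nonneg_left g3 hb.le
      have g8 := mul_le_mul_of_nonneg_left g4 hb.le
      intro i j
      fin_cases i <;> fin_cases j <;>
        simp only [Fin.zero_eta, Fin.mk_one, Fin.reduceFinMk, Matrix.cons_val] <;>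
        linarith)
  have q0 := hs 0
  have q1 := hs 1
  have q2 := hs 2
  have q3 := hs 3
  have q4 := hs 4
  have q5 := hs 5
  have q6 := hs 6
  have q7 := hs 7
  have q8 := hs 8
  simp only [Matrix.cons_val, sub_zero] at q0 q1 q2 q3 q4 q5 q6 q7 q8
  refine ⟨s, q0, q1, q2, q3, q4, q5, q6, ?_, ?_⟩
  · have := mul_le_mul_of_nonneg_left q7 ha.le
    rwa [← hR, ← abs_of_pos ha, ← abs_mul, mul_sub] at this
  · have := mul_le_mul_of_nonneg_left q8 ha.le
    rwa [← hR, ← abs_of_pos ha, ← abs_mul, mul_sub] at this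

/-! ### Regime `b ≤ 1/4`: compatibility of the constraints on the vertices of the hole -/

/-- Here and in the next four lemmas `v`, `w` are corner values and `B`, `T`, `L`, `R` middle values
of sides. The minimum on the right is the radius, around a corner value, of the interval allowed for
the adjacent hole vertex. The lemmas are the pairwise conditions needed for the Helly argument in
`exists_hole`; the hypotheses with the factor `A` are the fields `xh` and `xu` of `MidAdmissible`,
divided by `2 * b`. -/
theorem abs_corner_sub_third_le {b A v B L : ℝ} (hb : 0 < b) (hb4 : b ≤ 1 / 4)
    (hA : 2 * b * A = 1 - 2 * b)
    (h1 : |v - B| ≤ 1 - 2 * b) (h3 : |B - L| ≤ 2 * b)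
    (h4 : |B - v + A * (B - L)| ≤ 1) (h5 : |L - v + A * (L - B)| ≤ 1) :
    |v - B| ≤ b + min (1 - 2 * b) (3 / 2 * (1 - 2 * b) + b ^ 2 - |A * (B - L)|) := by
  rw [abs_le] at h1 h3 h4 h5
  rw [← min_add_add_left]
  refine le_min (abs_le.2 ⟨by linarith, by linarith⟩) ?_
  rcases abs_cases (A * (B - L)) with ⟨h, h'⟩ | ⟨h, h'⟩ <;> rw [h]
  · have : 0 ≤ B - L := by
      by_contra! hn
      nlinarith
    exact abs_le.2 ⟨by nlinarith, by nlinarith⟩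
  · have : B - L ≤ 0 := by
      by_contra! hn
      nlinarith
    exact abs_le.2 ⟨by nlinarith, by nlinarith⟩

theorem corner_sub_adjacent_third_le {b A v B L R : ℝ} (hb : 0 < b) (hb4 : b ≤ 1 / 4)
    (hA : 2 * b * A = 1 - 2 * b)
    (h1 : v - B ≤ 1 - 2 * b)
    (h4 : v - B + A * (R - B) ≤ 1) (h5 : v - R + A * (B - R) ≤ 1)
    (h6 : B - L ≤ 2 * b) (h7 : R - L ≤ 3 * b) (h8 : v - L ≤ 1) :
    v - L ≤ 2 * b + (3 / 2 * (1 - 2 * b) + b ^ 2 - |A * (B - R)|) := by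
  have hA1 : 1 ≤ A := by nlinarith
  have ha : 0 < 1 - 2 * b := by linarith
  rcases abs_cases (A * (B - R)) with ⟨h, h'⟩ | ⟨h, h'⟩ <;> rw [h]
  · have e1 := mul_le_mul_of_nonneg_left h8 hb.le
    have e2 := mul_le_mul_of_nonneg_left h5 ha.le
    have e3 := mul_le_mul_of_nonneg_left h6 ha.le
    have e4 : (1 - 2 * b) * (B - R) = 2 * b * (A * (B - R)) := by rw [← hA]; ring
    nlinarith [sq_nonneg (b - 3 / 10)]
  · have h0 : A * (v - B + A * (R - B) + (B - L)) ≤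
        A * (2 * b + (3 / 2 * (1 - 2 * b) + b ^ 2)) := by
      have e1 := mul_le_mul_of_nonneg_left h4 (by linarith : 0 ≤ A - 1)
      have e2 := mul_le_mul_of_nonneg_left h7 (by linarith : 0 ≤ A)
      -- The slack of the claimed inequality is `A + 1` times `1/2 - 5b + 13b² - 2b³`, and this
      -- polynomial is `25/2 (b - 1/5)² + (b²/2 - 2b³)`, nonnegative for `b ≤ 1/4`.
      have e3 : A * (25 / 2 * (b - 1 / 5) ^ 2 + b ^ 2 / 2 - 2 * b ^ 3) ≥ 0 := by
        have : b ^ 2 / 2 - 2 * b ^ 3 ≥ 0 := by nlinarith [sq_nonneg b]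
        have := sq_nonneg (b - 1 / 5)
        exact mul_nonneg (by linarith) (by linarith)
      have e4 : A * b = (1 - 2 * b) / 2 := by linarith
      have e5 : A * b ^ 2 = (1 - 2 * b) / 2 * b := by rw [← e4]; ring
      have e6 : A * b ^ 3 = (1 - 2 * b) / 2 * b ^ 2 := by rw [← e4]; ring
      have e7 : 25 / 2 * (b - 1 / 5) ^ 2 + (b ^ 2 / 2 - 2 * b ^ 3) ≥ 0 := by
        have : b ^ 2 / 2 - 2 * b ^ 3 ≥ 0 := by nlinarith [sq_nonneg b]
        have := sq_nonneg (b - 1 / 5)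
        linarith
      linarith
    have := le_of_mul_le_mul_left h0 (by linarith)
    linarith

theorem abs_adjacent_third_sub_corner_le {b A v B L R : ℝ} (hb : 0 < b) (hb4 : b ≤ 1 / 4)
    (hA : 2 * b * A = 1 - 2 * b)
    (h1 : |v - B| ≤ 1 - 2 * b)
    (h4 : |B - v + A * (B - R)| ≤ 1) (h5 : |R - v + A * (R - B)| ≤ 1)
    (h6 : |B - L| ≤ 2 * b) (h7 : |L - R| ≤ 3 * b) (h8 : |v - L| ≤ 1) :
    |L - v| ≤ 2 * b + min (1 - 2 * b) (3 / 2 * (1 - 2 * b) + b ^ 2 - |A * (B - R)|) := by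
  rw [abs_le] at h1 h4 h5 h6 h7 h8
  rw [← min_add_add_left]
  refine le_min (abs_le.2 ⟨by linarith, by linarith⟩) ?_
  refine abs_le.2 ⟨?_, ?_⟩
  · have := corner_sub_adjacent_third_le (v := v) (B := B) (L := L) (R := R) hb hb4 hA
      (by linarith) (by linarith) (by linarith) (by linarith) (by linarith) (by linarith)
    linarith
  · have := corner_sub_adjacent_third_le (v := -v) (B := -B) (L := -L) (R := -R) hb hb4 hA
      (by linarith) (by linarith) (by linarith) (by linarith) (by linarith) (by linarith)
    rw [show A * (-B - -R) = -(A * (B - R)) by ring, abs_neg] at this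
    linarith

theorem abs_adjacent_corner_sub_le {b A v w B L R : ℝ} (hb : 0 < b) (hb4 : b ≤ 1 / 4)
    (hA : 2 * b * A = 1 - 2 * b)
    (h1 : |v - B| ≤ 1 - 2 * b) (h2 : |w - B| ≤ 1 - 2 * b)
    (h3 : |B - L| ≤ 2 * b) (h3' : |B - R| ≤ 2 * b)
    (h4 : |B - v + A * (B - L)| ≤ 1) (h5 : |L - v + A * (L - B)| ≤ 1)
    (h4' : |B - w + A * (B - R)| ≤ 1) (h5' : |R - w + A * (R - B)| ≤ 1)
    (h7 : |L - R| ≤ 3 * b) (h8 : |v - w| ≤ 1) :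
    |v - w| ≤ b + min (1 - 2 * b) (3 / 2 * (1 - 2 * b) + b ^ 2 - |A * (B - L)|) +
      min (1 - 2 * b) (3 / 2 * (1 - 2 * b) + b ^ 2 - |A * (B - R)|) := by
  have hA1 : 1 ≤ A := by nlinarith
  rw [abs_le] at *
  have e1 := mul_le_mul_of_nonneg_left h3.1 (by linarith : 0 ≤ A)
  have e2 := mul_le_mul_of_nonneg_left h3.2 (by linarith : 0 ≤ A)
  have e3 := mul_le_mul_of_nonneg_left h3'.1 (by linarith : 0 ≤ A)
  have e4 := mul_le_mul_of_nonneg_left h3'.2 (by linarith : 0 ≤ A)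
  have e5 := mul_le_mul_of_nonneg_left h7.1 (by linarith : 0 ≤ A)
  have e6 := mul_le_mul_of_nonneg_left h7.2 (by linarith : 0 ≤ A)
  have hb2 := sq_nonneg b
  have m1 : |A * (B - L)| ≤ 1 - 2 * b := abs_le.2 ⟨by linarith, by linarith⟩
  have m2 : |A * (B - R)| ≤ 1 - 2 * b := abs_le.2 ⟨by linarith, by linarith⟩
  have a1 := le_abs_self (A * (B - L))
  have a2 := neg_abs_le (A * (B - L))
  have a3 := le_abs_self (A * (B - R))
  have a4 := neg_abs_le (A * (B - R))
  have big : ∀ y : ℝ, (1 - b) * (1 - 2 * b) ≤ A * y → 2 * b * (1 - b) ≤ y := fun y hy => by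
    refine le_of_mul_le_mul_left (a := A) ?_ (by linarith)
    calc A * (2 * b * (1 - b)) = (1 - b) * (2 * b * A) := by ring
      _ ≤ A * y := by rwa [hA]
  have last : -(b + (3 / 2 * (1 - 2 * b) + b ^ 2 - |A * (B - L)|) +
        (3 / 2 * (1 - 2 * b) + b ^ 2 - |A * (B - R)|)) ≤ v - w ∧
      v - w ≤ b + (3 / 2 * (1 - 2 * b) + b ^ 2 - |A * (B - L)|) +
        (3 / 2 * (1 - 2 * b) + b ^ 2 - |A * (B - R)|) := by
    -- The threshold is chosen so that, if one of the two absolute values lies below it, the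
    -- right-hand side is at least `1` and the bound `h8` suffices. If both lie above it, opposite
    -- signs contradict `|L - R| ≤ 3 * b`, and for equal signs the `A`-inequalities at the two
    -- corners combine to the claim.
    by_cases c1 : |A * (B - L)| ≤ (1 - b) * (1 - 2 * b)
    · constructor <;> linarith
    by_cases c2 : |A * (B - R)| ≤ (1 - b) * (1 - 2 * b)
    · constructor <;> linarith
    push Not at c1 c2
    rcases abs_cases (A * (B - L)) with ⟨h, h'⟩ | ⟨h, h'⟩ <;>
    rcases abs_cases (A * (B - R)) with ⟨g, g'⟩ | ⟨g, g'⟩ <;> rw [h] at c1 ⊢ <;> rw [g] at c2 ⊢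
    · have := big _ c1.le
      have := big _ c2.le
      constructor <;> linarith
    · constructor <;> linarith
    · constructor <;> linarith
    · have := big (L - B) (by linarith)
      have := big (R - B) (by linarith)
      constructor <;> linarith
  rcases min_choice (1 - 2 * b) (3 / 2 * (1 - 2 * b) + b ^ 2 - |A * (B - L)|) with c1 | c1 <;>
  rcases min_choice (1 - 2 * b) (3 / 2 * (1 - 2 * b) + b ^ 2 - |A * (B - R)|) with c2 | c2 <;>
  rw [c1, c2]
  · constructor <;> linarith
  · constructor <;> linarith
  · constructor <;> linarith
  · exact last

theorem abs_opposite_corner_sub_le {b A v w B T L R : ℝ} (hb : 0 < b) (hb4 : b ≤ 1 / 4)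
    (hA : 2 * b * A = 1 - 2 * b)
    (h3 : |B - L| ≤ 2 * b) (h3' : |T - R| ≤ 2 * b)
    (h4 : |B - v + A * (B - L)| ≤ 1) (h5 : |L - v + A * (L - B)| ≤ 1)
    (h4' : |T - w + A * (T - R)| ≤ 1) (h5' : |R - w + A * (R - T)| ≤ 1)
    (h6 : |B - T| ≤ 3 * b) (h7 : |L - R| ≤ 3 * b) (h9 : |B - R| ≤ 2 * b) (h10 : |T - L| ≤ 2 * b)
    (h8 : |v - w| ≤ 1) :
    |v - w| ≤ 2 * b + min (1 - 2 * b) (3 / 2 * (1 - 2 * b) + b ^ 2 - |A * (B - L)|) +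
      min (1 - 2 * b) (3 / 2 * (1 - 2 * b) + b ^ 2 - |A * (T - R)|) := by
  have hA1 : 1 ≤ A := by nlinarith
  rw [abs_le] at *
  have e1 := mul_le_mul_of_nonneg_left h3.1 (by linarith : 0 ≤ A)
  have e2 := mul_le_mul_of_nonneg_left h3.2 (by linarith : 0 ≤ A)
  have e3 := mul_le_mul_of_nonneg_left h3'.1 (by linarith : 0 ≤ A)
  have e4 := mul_le_mul_of_nonneg_left h3'.2 (by linarith : 0 ≤ A)
  have hb2 := sq_nonneg b
  have m1 : |A * (B - L)| ≤ 1 - 2 * b := abs_le.2 ⟨by linarith, by linarith⟩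
  have m2 : |A * (T - R)| ≤ 1 - 2 * b := abs_le.2 ⟨by linarith, by linarith⟩
  rcases min_choice (1 - 2 * b) (3 / 2 * (1 - 2 * b) + b ^ 2 - |A * (B - L)|) with c1 | c1 <;>
  rcases min_choice (1 - 2 * b) (3 / 2 * (1 - 2 * b) + b ^ 2 - |A * (T - R)|) with c2 | c2 <;>
  rw [c1, c2] <;> constructor <;> linarith

/-! ### Regime `b ≤ 1/4`: the values on the edges leading to the hole -/

/-- The middle value on the edge from the third point `B` of a side to the hole vertex `h`. -/
noncomputable def innerMid (b v B L h : ℝ) : ℝ :=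
  max (2 * b * v + (1 - 2 * b) * L - 3 * b * (1 - 2 * b))
    (min (2 * b * v + (1 - 2 * b) * L + 3 * b * (1 - 2 * b)) (2 * b * h + (1 - 2 * b) * B))

/-- `innerMid` clamps the interpolation between `B` and `h` to an interval centred at `2 * b * v +
(1 - 2 * b) * L`. As this interval is nonempty, clamping commutes with negation, so that two-sided
bounds follow from upper bounds. -/
theorem innerMid_neg (b v B L h : ℝ) (hb : 0 < b) (hb4 : b ≤ 1 / 4) :
    innerMid b (-v) (-B) (-L) (-h) = -innerMid b v B L h := by
  have : 0 ≤ 3 * b * (1 - 2 * b) := by nlinarith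
  unfold innerMid
  rcases max_cases (2 * b * v + (1 - 2 * b) * L - 3 * b * (1 - 2 * b))
    (min (2 * b * v + (1 - 2 * b) * L + 3 * b * (1 - 2 * b)) (2 * b * h + (1 - 2 * b) * B))
    with h1 | h1 <;>
  rcases min_cases (2 * b * v + (1 - 2 * b) * L + 3 * b * (1 - 2 * b))
    (2 * b * h + (1 - 2 * b) * B) with h2 | h2 <;>
  rcases max_cases (2 * b * -v + (1 - 2 * b) * -L - 3 * b * (1 - 2 * b))
    (min (2 * b * -v + (1 - 2 * b) * -L + 3 * b * (1 - 2 * b)) (2 * b * -h + (1 - 2 * b) * -B))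
    with h3 | h3 <;>
  rcases min_cases (2 * b * -v + (1 - 2 * b) * -L + 3 * b * (1 - 2 * b))
    (2 * b * -h + (1 - 2 * b) * -B) with h4 | h4 <;> linarith

theorem innerMid_le {b v B L h X : ℝ} (h1 : 2 * b * h + (1 - 2 * b) * B ≤ X)
    (h2 : 2 * b * v + (1 - 2 * b) * L - 3 * b * (1 - 2 * b) ≤ X) : innerMid b v B L h ≤ X :=
  max_le h2 ((min_le_right _ _).trans h1)

/-- By `innerMid_le` a bound has to be checked for the interpolated value and for the lower end of
the clamping interval only. The hypothesis `g4` is tailored to the third bound: multiplied by `2 *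
b`, it says that the lower end exceeds the interpolated value by at most `2 * b ^ 3`. In the fourth
bound the upper end of the interval is what counts. -/
theorem innerMid_upper {b A v B L h : ℝ} (hb : 0 < b) (hb4 : b ≤ 1 / 4)
    (hA : 2 * b * A = 1 - 2 * b)
    (h1 : |v - B| ≤ 1 - 2 * b) (h2 : |v - L| ≤ 1 - 2 * b) (h3 : |B - L| ≤ 2 * b)
    (h4 : |B - v + A * (B - L)| ≤ 1)
    (g1 : |h - B| ≤ b) (g2 : |h - L| ≤ b) (g3 : |v - h| ≤ 1 - 2 * b)
    (g4 : |v - h| ≤ 3 / 2 * (1 - 2 * b) + b ^ 2 - |A * (B - L)|) :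
    innerMid b v B L h - B ≤ 2 * b ^ 2 ∧ innerMid b v B L h - h ≤ (1 - 2 * b) * b ∧
    innerMid b v B L h - (2 * b * h + (1 - 2 * b) * B) ≤ 2 * b ^ 3 ∧
    innerMid b v B L h - (2 * b * v + (1 - 2 * b) * L) ≤ 3 * b * (1 - 2 * b) ∧
    innerMid b v B L h - (2 * b * v + (1 - 2 * b) * B) ≤ 2 * b * (1 - 2 * b) ∧
    innerMid b v B L h - v ≤ 1 - 2 * b ∧ innerMid b v B L h - L ≤ 1 - 2 * b ∧
    innerMid b v B L h - 2 * b * B - (1 - 2 * b) * (2 * b * v + (1 - 2 * b) * B) ≤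
      2 * b * (1 - 2 * b) ∧
    -(2 * b * (1 - 2 * b)) ≤
      2 * b * v + (1 - 2 * b) * B - 2 * b * B - (1 - 2 * b) * innerMid b v B L h ∧
    ∀ x, |x - h| ≤ b → |x - B| ≤ b → innerMid b v B L h - x ≤ b := by
  have ha : 0 < 1 - 2 * b := by linarith
  have hAx : 2 * b * (A * (B - L)) = (1 - 2 * b) * (B - L) := by rw [← hA]; ring
  have p : ∀ {x y : ℝ}, x ≤ y → b * x ≤ b * y := fun h => mul_le_mul_of_nonneg_left h hb.le
  have r : ∀ {x y : ℝ}, x ≤ y → (1 - 2 * b) * x ≤ (1 - 2 * b) * y :=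
    fun h => mul_le_mul_of_nonneg_left h ha.le
  have n := p (((le_abs_self _).trans g4).trans
    (sub_le_sub_left (neg_le_abs (A * (B - L))) _))
  rw [abs_le] at h1 h2 h3 h4 g1 g2 g3
  have c0 : 0 < b * b := by positivity
  have c1 : b * b ≤ b / 4 := by nlinarith
  have c2 : b * b * b ≤ b * b / 4 := by nlinarith
  have c3 : 0 < b * b * b := by positivity
  refine ⟨?_, ?_, ?_, ?_, ?_, ?_, ?_, ?_, ?_, fun x hx hx' => ?_⟩
  · refine sub_le_iff_le_add.2 (innerMid_le ?_ ?_)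
    · linarith [p g1.2]
    · linarith [p h4.1]
  · refine sub_le_iff_le_add.2 (innerMid_le ?_ ?_)
    · linarith [r g1.1]
    · linarith [p g3.2, r g2.1]
  · refine sub_le_iff_le_add.2 (innerMid_le ?_ ?_)
    · linarith
    · linarith
  · refine sub_le_iff_le_add.2 (max_le ?_ ((min_le_left _ _).trans ?_)) <;> linarith
  · refine sub_le_iff_le_add.2 (innerMid_le ?_ ?_)
    · linarith [p g3.1]
    · linarith [r h3.1]
  · refine sub_le_iff_le_add.2 (innerMid_le ?_ ?_)
    · linarith [p g3.1, r h1.1]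
    · linarith [r h2.1]
  · refine sub_le_iff_le_add.2 (innerMid_le ?_ ?_)
    · linarith [p g2.2, r h3.2]
    · linarith [p h2.2]
  · have : innerMid b v B L h ≤ 2 * b * B + (1 - 2 * b) * (2 * b * v + (1 - 2 * b) * B) +
        2 * b * (1 - 2 * b) := by
      refine innerMid_le ?_ ?_
      · linarith [p (r g3.1), p (p g1.2)]
      · linarith [p (p h1.2), r h3.1]
    linarith
  -- The bound on `(1 - 2 * b) * innerMid` is divided by `1 - 2 * b` to take the form required by
  -- `innerMid_le`.
  · have : innerMid b v B L h ≤ (1 - 2 * b) * ((1 - 2 * b)⁻¹ * (2 * b * v + (1 - 2 * b) * B -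
        2 * b * B + 2 * b * (1 - 2 * b))) / (1 - 2 * b) := by
      refine innerMid_le ?_ ?_
      · rw [le_div_iff₀ ha, mul_inv_cancel_left₀ ha.ne']
        linarith [p (p h1.1), p (r g3.1)]
      · rw [le_div_iff₀ ha, mul_inv_cancel_left₀ ha.ne']
        linarith [p (p h1.1), r (r h3.1)]
    rw [le_div_iff₀ ha, mul_inv_cancel_left₀ ha.ne'] at this
    linarith
  · rw [abs_le] at hx hx'
    refine sub_le_iff_le_add.2 (innerMid_le ?_ ?_)
    · linarith [p hx.1, r hx'.1]
    · linarith [p g3.2, r g2.1]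

/-- What the subsquares on both sides of the edge from `B` to `h` require of its middle value `e`.
The middle subsquare uses `base` (its `hu`), `hole` (its `vu`), `hole_adj` (its `vu'` at the other
hole vertex) and `interp` (the size of the error `d` in `exists_mid_of_hole_edge`). The corner
subsquare uses `opp` (its `uu`), `adj` (its `hu`), `corner` and `side` (its `vu'`), and `extra`,
`extra'` (its `xu`, `xh` at the corner `B`). -/
structure InnerMidBounds (b v B L h e : ℝ) : Prop where
  base : |e - B| ≤ 2 * b ^ 2
  hole : |e - h| ≤ (1 - 2 * b) * b
  interp : |e - (2 * b * h + (1 - 2 * b) * B)| ≤ 2 * b ^ 3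
  opp : |e - (2 * b * v + (1 - 2 * b) * L)| ≤ 3 * b * (1 - 2 * b)
  adj : |e - (2 * b * v + (1 - 2 * b) * B)| ≤ 2 * b * (1 - 2 * b)
  corner : |e - v| ≤ 1 - 2 * b
  side : |e - L| ≤ 1 - 2 * b
  extra : |e - 2 * b * B - (1 - 2 * b) * (2 * b * v + (1 - 2 * b) * B)| ≤ 2 * b * (1 - 2 * b)
  extra' : |2 * b * v + (1 - 2 * b) * B - 2 * b * B - (1 - 2 * b) * e| ≤ 2 * b * (1 - 2 * b)
  hole_adj : ∀ x, |x - h| ≤ b → |x - B| ≤ b → |e - x| ≤ b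

theorem innerMid_bounds {b A v B L h : ℝ} (hb : 0 < b) (hb4 : b ≤ 1 / 4)
    (hA : 2 * b * A = 1 - 2 * b)
    (h1 : |v - B| ≤ 1 - 2 * b) (h2 : |v - L| ≤ 1 - 2 * b) (h3 : |B - L| ≤ 2 * b)
    (h4 : |B - v + A * (B - L)| ≤ 1)
    (g1 : |h - B| ≤ b) (g2 : |h - L| ≤ b) (g3 : |v - h| ≤ 1 - 2 * b)
    (g4 : |v - h| ≤ 3 / 2 * (1 - 2 * b) + b ^ 2 - |A * (B - L)|) :
    InnerMidBounds b v B L h (innerMid b v B L h) := by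
  obtain ⟨u1, u2, u3, u4, u5, u6, u7, u8, u9, u10⟩ :=
    innerMid_upper hb hb4 hA h1 h2 h3 h4 g1 g2 g3 g4
  have neg : ∀ x y : ℝ, |-x - -y| = |x - y| := fun x y => by
    rw [← abs_neg (x - y)]; ring_nf
  obtain ⟨l1, l2, l3, l4, l5, l6, l7, l8, l9, l10⟩ :=
    innerMid_upper (b := b) (A := A) (v := -v) (B := -B) (L := -L) (h := -h) hb hb4 hA
      (by rwa [neg]) (by rwa [neg]) (by rwa [neg])
      (by rwa [show -B - -v + A * (-B - -L) = -(B - v + A * (B - L)) by ring, abs_neg])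
      (by rwa [neg]) (by rwa [neg]) (by rwa [neg])
      (by rwa [neg, show A * (-B - -L) = -(A * (B - L)) by ring, abs_neg])
  rw [innerMid_neg _ _ _ _ _ hb hb4] at *
  constructor
  all_goals first
    | exact abs_le.2 ⟨by linarith, by linarith⟩
    | refine fun x hx hx' => abs_le.2 ⟨?_, u10 x hx hx'⟩
      linarith [l10 (-x) (by rwa [neg]) (by rwa [neg])]

/-! ### Regime `b ≤ 1/4`: admissible data and their extension to the subsquares -/

/-- Admissibility at scale `r` of boundary data on a square: `v s t` are the values at the corners,
`H t` those on the middle parts of the two horizontal sides, `U s` those on the middle parts of the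
two vertical sides. -/
structure MidAdmissible (b r : ℝ) (v : Bool → Bool → ℝ) (H U : Bool → ℝ) : Prop where
  hh : |H false - H true| ≤ 3 * b * r
  uu : |U false - U true| ≤ 3 * b * r
  hu : ∀ s t, |H t - U s| ≤ 2 * b * r
  vh : ∀ s t, |v s t - H t| ≤ (1 - 2 * b) * r
  vu : ∀ s t, |v s t - U s| ≤ (1 - 2 * b) * r
  vh' : ∀ s t, |v s (!t) - H t| ≤ r
  vu' : ∀ s t, |v (!s) t - U s| ≤ r
  vv : ∀ s t s' t', |v s t - v s' t'| ≤ r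
  xh : ∀ s t, |H t - 2 * b * v s t - (1 - 2 * b) * U s| ≤ 2 * b * r
  xu : ∀ s t, |U s - 2 * b * v s t - (1 - 2 * b) * H t| ≤ 2 * b * r

namespace MidAdmissible

variable {b r : ℝ} {v : Bool → Bool → ℝ} {H U : Bool → ℝ}

theorem hh_not (h : MidAdmissible b r v H U) (t : Bool) : |H t - H (!t)| ≤ 3 * b * r := by
  cases t
  · exact h.hh
  · rw [abs_sub_comm]; exact h.hh

theorem uu_not (h : MidAdmissible b r v H U) (t : Bool) : |U t - U (!t)| ≤ 3 * b * r := by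
  cases t
  · exact h.uu
  · rw [abs_sub_comm]; exact h.uu

theorem swap (h : MidAdmissible b r v H U) : MidAdmissible b r (fun s t => v t s) U H where
  hh := h.uu
  uu := h.hh
  hu s t := by rw [abs_sub_comm]; exact h.hu t s
  vh s t := h.vu t s
  vu s t := h.vh t s
  vh' s t := h.vu' t s
  vu' s t := h.vh' t s
  vv s t s' t' := h.vv t s t' s'
  xh s t := h.xu t s
  xu s t := h.xh t s

theorem flip (h : MidAdmissible b r v H U) (p q : Bool) :
    MidAdmissible b r (fun s t => v (s ^^ p) (t ^^ q)) (fun t => H (t ^^ q))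
      (fun s => U (s ^^ p)) where
  hh := by cases q <;> [exact h.hh; exact h.hh_not true]
  uu := by cases p <;> [exact h.uu; exact h.uu_not true]
  hu s t := h.hu _ _
  vh s t := h.vh _ _
  vu s t := h.vu _ _
  vh' s t := by simpa using h.vh' (s ^^ p) (t ^^ q)
  vu' s t := by simpa using h.vu' (s ^^ p) (t ^^ q)
  vv s t s' t' := h.vv _ _ _ _
  xh s t := h.xh _ _
  xu s t := h.xu _ _

theorem smul (h : MidAdmissible b r v H U) {c : ℝ} (hc : 0 ≤ c) :
    MidAdmissible b (r * c) (fun s t => c * v s t) (fun t => c * H t) (fun s => c * U s) := by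
  have key : ∀ x y : ℝ, |x| ≤ y * r → ∀ z, z = c * x → |z| ≤ y * (r * c) := fun x y hx z hz => by
    rw [hz, abs_mul, abs_of_nonneg hc, ← mul_assoc, mul_comm]
    gcongr
  have key1 : ∀ x : ℝ, |x| ≤ r → ∀ z, z = c * x → |z| ≤ r * c := fun x hx z hz => by
    have := key x 1 (by simpa using hx) z hz
    simpa using this
  exact ⟨key _ _ h.hh _ (by ring), key _ _ h.uu _ (by ring),
    fun s t => key _ _ (h.hu s t) _ (by ring),
    fun s t => key _ _ (h.vh s t) _ (by ring), fun s t => key _ _ (h.vu s t) _ (by ring),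
    fun s t => key1 _ (h.vh' s t) _ (by ring), fun s t => key1 _ (h.vu' s t) _ (by ring),
    fun s t s' t' => key1 _ (h.vv s t s' t') _ (by ring),
    fun s t => key _ _ (h.xh s t) _ (by ring), fun s t => key _ _ (h.xu s t) _ (by ring)⟩

theorem congr {v' : Bool → Bool → ℝ} {H' U' : Bool → ℝ} (h : MidAdmissible b r v H U)
    (hv : ∀ s t, v' s t = v s t) (hH : ∀ t, H' t = H t) (hU : ∀ s, U' s = U s) :
    MidAdmissible b r v' H' U' := by
  obtain rfl : v' = v := funext fun s => funext (hv s)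
  obtain rfl : H' = H := funext hH
  obtain rfl : U' = U := funext hU
  exact h

end MidAdmissible

theorem abs_mul_sub_le {c x y z : ℝ} (hc : 0 ≤ c) (h : |x| ≤ y) (hz : z = c * x) : |z| ≤ c * y := by
  rw [hz, abs_mul, abs_of_nonneg hc]
  gcongr

/-- At the outer corner `v` the fields `xh`, `xu` of the child are those of the parent multiplied by
`1 - 2 * b`; this self-reproduction is the reason for their form. They also bound the distance from
`B` to the new middle value on the opposite side by `2 * b`, which is at most the scale `1 - 2 * b`
because `b ≤ 1/4`. -/
theorem MidAdmissible.corner_child_aux {b v B L h e e' : ℝ} (hb : 0 < b) (hb4 : b ≤ 1 / 4)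
    (h1 : |v - B| ≤ 1 - 2 * b) (h2 : |v - L| ≤ 1 - 2 * b) (h3 : |B - L| ≤ 2 * b)
    (h4 : |B - 2 * b * v - (1 - 2 * b) * L| ≤ 2 * b)
    (h5 : |L - 2 * b * v - (1 - 2 * b) * B| ≤ 2 * b)
    (g1 : |h - B| ≤ b) (g2 : |h - L| ≤ b) (g3 : |v - h| ≤ 1 - 2 * b)
    (he : InnerMidBounds b v B L h e) (he' : InnerMidBounds b v L B h e') :
    MidAdmissible b (1 - 2 * b)
      (fun s t => cond t (cond s h L) (cond s B v))
      (fun t => cond t e' (2 * b * v + (1 - 2 * b) * B))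
      (fun s => cond s e (2 * b * v + (1 - 2 * b) * L)) := by
  have ha : 0 ≤ 1 - 2 * b := by linarith
  have hb0 : 0 ≤ 2 * b := by linarith
  have c1 : b * b ≤ b / 4 := by nlinarith
  have c0 : 0 < b * b := by positivity
  have c2 : 0 ≤ (1 - 2 * b) * (1 - 4 * b) := mul_nonneg ha (by linarith)
  have c3 : 0 ≤ (1 - 2 * b) * (1 - 3 * b) := mul_nonneg ha (by linarith)
  have c4 : 0 ≤ (1 - 2 * b) * (b * (2 * b)) := by positivity
  have m1 := abs_mul_sub_le hb0 h1 rfl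
  have m2 := abs_mul_sub_le hb0 h2 rfl
  have n1 := abs_mul_sub_le ha h1 rfl
  have n2 := abs_mul_sub_le ha h2 rfl
  have n3 := abs_mul_sub_le ha h3 rfl
  have n4 := abs_mul_sub_le ha h4 rfl
  have n5 := abs_mul_sub_le ha h5 rfl
  have k1 := abs_mul_sub_le ha g1 rfl
  have k2 := abs_mul_sub_le ha g2 rfl
  have l3 := abs_mul_sub_le hb0 g3 rfl
  have o1 := abs_mul_sub_le ha he.hole rfl
  have o2 := abs_mul_sub_le ha he'.hole rfl
  obtain ⟨p1, p2, -, p4, p5, p6, p7, p8, p9, -⟩ := he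
  obtain ⟨q1, q2, -, q4, q5, q6, q7, q8, q9, -⟩ := he'
  rw [abs_le] at *
  constructor
  · exact abs_le.2 ⟨by dsimp only [cond]; linarith, by dsimp only [cond]; linarith⟩
  · exact abs_le.2 ⟨by dsimp only [cond]; linarith, by dsimp only [cond]; linarith⟩
  all_goals first
    | intro s t
      rw [abs_le]
      rcases s <;> rcases t <;> simp only [cond, Bool.not_true, Bool.not_false] <;> constructor <;>
          linarith
    | intro s t s' t'
      rw [abs_le]
      rcases s <;> rcases t <;> rcases s' <;> rcases t' <;> dsimp only [cond] <;> constructor <;>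
          linarith

/-- In a middle subsquare the outer side is constantly `B` and the lateral values `e`, `d` are
already chosen; only the value `m` on the side facing the hole is free. Translation by `B` and
division by `b` lead to `exists_mid_of_hole_edge`. -/
theorem exists_mid_child_aux {b B h k e d : ℝ} (hb : 0 < b) (hb4 : b ≤ 1 / 4)
    (h1 : |h - B| ≤ b) (h2 : |k - B| ≤ b) (h3 : |h - k| ≤ b)
    (e1 : |e - B| ≤ 2 * b ^ 2) (e2 : |e - h| ≤ (1 - 2 * b) * b)
    (e3 : |e - (2 * b * h + (1 - 2 * b) * B)| ≤ 2 * b ^ 3)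
    (e4 : ∀ x, |x - h| ≤ b → |x - B| ≤ b → |e - x| ≤ b)
    (d1 : |d - B| ≤ 2 * b ^ 2) (d2 : |d - k| ≤ (1 - 2 * b) * b)
    (d3 : |d - (2 * b * k + (1 - 2 * b) * B)| ≤ 2 * b ^ 3)
    (d4 : ∀ x, |x - k| ≤ b → |x - B| ≤ b → |d - x| ≤ b) :
    ∃ m, MidAdmissible b b (fun s t => cond t (cond s k h) B) (fun t => cond t m B)
      (fun s => cond s d e) := by
  have ha : 0 ≤ 1 - 2 * b := by linarith
  have hb0 : 0 ≤ 2 * b := by linarith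
  have div : ∀ {x y z : ℝ}, |x| ≤ y → z * b = x → ∀ y', y' * b = y → |z| ≤ y' := by
    rintro x y z h rfl y' rfl
    rw [abs_mul, abs_of_pos hb] at h
    exact le_of_mul_le_mul_right h hb
  have mul : ∀ {x y z : ℝ}, |x| ≤ y → x * b = z → |z| ≤ y * b := by
    rintro x y z h rfl
    rw [abs_mul, abs_of_pos hb]
    exact mul_le_mul_of_nonneg_right h hb.le
  -- The lateral value on one side has to be close to the hole vertex on the other side.
  have e5 := e4 k (by rwa [abs_sub_comm]) h2
  have d5 := d4 h h3 h1
  obtain ⟨s, s1, s2, s3, s4, s5, s6, s7, s8, s9⟩ := exists_mid_of_hole_edge (b := b)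
    (h := (h - B) / b) (k := (k - B) / b) (d := (e - (2 * b * h + (1 - 2 * b) * B)) / b)
    (d' := (d - (2 * b * k + (1 - 2 * b) * B)) / b) hb hb4
    (div h1 (by field_simp) _ (by ring)) (div h2 (by field_simp) _ (by ring))
    (div h3 (by field_simp; ring) _ (by ring)) (div e3 (by field_simp) _ (by ring))
    (div d3 (by field_simp) _ (by ring)) (div e1 (by field_simp; ring) _ (by ring))
    (div d1 (by field_simp; ring) _ (by ring)) (div e2 (by field_simp; ring) _ (by ring))
    (div d2 (by field_simp; ring) _ (by ring)) (div e5 (by field_simp; ring) _ (by ring))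
    (div d5 (by field_simp; ring) _ (by ring))
  replace s1 := mul (z := b * s + B - B) s1 (by ring)
  replace s2 := mul (z := b * s + B - h) s2 (by field_simp; ring)
  replace s3 := mul (z := b * s + B - k) s3 (by field_simp; ring)
  replace s4 := mul (z := b * s + B - e) s4 (by field_simp; ring)
  replace s5 := mul (z := b * s + B - d) s5 (by field_simp; ring)
  replace s6 := mul (z := b * s + B - (2 * b * h + (1 - 2 * b) * e)) s6 (by field_simp; ring)
  replace s7 := mul (z := b * s + B - (2 * b * k + (1 - 2 * b) * d)) s7 (by field_simp; ring)
  replace s8 := mul (z := (1 - 2 * b) * (b * s + B) - (e - 2 * b * h)) s8 (by field_simp; ring)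
  replace s9 := mul (z := (1 - 2 * b) * (b * s + B) - (d - 2 * b * k)) s9 (by field_simp; ring)
  refine ⟨b * s + B, ?_⟩
  generalize b * s + B = m at *
  have c1 : b * b ≤ b / 4 := by nlinarith
  have c0 : 0 < b * b := by positivity
  have c5 : 0 ≤ b * (b * (1 - 4 * b)) := by
    have : 0 ≤ 1 - 4 * b := by linarith
    positivity
  have c6 : 0 ≤ b * (1 - 2 * b) := by positivity
  have q0 := abs_mul_sub_le hb0 h3 rfl
  have q1 := abs_mul_sub_le ha e1 rfl
  have q2 := abs_mul_sub_le ha d1 rfl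
  clear e4 d4 mul div
  rw [abs_le] at *
  constructor
  · exact abs_le.2 ⟨by dsimp only [cond]; linarith, by dsimp only [cond]; linarith⟩
  · exact abs_le.2 ⟨by dsimp only [cond]; linarith, by dsimp only [cond]; linarith⟩
  all_goals first
    | intro s t
      rw [abs_le]
      rcases s <;> rcases t <;> simp only [cond, Bool.not_true, Bool.not_false] <;> constructor <;>
          linarith
    | intro s t s' t'
      rw [abs_le]
      rcases s <;> rcases t <;> rcases s' <;> rcases t' <;> dsimp only [cond] <;> constructor <;>
          linarith

/-- Helly property on the four-cycle. -/
theorem exists_forall_abs_sub_le_fourCycle {ι : Type*} [Fintype ι] [Nonempty ι] {b : ℝ} (hb : 0 ≤ b)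
    (c ρ : Bool → Bool → ι → ℝ)
    (h0 : ∀ s t i j, c s t i - c s t j ≤ ρ s t i + ρ s t j)
    (h1 : ∀ s t i j, c s t i - c (!s) t j ≤ b + ρ s t i + ρ (!s) t j)
    (h2 : ∀ s t i j, c s t i - c s (!t) j ≤ b + ρ s t i + ρ s (!t) j)
    (h3 : ∀ s t i j, c s t i - c (!s) (!t) j ≤ 2 * b + ρ s t i + ρ (!s) (!t) j) :
    ∃ h : Bool → Bool → ℝ, (∀ s t i, |h s t - c s t i| ≤ ρ s t i) ∧
      (∀ t, |h false t - h true t| ≤ b) ∧ ∀ s, |h s false - h s true| ≤ b := by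
  classical
  -- `δ s s' + δ t t'` is the path distance on the four-cycle with edges of length `b`.
  let δ : Bool → Bool → ℝ := fun x y => if x = y then 0 else b
  have dcases : ∀ x y, (y = x ∧ δ x y = 0) ∨ (y = !x ∧ δ x y = b) := by
    intro x y
    rcases x <;> rcases y <;> simp [δ]
  let m : Bool → Bool → ℝ := fun s t => Finset.univ.sup' Finset.univ_nonempty fun i => c s t i - ρ
      s t i
  have hm : ∀ s t i, c s t i - ρ s t i ≤ m s t := fun s t i =>
    Finset.le_sup' (fun i => c s t i - ρ s t i) (Finset.mem_univ i)
  have hm' : ∀ s t s' t' j, m s t - (δ s s' + δ t t') ≤ c s' t' j + ρ s' t' j := by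
    intro s t s' t' j
    rw [sub_le_iff_le_add]
    refine Finset.sup'_le _ _ fun i _ => ?_
    rcases dcases s s' with ⟨rfl, e⟩ | ⟨rfl, e⟩ <;> rcases dcases t t' with ⟨rfl, f⟩ | ⟨rfl, f⟩ <;>
      rw [e, f]
    · linarith [h0 s' t' i j]
    · linarith [h2 s' t i j]
    · linarith [h1 s t' i j]
    · linarith [h3 s t i j]
  -- McShane extension of the greatest lower bounds `m`: it is the least function above `m` that is
  -- `b`-Lipschitz along the cycle, and the pairwise hypotheses keep it below all upper bounds.
  let h : Bool → Bool → ℝ := fun s t => Finset.univ.sup' Finset.univ_nonempty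
    fun p : Bool × Bool => m p.1 p.2 - (δ p.1 s + δ p.2 t)
  have step : ∀ s t s' t', h s t ≤ h s' t' + (δ s s' + δ t t') := by
    intro s t s' t'
    refine Finset.sup'_le _ _ fun p _ => ?_
    have := Finset.le_sup' (fun p : Bool × Bool => m p.1 p.2 - (δ p.1 s' + δ p.2 t'))
      (Finset.mem_univ p)
    have tri : ∀ x y z, δ x z ≤ δ x y + δ y z := by
      intro x y z
      rcases x <;> rcases y <;> rcases z <;> simp [δ, hb]
    have := tri p.1 s s'
    have := tri p.2 t t'
    change m p.1 p.2 - (δ p.1 s + δ p.2 t) ≤ h s' t' + _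
    linarith
  refine ⟨h, fun s t i => abs_le.2 ⟨?_, ?_⟩, fun t => abs_le.2 ⟨?_, ?_⟩, fun s => abs_le.2 ⟨?_, ?_⟩⟩
  · have := Finset.le_sup' (fun p : Bool × Bool => m p.1 p.2 - (δ p.1 s + δ p.2 t))
      (Finset.mem_univ (s, t))
    simp only [δ, if_true] at this
    change _ ≤ h s t at this
    linarith [hm s t i]
  · rw [sub_le_iff_le_add']
    exact Finset.sup'_le _ _ fun p _ => hm' _ _ _ _ _
  · linarith [step true t false t, show δ true false = b by simp [δ], show δ t t = 0 by simp [δ]]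
  · linarith [step false t true t, show δ false true = b by simp [δ], show δ t t = 0 by simp [δ]]
  · linarith [step s true s false, show δ true false = b by simp [δ], show δ s s = 0 by simp [δ]]
  · linarith [step s false s true, show δ false true = b by simp [δ], show δ s s = 0 by simp [δ]]

namespace MidAdmissible

variable {b r : ℝ} {v : Bool → Bool → ℝ} {H U : Bool → ℝ}

/-- The four vertices of the hole have to be close to the two neighbouring side values, to the
neighbouring corner and to each other. The fourth condition, beyond the ones dictated by
admissibility of the subsquares, limits the effect of the clamp in `innerMid`. -/
theorem exists_hole {A : ℝ} (hb : 0 < b) (hb4 : b ≤ 1 / 4) (hA : 2 * b * A = 1 - 2 * b)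
    (M : MidAdmissible b 1 v H U) : ∃ h : Bool → Bool → ℝ,
      (∀ s t, |h s t - H t| ≤ b ∧ |h s t - U s| ≤ b ∧ |v s t - h s t| ≤ 1 - 2 * b ∧
        |v s t - h s t| ≤ 3 / 2 * (1 - 2 * b) + b ^ 2 - |A * (H t - U s)|) ∧
      (∀ t, |h false t - h true t| ≤ b) ∧ ∀ s, |h s false - h s true| ≤ b := by
  -- With `2 * b * A = 1 - 2 * b`, this is `xh` divided by `2 * b`.
  have ex : ∀ s t, |H t - v s t + A * (H t - U s)| ≤ 1 := fun s t => by
    have h := M.xh s t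
    rw [show H t - 2 * b * v s t - (1 - 2 * b) * U s = 2 * b * (H t - v s t + A * (H t - U s)) by
      rw [mul_add, ← mul_assoc, hA]; ring, abs_mul, abs_of_pos (by linarith : 0 < 2 * b)] at h
    nlinarith
  have ex' : ∀ s t, |U s - v s t + A * (U s - H t)| ≤ 1 := fun s t => by
    have h := M.xu s t
    rw [show U s - 2 * b * v s t - (1 - 2 * b) * H t = 2 * b * (U s - v s t + A * (U s - H t)) by
      rw [mul_add, ← mul_assoc, hA]; ring, abs_mul, abs_of_pos (by linarith : 0 < 2 * b)] at h
    nlinarith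
  obtain ⟨hh, uu, hu, vh, vu, vh', vu', vv, -, -⟩ := id M
  have hhn := M.hh_not
  have uun := M.uu_not
  simp only [mul_one] at hh uu hu vh vu vh' vu' vv hhn uun
  let ρ : Bool → Bool → ℝ := fun s t =>
    min (1 - 2 * b) (3 / 2 * (1 - 2 * b) + b ^ 2 - |A * (H t - U s)|)
  have uh : ∀ s t, |U s - H t| ≤ 2 * b := fun s t => by rw [abs_sub_comm]; exact hu s t
  have ρs : ∀ s t, ρ s t = min (1 - 2 * b) (3 / 2 * (1 - 2 * b) + b ^ 2 - |A * (U s - H t)|) :=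
    fun s t => by rw [← neg_sub (H t), mul_neg, abs_neg]
  have a1 : ∀ s t, |v s t - H t| ≤ b + ρ s t := fun s t =>
    abs_corner_sub_third_le hb hb4 hA (vh s t) (hu s t) (ex s t) (ex' s t)
  have a2 : ∀ s t, |v s t - U s| ≤ b + ρ s t := fun s t => by
    rw [ρs]
    exact abs_corner_sub_third_le hb hb4 hA (vu s t) (uh s t) (ex' s t) (ex s t)
  have a3 : ∀ s t, |U (!s) - v s t| ≤ 2 * b + ρ s t := fun s t =>
    abs_adjacent_third_sub_corner_le hb hb4 hA (vh s t) (ex s t) (ex' s t) (hu _ _)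
      (by rw [abs_sub_comm]; exact uun s) (by simpa using vu' (!s) t)
  have a4 : ∀ s t, |H (!t) - v s t| ≤ 2 * b + ρ s t := fun s t => by
    rw [ρs]
    exact abs_adjacent_third_sub_corner_le hb hb4 hA (vu s t) (ex' s t) (ex s t) (uh _ _)
      (by rw [abs_sub_comm]; exact hhn t) (by simpa using vh' s (!t))
  have a5 : ∀ s t, |v s t - v (!s) t| ≤ b + ρ s t + ρ (!s) t := fun s t =>
    abs_adjacent_corner_sub_le hb hb4 hA (vh _ _) (vh _ _) (hu _ _) (hu _ _) (ex _ _) (ex' _ _)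
      (ex _ _) (ex' _ _) (uun s) (vv _ _ _ _)
  have a6 : ∀ s t, |v s t - v s (!t)| ≤ b + ρ s t + ρ s (!t) := fun s t => by
    rw [ρs, ρs]
    exact abs_adjacent_corner_sub_le hb hb4 hA (vu _ _) (vu _ _) (uh _ _) (uh _ _) (ex' _ _)
      (ex _ _) (ex' _ _) (ex _ _) (hhn t) (vv _ _ _ _)
  have a7 : ∀ s t, |v s t - v (!s) (!t)| ≤ 2 * b + ρ s t + ρ (!s) (!t) := fun s t =>
    abs_opposite_corner_sub_le hb hb4 hA (hu _ _) (hu _ _) (ex _ _) (ex' _ _)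
      (ex _ _) (ex' _ _) (hhn t) (uun s) (hu _ _) (hu _ _) (vv _ _ _ _)
  have ρ0 : ∀ s t, 0 ≤ ρ s t := fun s t => by
    have hA0 : 0 ≤ A := by nlinarith
    have : |A * (H t - U s)| ≤ A * (2 * b) := abs_mul_sub_le hA0 (hu s t) rfl
    exact le_min (by linarith) (by nlinarith)
  obtain ⟨h, h1, h2, h3⟩ := exists_forall_abs_sub_le_fourCycle hb.le
    (fun s t => ![H t, U s, v s t]) (fun s t => ![b, b, ρ s t])
    (by
      intro s t
      have A1 := abs_le.1 (a1 s t)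
      have A2 := abs_le.1 (a2 s t)
      have A3 := abs_le.1 (hu s t)
      have A4 := ρ0 s t
      intro i j
      fin_cases i <;> fin_cases j <;> simp <;> linarith)
    (by
      intro s t
      have A1 := abs_le.1 (a1 s t)
      have A1' := abs_le.1 (a1 (!s) t)
      have A2 := abs_le.1 (hu s t)
      have A2' := abs_le.1 (hu (!s) t)
      have A3 := abs_le.1 (uun s)
      have A4 := abs_le.1 (a3 s t)
      have A4' := abs_le.1 (a3 (!s) t)
      rw [Bool.not_not] at A4'
      have A5 := abs_le.1 (a5 s t)
      have R0 := ρ0 s t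
      have R1 := ρ0 (!s) t
      have R2 := ρ0 s (!t)
      have R3 := ρ0 (!s) (!t)
      intro i j
      fin_cases i <;> fin_cases j <;> simp <;> linarith)
    (by
      intro s t
      have A1 := abs_le.1 (a2 s t)
      have A1' := abs_le.1 (a2 s (!t))
      have A2 := abs_le.1 (hu s t)
      have A2' := abs_le.1 (hu s (!t))
      have A3 := abs_le.1 (hhn t)
      have A4 := abs_le.1 (a4 s t)
      have A4' := abs_le.1 (a4 s (!t))
      rw [Bool.not_not] at A4'
      have A5 := abs_le.1 (a6 s t)
      have R0 := ρ0 s t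
      have R1 := ρ0 (!s) t
      have R2 := ρ0 s (!t)
      have R3 := ρ0 (!s) (!t)
      intro i j
      fin_cases i <;> fin_cases j <;> simp <;> linarith)
    (by
      intro s t
      have A1 := abs_le.1 (a3 s t)
      have A1' := abs_le.1 (a3 (!s) (!t))
      rw [Bool.not_not] at A1'
      have A2 := abs_le.1 (hu s (!t))
      have A2' := abs_le.1 (hu (!s) t)
      have A3 := abs_le.1 (hhn t)
      have A3' := abs_le.1 (uun s)
      have A4 := abs_le.1 (a4 s t)
      have A4' := abs_le.1 (a4 (!s) (!t))
      rw [Bool.not_not] at A4'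
      have A5 := abs_le.1 (a7 s t)
      have R0 := ρ0 s t
      have R1 := ρ0 (!s) t
      have R2 := ρ0 s (!t)
      have R3 := ρ0 (!s) (!t)
      intro i j
      fin_cases i <;> fin_cases j <;> simp <;> linarith)
  refine ⟨h, fun s t => ⟨h1 s t 0, h1 s t 1, ?_⟩, h2, h3⟩
  rw [abs_sub_comm (v s t)]
  exact le_min_iff.1 (h1 s t 2)
end MidAdmissible

/-- `h` collects the hole vertices, `e` and `e'` the middle values on the inner edges ending at the
horizontal and vertical sides, `k` and `l` those on the edges of the hole. All corner children are
reflections of one model, which is why the data are written with `^^`. -/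
theorem MidAdmissible.exists_children_one {b : ℝ} {v : Bool → Bool → ℝ} {H U : Bool → ℝ}
    (hb : 0 < b) (hb4 : b ≤ 1 / 4) (M : MidAdmissible b 1 v H U) :
    ∃ (h e e' : Bool → Bool → ℝ) (k l : Bool → ℝ), (∀ s t, |h s t - H t| ≤ 1) ∧
      (∀ s t, MidAdmissible b (1 - 2 * b)
        (fun s' t' => cond (t' ^^ t) (cond (s' ^^ s) (h s t) (U s)) (cond (s' ^^ s) (H t) (v s t)))
        (fun t' => cond (t' ^^ t) (e' s t) (2 * b * v s t + (1 - 2 * b) * H t))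
        (fun s' => cond (s' ^^ s) (e s t) (2 * b * v s t + (1 - 2 * b) * U s))) ∧
      (∀ t, MidAdmissible b b (fun s' t' => cond (t' ^^ t) (h s' t) (H t))
        (fun t' => cond (t' ^^ t) (k t) (H t)) (fun s' => e s' t)) ∧
      ∀ s, MidAdmissible b b (fun s' t' => cond (s' ^^ s) (h s t') (U s))
        (fun t' => e' s t') (fun s' => cond (s' ^^ s) (l s) (U s)) := by
  obtain ⟨A, hA⟩ : ∃ A, 2 * b * A = 1 - 2 * b := ⟨(1 - 2 * b) / (2 * b), by field_simp⟩
  obtain ⟨h, h1, h2, h3⟩ := M.exists_hole hb hb4 hA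
  have ex : ∀ s t, |H t - v s t + A * (H t - U s)| ≤ 1 := fun s t => by
    have h := M.xh s t
    rw [show H t - 2 * b * v s t - (1 - 2 * b) * U s = 2 * b * (H t - v s t + A * (H t - U s)) by
      rw [mul_add, ← mul_assoc, hA]; ring, abs_mul, abs_of_pos (by linarith : 0 < 2 * b)] at h
    nlinarith
  have ex' : ∀ s t, |U s - v s t + A * (U s - H t)| ≤ 1 := fun s t => by
    have h := M.xu s t
    rw [show U s - 2 * b * v s t - (1 - 2 * b) * H t = 2 * b * (U s - v s t + A * (U s - H t)) by
      rw [mul_add, ← mul_assoc, hA]; ring, abs_mul, abs_of_pos (by linarith : 0 < 2 * b)] at h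
    nlinarith
  obtain ⟨hh, uu, hu, vh, vu, vh', vu', vv, xh, xu⟩ := id M
  simp only [mul_one] at hh uu hu vh vu vh' vu' vv xh xu
  have uh : ∀ s t, |U s - H t| ≤ 2 * b := fun s t => by rw [abs_sub_comm]; exact hu s t
  have he : ∀ s t, InnerMidBounds b (v s t) (H t) (U s) (h s t)
      (innerMid b (v s t) (H t) (U s) (h s t)) := fun s t =>
    innerMid_bounds hb hb4 hA (vh s t) (vu s t) (hu s t) (ex s t) (h1 s t).1 (h1 s t).2.1
      (h1 s t).2.2.1 (h1 s t).2.2.2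
  have he' : ∀ s t, InnerMidBounds b (v s t) (U s) (H t) (h s t)
      (innerMid b (v s t) (U s) (H t) (h s t)) := fun s t =>
    innerMid_bounds hb hb4 hA (vu s t) (vh s t) (uh s t) (ex' s t) (h1 s t).2.1 (h1 s t).1
      (h1 s t).2.2.1 (by
        rw [show A * (U s - H t) = -(A * (H t - U s)) by ring, abs_neg]
        exact (h1 s t).2.2.2)
  have hk := fun t => exists_mid_child_aux hb hb4 (h1 false t).1 (h1 true t).1 (h2 t)
    (he false t).base (he false t).hole (he false t).interp (he false t).hole_adj
    (he true t).base (he true t).hole (he true t).interp (he true t).hole_adj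
  have hl := fun s => exists_mid_child_aux hb hb4 (h1 s false).2.1 (h1 s true).2.1 (h3 s)
    (he' s false).base (he' s false).hole (he' s false).interp (he' s false).hole_adj
    (he' s true).base (he' s true).hole (he' s true).interp (he' s true).hole_adj
  choose k hk using hk
  choose l hl using hl
  refine ⟨h, fun s t => innerMid b (v s t) (H t) (U s) (h s t),
    fun s t => innerMid b (v s t) (U s) (H t) (h s t), k, l,
    fun s t => (h1 s t).1.trans (by linarith), fun s t => ?_, fun t => ?_, fun s => ?_⟩
  · have := MidAdmissible.corner_child_aux hb hb4 (vh s t) (vu s t) (hu s t) (xh s t) (xu s t)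
      (h1 s t).1 (h1 s t).2.1 (h1 s t).2.2.1 (he s t) (he' s t)
    exact this.flip s t
  · refine ((hk t).flip false t).congr (fun s' t' => ?_) (fun t' => ?_) (fun s' => ?_)
    · cases s' <;> cases t' <;> cases t <;> rfl
    · rfl
    · cases s' <;> rfl
  · refine ((hl s).swap.flip s false).congr (fun s' t' => ?_) (fun t' => ?_) (fun s' => ?_)
    · cases s' <;> cases t' <;> cases s <;> rfl
    · cases t' <;> rfl
    · rfl

theorem MidAdmissible.exists_children {b r : ℝ} {v : Bool → Bool → ℝ} {H U : Bool → ℝ}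
    (hb : 0 < b) (hb4 : b ≤ 1 / 4) (hr : 0 < r) (M : MidAdmissible b r v H U) :
    ∃ (h e e' : Bool → Bool → ℝ) (k l : Bool → ℝ), (∀ s t, |h s t - H t| ≤ r) ∧
      (∀ s t, MidAdmissible b ((1 - 2 * b) * r)
        (fun s' t' => cond (t' ^^ t) (cond (s' ^^ s) (h s t) (U s)) (cond (s' ^^ s) (H t) (v s t)))
        (fun t' => cond (t' ^^ t) (e' s t) (2 * b * v s t + (1 - 2 * b) * H t))
        (fun s' => cond (s' ^^ s) (e s t) (2 * b * v s t + (1 - 2 * b) * U s))) ∧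
      (∀ t, MidAdmissible b (b * r) (fun s' t' => cond (t' ^^ t) (h s' t) (H t))
        (fun t' => cond (t' ^^ t) (k t) (H t)) (fun s' => e s' t)) ∧
      ∀ s, MidAdmissible b (b * r) (fun s' t' => cond (s' ^^ s) (h s t') (U s))
        (fun t' => e' s t') (fun s' => cond (s' ^^ s) (l s) (U s)) := by
  have M1 := M.smul (inv_nonneg.2 hr.le)
  rw [mul_inv_cancel₀ hr.ne'] at M1
  obtain ⟨h, e, e', k, l, h0, h1, h2, h3⟩ := M1.exists_children_one hb hb4
  refine ⟨fun s t => r * h s t, fun s t => r * e s t, fun s t => r * e' s t, fun t => r * k t,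
    fun s => r * l s, fun s t => ?_, fun s t => ?_, fun t => ?_, fun s => ?_⟩
  · have := h0 s t
    rw [← mul_le_mul_iff_right₀ hr, ← abs_of_pos hr, ← abs_mul, abs_of_pos hr, mul_sub,
      mul_inv_cancel_left₀ hr.ne', mul_one] at this
    exact this
  · refine ((h1 s t).smul hr.le).congr (fun s' t' => ?_) (fun t' => ?_) (fun s' => ?_)
    · cases (s' ^^ s) <;> cases (t' ^^ t) <;> simp [hr.ne']
    · cases (t' ^^ t) <;> simp only [cond] <;> field_simp
    · cases (s' ^^ s) <;> simp only [cond] <;> field_simp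
  · refine ((h2 t).smul hr.le).congr (fun s' t' => ?_) (fun t' => ?_) (fun s' => ?_)
    · cases (t' ^^ t) <;> simp [hr.ne']
    · cases (t' ^^ t) <;> simp [hr.ne']
    · rfl
  · refine ((h3 s).smul hr.le).congr (fun s' t' => ?_) (fun t' => ?_) (fun s' => ?_)
    · cases (s' ^^ s) <;> simp [hr.ne']
    · rfl
    · cases (s' ^^ s) <;> simp [hr.ne']

/-! ### Ternary coordinates of words -/

/-- The horizontal ternary digit of a letter. -/
def digitX : Fin 8 → ℕ := ![0, 1, 2, 2, 2, 1, 0, 0]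

/-- The vertical ternary digit of a letter. -/
def digitY : Fin 8 → ℕ := ![0, 0, 0, 1, 2, 2, 2, 1]

/-- The horizontal index of the square of a word among the squares of its level. -/
def coordX : Word → ℕ
  | [] => 0
  | i :: w => digitX i * 3 ^ w.length + coordX w

/-- The vertical index of the square of a word among the squares of its level. -/
def coordY : Word → ℕ
  | [] => 0
  | i :: w => digitY i * 3 ^ w.length + coordY w

theorem digitX_le (i : Fin 8) : digitX i ≤ 2 := by revert i; decide

theorem digitY_le (i : Fin 8) : digitY i ≤ 2 := by revert i; decide

theorem coordX_lt (w : Word) : coordX w < 3 ^ w.length := by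
  induction w with
  | nil => simp [coordX]
  | cons i w ih =>
    have := Nat.mul_le_mul_right (3 ^ w.length) (digitX_le i)
    rw [coordX, List.length_cons, pow_succ]
    omega

theorem coordY_lt (w : Word) : coordY w < 3 ^ w.length := by
  induction w with
  | nil => simp [coordY]
  | cons i w ih =>
    have := Nat.mul_le_mul_right (3 ^ w.length) (digitY_le i)
    rw [coordY, List.length_cons, pow_succ]
    omega

theorem exists_letter {x y : ℕ} (hx : x < 3) (hy : y < 3) (h : ¬(x = 1 ∧ y = 1)) :
    ∃ i, digitX i = x ∧ digitY i = y := by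
  interval_cases x <;> interval_cases y <;> first | decide | exact absurd ⟨rfl, rfl⟩ h

@[simp] theorem weight_nil (a b : ℝ) : weight a b [] = 1 := rfl

@[simp] theorem weight_cons (a b : ℝ) (i : Fin 8) (w : Word) :
    weight a b (i :: w) = ratio a b i * weight a b w := rfl

/-! ### Potentials from recursive extension of edge data -/

/-- Types of boundary data on a segment: the values at the end points, and the data on the three
subsegments of one third of the length. -/
structure EdgeSystem (E : Type*) where
  l : E → ℝ
  r : E → ℝ
  sub : ℕ → E → E
  l_sub_zero : ∀ e, l (sub 0 e) = l e
  l_sub_one : ∀ e, l (sub 1 e) = r (sub 0 e)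
  l_sub_two : ∀ e, l (sub 2 e) = r (sub 1 e)
  r_sub_two : ∀ e, r (sub 2 e) = r e

namespace EdgeSystem

variable {E : Type*} (S : EdgeSystem E)

theorem l_sub_succ {d : ℕ} (hd : d < 2) (e : E) : S.l (S.sub (d + 1) e) = S.r (S.sub d e) := by
  interval_cases d
  · exact S.l_sub_one e
  · exact S.l_sub_two e

/-- The values prescribed at the `3 ^ N + 1` equidistant points of a segment. -/
def eval : ℕ → E → ℕ → ℝ
  | 0, e, t => if t = 0 then S.l e else S.r e
  | N + 1, e, t =>
    -- The right end point is set apart, since its leading digit would be `3`.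
    if t = 3 ^ (N + 1) then S.r e else eval N (S.sub (t / 3 ^ N) e) (t % 3 ^ N)

theorem eval_zero (N : ℕ) (e : E) : S.eval N e 0 = S.l e := by
  induction N generalizing e with
  | zero => simp [eval]
  | succ N ih =>
    have : 0 ≠ 3 ^ (N + 1) := by positivity
    rw [eval, if_neg this, Nat.zero_div, Nat.zero_mod, ih, S.l_sub_zero]

theorem eval_pow (N : ℕ) (e : E) : S.eval N e (3 ^ N) = S.r e := by
  cases N <;> simp [eval]

theorem eval_succ (N : ℕ) (e : E) {d t : ℕ} (hd : d < 3) (ht : t ≤ 3 ^ N) :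
    S.eval (N + 1) e (d * 3 ^ N + t) = S.eval N (S.sub d e) t := by
  have h3 : 0 < 3 ^ N := by positivity
  rcases ht.lt_or_eq with ht | rfl
  · have : d * 3 ^ N + t ≠ 3 ^ (N + 1) := by
      have := Nat.mul_le_mul_right (3 ^ N) (show d ≤ 2 by omega)
      rw [pow_succ]
      omega
    rw [eval, if_neg this, Nat.mul_comm, Nat.mul_add_div h3, Nat.div_eq_of_lt ht, Nat.add_zero,
      Nat.mul_add_mod, Nat.mod_eq_of_lt ht]
  · rw [eval_pow, eval]
    obtain rfl | hd : d = 2 ∨ d < 2 := by omega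
    · rw [if_pos (by ring), S.r_sub_two]
    · have : d * 3 ^ N + 3 ^ N ≠ 3 ^ (N + 1) := by
        have := Nat.mul_le_mul_right (3 ^ N) (show d ≤ 1 by omega)
        rw [pow_succ]
        omega
      rw [if_neg this, show d * 3 ^ N + 3 ^ N = 3 ^ N * (d + 1) by ring, Nat.mul_div_cancel_left _
          h3,
        Nat.mul_mod_right, eval_zero, S.l_sub_succ hd]

theorem eval_const {e : E} (he : ∀ i, S.sub i e = e) (hlr : S.r e = S.l e) (N t : ℕ) :
    S.eval N e t = S.l e := by
  induction N generalizing t with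
  | zero => simp [eval, hlr]
  | succ N ih => rw [eval, he, ih, hlr, ite_self]

end EdgeSystem

/-- Gluing functions on the grid squares of side `M` of a grid square of side `3 * M`. -/
theorem exists_glue {M : ℕ} (hM : 0 < M) (f : ℕ → ℕ → ℕ → ℕ → ℝ) (V : ℕ → ℕ → ℝ)
    (h u : ℕ → ℕ → ℕ → ℝ)
    (hh0 : ∀ d e, h d e 0 = V d e) (hh1 : ∀ d e, d < 3 → e ≤ 3 → h d e M = V (d + 1) e)
    (hu0 : ∀ d e, u d e 0 = V d e) (hu1 : ∀ d e, d ≤ 3 → e < 3 → u d e M = V d (e + 1)) :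
    ∃ F : ℕ → ℕ → ℝ,
      (∀ d e x, d < 3 → e ≤ 3 → x ≤ M → F (d * M + x) (e * M) = h d e x) ∧
      (∀ d e y, d ≤ 3 → e < 3 → y ≤ M → F (d * M) (e * M + y) = u d e y) ∧
      ∀ d e, d < 3 → e < 3 → (∀ x ≤ M, f d e x 0 = h d e x) →
        (∀ x ≤ M, f d e x M = h d (e + 1) x) → (∀ y ≤ M, f d e 0 y = u d e y) →
        (∀ y ≤ M, f d e M y = u (d + 1) e y) →
        ∀ x y, x ≤ M → y ≤ M → F (d * M + x) (e * M + y) = f d e x y := by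
  -- Division with remainder assigns to each block its left and lower sides only; the upper and
  -- right sides are read off the next block, where they agree by the compatibility of `h`, `u` and
  -- `V`.
  let F : ℕ → ℕ → ℝ := fun x y =>
    if x % M = 0 then u (x / M) (y / M) (y % M)
    else if y % M = 0 then h (x / M) (y / M) (x % M) else f (x / M) (y / M) (x % M) (y % M)
  have dm : ∀ d x, x < M → (d * M + x) / M = d ∧ (d * M + x) % M = x := fun d x hx => by
    rw [Nat.mul_comm, Nat.mul_add_div hM, Nat.mul_add_mod, Nat.div_eq_of_lt hx,
      Nat.mod_eq_of_lt hx, Nat.add_zero]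
    exact ⟨rfl, rfl⟩
  have hF : ∀ d e x y, x < M → y < M → F (d * M + x) (e * M + y) =
      if x = 0 then u d e y else if y = 0 then h d e x else f d e x y := fun d e x y hx hy => by
    simp only [F, dm d x hx, dm e y hy]
  have hU : ∀ d e y, d ≤ 3 → e < 3 → y ≤ M → F (d * M) (e * M + y) = u d e y := by
    intro d e y hd he hy
    rcases hy.lt_or_eq with hy | rfl
    · simpa using hF d e 0 y hM hy
    · have := hF d (e + 1) 0 0 hM hM
      rw [if_pos rfl, hu0] at this
      rw [hu1 d e hd he, ← this]
      ring_nf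
  have hH : ∀ d e x, d < 3 → e ≤ 3 → x ≤ M → F (d * M + x) (e * M) = h d e x := by
    intro d e x hd he hx
    rcases hx.lt_or_eq with hx | rfl
    · have := hF d e x 0 hx hM
      rw [Nat.add_zero] at this
      rw [this]
      split_ifs with h0
      · rw [h0, hh0, hu0]
      · rfl
      · contradiction
    · have := hF (d + 1) e 0 0 hM hM
      rw [if_pos rfl, hu0] at this
      rw [hh1 d e hd he, ← this]
      ring_nf
  refine ⟨F, hH, hU, fun d e hd he b t l r x y hx hy => ?_⟩
  rcases hy.lt_or_eq with hy | rfl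
  · rcases hx.lt_or_eq with hx | rfl
    · rw [hF d e x y hx hy]
      split_ifs with h1 h2
      · rw [h1, l _ hy.le]
      · rw [h2, b _ hx.le]
      · rfl
    · rw [r _ hy.le, ← hU (d + 1) e y (by omega) he hy.le]
      ring_nf
  · rw [t _ hx, ← hH d (e + 1) x hd (by omega) hx]
    ring_nf

/-- The family `A` of admissible boundary data on squares (in the order bottom, top, left, right) can
be extended to the eight subsquares so that the data on each of them is admissible at the scale
given by the ratios `a` and `b`. -/
structure EdgeSystem.Extends {E : Type*} (S : EdgeSystem E) (a b K : ℝ)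
    (A : ℝ → E → E → E → E → Prop) : Prop where
  corner : ∀ {r B T L R}, A r B T L R →
    S.l L = S.l B ∧ S.l R = S.r B ∧ S.r L = S.l T ∧ S.r R = S.r T
  osc : ∀ {r B T L R}, A r B T L R →
    |S.r B - S.l B| ≤ K * r ∧ |S.l T - S.l B| ≤ K * r ∧ |S.r T - S.l B| ≤ K * r
  exists_children : ∀ {r B T L R}, 0 < r → A r B T L R → ∃ (H U : ℕ → ℕ → E) (V : ℕ → ℕ → ℝ),
    (∀ x < 3, ∀ y ≤ 3, S.l (H x y) = V x y ∧ S.r (H x y) = V (x + 1) y) ∧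
    (∀ x ≤ 3, ∀ y < 3, S.l (U x y) = V x y ∧ S.r (U x y) = V x (y + 1)) ∧
    (∀ x < 3, H x 0 = S.sub x B ∧ H x 3 = S.sub x T ∧ U 0 x = S.sub x L ∧ U 3 x = S.sub x R) ∧
    ∀ i : Fin 8, |V (digitX i) (digitY i) - S.l B| ≤ K * r ∧
      A (ratio a b i * r) (H (digitX i) (digitY i)) (H (digitX i) (digitY i + 1))
        (U (digitX i) (digitY i)) (U (digitX i + 1) (digitY i))

theorem ratio_pos {a b : ℝ} (ha : 0 < a) (hb : 0 < b) (i : Fin 8) : 0 < ratio a b i := by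
  unfold ratio
  split_ifs <;> assumption

theorem ratio_le_max (a b : ℝ) (i : Fin 8) : ratio a b i ≤ max a b := by
  unfold ratio
  split_ifs
  exacts [le_max_left _ _, le_max_right _ _]

theorem weight_pos {a b : ℝ} (ha : 0 < a) (hb : 0 < b) (w : Word) : 0 < weight a b w := by
  induction w with
  | nil => simp
  | cons i w ih => simpa using mul_pos (ratio_pos ha hb i) ih

theorem digit_injective : ∀ i j : Fin 8, digitX i = digitX j → digitY i = digitY j → i = j := by
  decide

/-- Induction on the level, the extension step being applied to the first letter. Sharing the edge
data between neighbouring subsquares makes the eight functions agree on common sides. The reference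
value `c w` is the value at the lower left corner of the square of `w`; passing to a child changes
it by at most `K * r`, and these changes sum to a geometric series of ratio at most `max a b`. -/
theorem EdgeSystem.Extends.exists_potential {E : Type*} {S : EdgeSystem E} {a b K : ℝ}
    {A : ℝ → E → E → E → E → Prop} (h : S.Extends a b K A) (ha : 0 < a) (hb : 0 < b) (ha1 : a < 1)
    (hb1 : b < 1) (hK : 0 ≤ K) (N : ℕ) {r : ℝ} (hr : 0 < r) {B T L R : E} (hA : A r B T L R) :
    ∃ (F : ℕ → ℕ → ℝ) (c : Word → ℝ), c [] = S.l B ∧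
      (∀ t ≤ 3 ^ N, F t 0 = S.eval N B t ∧ F t (3 ^ N) = S.eval N T t ∧ F 0 t = S.eval N L t ∧
        F (3 ^ N) t = S.eval N R t) ∧
      ∀ w v : Word, w.length + v.length = N → ∀ p ≤ 1, ∀ q ≤ 1,
        |F (coordX (w ++ v) + p) (coordY (w ++ v) + q) - c w| ≤
          K / (1 - max a b) * r * weight a b w := by
  have hm : max a b < 1 := max_lt ha1 hb1
  have hm0 : 0 < max a b := lt_max_of_lt_left ha
  set M := K / (1 - max a b) with hM
  have hM0 : 0 ≤ M := div_nonneg hK (by linarith)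
  -- The constant `M` is the fixed point of one step of the recursion.
  have hMK : K + max a b * M = M := by
    rw [hM]
    field_simp [show 1 - max a b ≠ 0 by linarith]
    ring
  have hKM : K ≤ M := by linarith [mul_nonneg hm0.le hM0]
  induction N generalizing r B T L R with
  | zero =>
    obtain ⟨c1, c2, c3, c4⟩ := h.corner hA
    obtain ⟨o1, o2, o3⟩ := h.osc hA
    refine ⟨fun x y => if x = 0 then (if y = 0 then S.l B else S.l T) else
      if y = 0 then S.r B else S.r T, fun _ => S.l B, rfl, fun t ht => ?_, fun w v hwv => ?_⟩
    · obtain rfl | rfl : t = 0 ∨ t = 1 := by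
        rw [pow_zero] at ht
        omega
      · simp [EdgeSystem.eval, c1, c2]
      · simp [EdgeSystem.eval, c3, c4]
    · obtain rfl : w = [] := List.length_eq_zero_iff.1 (by omega)
      obtain rfl : v = [] := List.length_eq_zero_iff.1 (by simpa using hwv)
      have e : K * r ≤ M * r * weight a b [] := by
        rw [weight_nil, mul_one]
        gcongr
      intro p hp q hq
      interval_cases p <;> interval_cases q <;> simp [coordX, coordY] <;>
        first | linarith | positivity | skip
      all_goals simpa using (by assumption : |_| ≤ K * r).trans e
  | succ N ih =>
    obtain ⟨H, U, V, hH, hU, hsub, hch⟩ := h.exists_children hr hA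
    have hr' : ∀ i, 0 < ratio a b i * r := fun i => mul_pos (ratio_pos ha hb i) hr
    choose f c hc0 hf hc using fun i => ih (hr' i) (hch i).2
    have h3 : 0 < 3 ^ N := by positivity
    -- The hole has no letter; its values are irrelevant and set to `0`.
    let g : ℕ → ℕ → ℕ → ℕ → ℝ := fun d e =>
      if hde : ∃ i, digitX i = d ∧ digitY i = e then f hde.choose else fun _ _ => 0
    have hg : ∀ i, g (digitX i) (digitY i) = f i := fun i => by
      have hde : ∃ j, digitX j = digitX i ∧ digitY j = digitY i := ⟨i, rfl, rfl⟩
      simp only [g, dif_pos hde]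
      rw [digit_injective _ _ hde.choose_spec.1 hde.choose_spec.2]
    let hh : ℕ → ℕ → ℕ → ℝ := fun d e t =>
      if t = 0 then V d e else S.eval N (H d e) t
    let uu : ℕ → ℕ → ℕ → ℝ := fun d e t =>
      if t = 0 then V d e else S.eval N (U d e) t
    have hhe : ∀ d e t, d < 3 → e ≤ 3 → hh d e t = S.eval N (H d e) t := fun d e t hd he => by
      simp only [hh]
      split_ifs with h0
      · rw [h0, S.eval_zero, (hH d hd e he).1]
      · rfl
    have uue : ∀ d e t, d ≤ 3 → e < 3 → uu d e t = S.eval N (U d e) t := fun d e t hd he => by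
      simp only [uu]
      split_ifs with h0
      · rw [h0, S.eval_zero, (hU d hd e he).1]
      · rfl
    obtain ⟨F, F1, F2, F3⟩ := exists_glue h3 g V hh uu (fun d e => by simp [hh])
      (fun d e hd he => by rw [hhe d e _ hd he, S.eval_pow, (hH d hd e he).2])
      (fun d e => by simp [uu])
      (fun d e hd he => by rw [uue d e _ hd he, S.eval_pow, (hU d hd e he).2])
    have F4 : ∀ i x y, x ≤ 3 ^ N → y ≤ 3 ^ N →
        F (digitX i * 3 ^ N + x) (digitY i * 3 ^ N + y) = f i x y := by
      intro i x y hx hy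
      have dx := digitX_le i
      have dy := digitY_le i
      rw [F3 _ _ (by omega) (by omega) _ _ _ _ x y hx hy, hg]
      · exact fun t ht => by rw [hg, hhe _ _ _ (by omega) (by omega), (hf i t ht).1]
      · exact fun t ht => by rw [hg, hhe _ _ _ (by omega) (by omega), (hf i t ht).2.1]
      · exact fun t ht => by rw [hg, uue _ _ _ (by omega) (by omega), (hf i t ht).2.2.1]
      · exact fun t ht => by rw [hg, uue _ _ _ (by omega) (by omega), (hf i t ht).2.2.2]
    refine ⟨F, fun w => match w with | [] => S.l B | i :: w => c i w, rfl, fun t ht => ?_,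
      fun w v hwv p hp q hq => ?_⟩
    · obtain ⟨d, s, hd, hs, rfl⟩ : ∃ d s, d < 3 ∧ s ≤ 3 ^ N ∧ t = d * 3 ^ N + s := by
        rcases ht.lt_or_eq with ht | rfl
        · refine ⟨t / 3 ^ N, t % 3 ^ N, ?_, (Nat.mod_lt _ h3).le, (Nat.div_add_mod' _ _).symm⟩
          rw [pow_succ] at ht
          exact Nat.div_lt_of_lt_mul ht
        · exact ⟨2, 3 ^ N, by norm_num, le_rfl, by ring⟩
      obtain ⟨e1, e2, e3, e4⟩ := hsub d hd
      rw [S.eval_succ N _ hd hs, S.eval_succ N _ hd hs, S.eval_succ N _ hd hs,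
        S.eval_succ N _ hd hs, ← e1, ← e2, ← e3, ← e4, ← hhe _ _ _ hd (by norm_num),
        ← hhe _ _ _ hd (by norm_num), ← uue _ _ _ (by norm_num) hd, ← uue _ _ _ (by norm_num) hd]
      have e5 := F1 d 0 s hd (by norm_num) hs
      have e6 := F1 d 3 s hd (by norm_num) hs
      have e7 := F2 0 d s (by norm_num) hd hs
      have e8 := F2 3 d s (by norm_num) hd hs
      rw [Nat.zero_mul] at e5 e7
      exact ⟨e5, by rw [pow_succ', e6], e7, by rw [pow_succ', e8]⟩
    · have child : ∀ i w v, w.length + v.length = N →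
          |F (coordX (i :: w ++ v) + p) (coordY (i :: w ++ v) + q) - c i w| ≤
            M * (ratio a b i * r) * weight a b w := by
        intro i w v hwv
        have hl : (w ++ v).length = N := by simpa using hwv
        have hx := coordX_lt (w ++ v)
        have hy := coordY_lt (w ++ v)
        rw [List.cons_append, coordX, coordY, hl, add_assoc, add_assoc,
          F4 i _ _ (by rw [hl] at hx; omega) (by rw [hl] at hy; omega)]
        exact hc i w v hwv p hp q hq
      rcases w with _ | ⟨i, w⟩
      · rcases v with _ | ⟨i, v⟩
        · simp at hwv
        · have h1 := child i [] v (by simpa using hwv)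
          rw [hc0, weight_nil, mul_one, (hH _ (by have := digitX_le i; omega) _
            (by have := digitY_le i; omega)).1] at h1
          have h2 := (hch i).1
          have h3 : |F (coordX (i :: v) + p) (coordY (i :: v) + q) - S.l B| ≤
              M * (ratio a b i * r) + K * r := by
            refine (abs_sub_le _ (V (digitX i) (digitY i)) _).trans (add_le_add h1 h2)
          refine h3.trans ?_
          rw [weight_nil, mul_one]
          have h4 := mul_le_mul_of_nonneg_left (ratio_le_max a b i) (mul_nonneg hM0 hr.le)
          have h5 : (K + max a b * M) * r = M * r := by rw [hMK]
          linarith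
      · refine (child i w v (by simp at hwv; omega)).trans_eq ?_
        rw [weight_cons]
        ring

/-! ### The extension step for `b ≤ 1/4` as an edge system -/

/-- Edge data given by the values at the end points and the value on the middle part. -/
def midEdges (b : ℝ) : EdgeSystem (ℝ × ℝ × ℝ) where
  l e := e.1
  r e := e.2.2
  sub i e :=
    if i = 0 then (e.1, 2 * b * e.1 + (1 - 2 * b) * e.2.1, e.2.1)
    else if i = 1 then (e.2.1, e.2.1, e.2.1)
    else (e.2.1, 2 * b * e.2.2 + (1 - 2 * b) * e.2.1, e.2.2)
  l_sub_zero _ := rfl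
  l_sub_one _ := rfl
  l_sub_two _ := rfl
  r_sub_two _ := rfl

/-- The admissible families of edge data of a square. -/
def midAdmissibleEdges (b r : ℝ) (B T L R : ℝ × ℝ × ℝ) : Prop :=
  L.1 = B.1 ∧ R.1 = B.2.2 ∧ L.2.2 = T.1 ∧ R.2.2 = T.2.2 ∧
    MidAdmissible b r (fun s t => cond t (cond s T.2.2 T.1) (cond s B.2.2 B.1))
      (fun t => cond t T.2.1 B.2.1) (fun s => cond s R.2.1 L.2.1)

theorem extends_midEdges {b : ℝ} (hb : 0 < b) (hb4 : b ≤ 1 / 4) :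
    (midEdges b).Extends (1 - 2 * b) b 2 (midAdmissibleEdges b) where
  corner := fun ⟨h1, h2, h3, h4, _⟩ => ⟨h1, h2, h3, h4⟩
  osc := fun {r B T L R} ⟨_, _, _, _, M⟩ => by
    have h1 := M.vv true false false false
    have h2 := M.vv false true false false
    have h3 := M.vv true true false false
    have h0 : 0 ≤ r := (abs_nonneg _).trans h1
    exact ⟨h1.trans (by linarith), h2.trans (by linarith), h3.trans (by linarith)⟩
  exists_children := by
    rintro r ⟨_, B, _⟩ ⟨_, T, _⟩ ⟨v00, L, v01⟩ ⟨v10, R, v11⟩ hr ⟨rfl, rfl, rfl, rfl, M⟩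
    obtain ⟨h, e, e', k, l, h0, h1, h2, h3⟩ := M.exists_children hb hb4 hr
    simp only at *
    -- Values at the vertices of the grid of thirds; `mH` and `mU` are the middle values on its
    -- horizontal and vertical edges. Inner indices `1` and `2` correspond to `false` and `true`.
    let V : ℕ → ℕ → ℝ := fun x y =>
      if y = 0 then (if x = 0 then v00 else if x = 3 then v10 else B)
      else if y = 3 then (if x = 0 then v01 else if x = 3 then v11 else T)
      else if x = 0 then L else if x = 3 then R else h (decide (2 ≤ x)) (decide (2 ≤ y))
    let mH : ℕ → ℕ → ℝ := fun x y =>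
      if y = 0 then (if x = 0 then 2 * b * v00 + (1 - 2 * b) * B else if x = 1 then B else
        2 * b * v10 + (1 - 2 * b) * B)
      else if y = 3 then (if x = 0 then 2 * b * v01 + (1 - 2 * b) * T else if x = 1 then T else
        2 * b * v11 + (1 - 2 * b) * T)
      else if x = 1 then k (decide (2 ≤ y)) else e' (decide (2 ≤ x)) (decide (2 ≤ y))
    let mU : ℕ → ℕ → ℝ := fun x y =>
      if x = 0 then (if y = 0 then 2 * b * v00 + (1 - 2 * b) * L else if y = 1 then L else
        2 * b * v01 + (1 - 2 * b) * L)
      else if x = 3 then (if y = 0 then 2 * b * v10 + (1 - 2 * b) * R else if y = 1 then R else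
        2 * b * v11 + (1 - 2 * b) * R)
      else if y = 1 then l (decide (2 ≤ x)) else e (decide (2 ≤ x)) (decide (2 ≤ y))
    have hV : ∀ i : Fin 8, |V (digitX i) (digitY i) - v00| ≤ 2 * r := by
      have g0 := abs_le.1 (M.vv true false false false)
      have g1 := abs_le.1 (M.vv false true false false)
      have g2 := abs_le.1 (M.vv true true false false)
      have g3 := abs_le.1 (M.vh false false)
      have g4 := abs_le.1 (M.vu false false)
      have g5 := abs_le.1 (M.vh' false true)
      have g6 := abs_le.1 (M.vu' true false)
      have g7 := fun s t => abs_le.1 (h0 s t)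
      have e1 := g7 false false
      have e2 := g7 false true
      have e3 := g7 true false
      have e4 := g7 true true
      simp only [cond, Bool.not_true, Bool.not_false] at *
      have : 0 < b * r := mul_pos hb hr
      intro i
      fin_cases i <;> simp [V, digitX, digitY] <;>
        first | exact hr.le | exact abs_le.2 ⟨by linarith, by linarith⟩
    refine ⟨fun x y => (V x y, mH x y, V (x + 1) y), fun x y => (V x y, mU x y, V x (y + 1)), V,
      fun x _ y _ => ⟨rfl, rfl⟩, fun x _ y _ => ⟨rfl, rfl⟩, fun x hx => ?_, fun i => ⟨hV i, ?_⟩⟩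
    · interval_cases x <;> simp [midEdges, V, mH, mU]
    · refine ⟨rfl, rfl, rfl, rfl, ?_⟩
      have q1 := h1 false false
      have q2 := h1 false true
      have q3 := h1 true false
      have q4 := h1 true true
      have q5 := h2 false
      have q6 := h2 true
      have q7 := h3 false
      have q8 := h3 true
      clear h1 h2 h3 hV h0 M
      fin_cases i
      · refine q1.congr ?_ ?_ ?_ <;> simp [V, mH, mU, digitX, digitY]
      · refine q5.congr ?_ ?_ ?_ <;> simp [V, mH, mU, digitX, digitY]
      · refine q3.congr ?_ ?_ ?_ <;> simp [V, mH, mU, digitX, digitY]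
      · refine q8.congr ?_ ?_ ?_ <;> simp [V, mH, mU, digitX, digitY]
      · refine q4.congr ?_ ?_ ?_ <;> simp [V, mH, mU, digitX, digitY]
      · refine q6.congr ?_ ?_ ?_ <;> simp [V, mH, mU, digitX, digitY]
      · refine q2.congr ?_ ?_ ?_ <;> simp [V, mH, mU, digitX, digitY]
      · refine q7.congr ?_ ?_ ?_ <;> simp [V, mH, mU, digitX, digitY]

/-- The rise `3 * b` from left to right is the largest one permitted by the field `uu` at scale `1`.
-/
theorem midAdmissibleEdges_crossing {b : ℝ} (hb : 0 < b) (hb4 : b ≤ 1 / 4) :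
    midAdmissibleEdges b 1 (0, 3 / 2 * b, 3 * b) (0, 3 / 2 * b, 3 * b) (0, 0, 0)
      (3 * b, 3 * b, 3 * b) := by
  refine ⟨rfl, rfl, rfl, rfl, ?_⟩
  have hbb : b * b ≤ b / 4 := by nlinarith
  have hbb' : 0 < b * b := by positivity
  constructor
  all_goals first
    | simpa using hb.le
    | intro s t s' t'
      rw [abs_le]
      rcases s <;> rcases t <;> rcases s' <;> rcases t' <;> simp only [cond] <;> constructor <;>
          linarith
    | intro s t
      rw [abs_le]
      rcases s <;> rcases t <;> simp only [cond, Bool.not_true, Bool.not_false] <;> constructor <;>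
          linarith
    | rw [abs_le]; constructor <;> simp <;> linarith

/-! ### Regime `b ≥ 1/3`: functions of the first coordinate -/

/-- Edge data given by the values at the end points, interpolated with increments proportional to
`α`, `1 - 2 * α` and `α`. -/
def endEdges (α : ℝ) : EdgeSystem (ℝ × ℝ) where
  l e := e.1
  r e := e.2
  sub i e :=
    if i = 0 then (e.1, e.1 + α * (e.2 - e.1))
    else if i = 1 then (e.1 + α * (e.2 - e.1), e.2 - α * (e.2 - e.1))
    else (e.2 - α * (e.2 - e.1), e.2)
  l_sub_zero _ := rfl
  l_sub_one _ := rfl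
  l_sub_two _ := rfl
  r_sub_two _ := rfl

/-- Edge data of functions which depend on the first coordinate only. -/
def endAdmissibleEdges (r : ℝ) (B T L R : ℝ × ℝ) : Prop :=
  T = B ∧ L = (B.1, B.1) ∧ R = (B.2, B.2) ∧ |B.2 - B.1| ≤ r

/-- The middle column consists of two subsquares of ratio `b` and takes the increment `1 - 2 * α`;
the outer columns contain both ratios and take `α`. Hence the three inequalities between `α`, `a`
and `b`. -/
theorem extends_endEdges {a b α : ℝ} (hα : 0 < α) (hα3 : α ≤ 1 / 3) (ha : α ≤ a) (hb : α ≤ b)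
    (hb' : 1 - 2 * α ≤ b) : (endEdges α).Extends a b 1 endAdmissibleEdges where
  corner := by
    rintro r B T L R ⟨rfl, rfl, rfl, -⟩
    exact ⟨rfl, rfl, rfl, rfl⟩
  osc := by
    rintro r B T L R ⟨rfl, rfl, rfl, h⟩
    have : 0 ≤ r := (abs_nonneg _).trans h
    simp [endEdges, h, this]
  exists_children := by
    rintro r ⟨c, c'⟩ _ _ _ hr ⟨rfl, rfl, rfl, h⟩
    let p : ℕ → ℝ := fun x =>
      if x = 0 then c else if x = 1 then c + α * (c' - c) else if x = 2 then c' - α * (c' - c) else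
          c'
    refine ⟨fun x _ => (p x, p (x + 1)), fun x _ => (p x, p x), fun x _ => p x,
      fun x _ y _ => ⟨rfl, rfl⟩, fun x _ y _ => ⟨rfl, rfl⟩, fun x hx => ?_,
      fun i => ⟨?_, rfl, rfl, rfl, ?_⟩⟩
    · interval_cases x <;> simp [p, endEdges]
    · simp only at h
      change |p _ - c| ≤ _
      have key : ∀ β x, 0 ≤ β → β ≤ 1 → x = β * (c' - c) → |x| ≤ 1 * r := by
        rintro β _ h0 h1 rfl
        rw [abs_mul, abs_of_nonneg h0]
        gcongr
      fin_cases i <;> simp only [p, digitX, Matrix.cons_val, Fin.zero_eta, Fin.mk_one,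
          Fin.reduceFinMk]
      · exact key 0 _ le_rfl zero_le_one (by simp)
      · exact key α _ hα.le (by linarith) (by simp)
      · exact key (1 - α) _ (by linarith) (by linarith) (by simp; ring)
      · exact key (1 - α) _ (by linarith) (by linarith) (by simp; ring)
      · exact key (1 - α) _ (by linarith) (by linarith) (by simp; ring)
      · exact key α _ hα.le (by linarith) (by simp)
      · exact key 0 _ le_rfl zero_le_one (by simp)
      · exact key 0 _ le_rfl zero_le_one (by simp)
    · simp only at h ⊢
      have key : ∀ β γ x, 0 ≤ β → β ≤ γ → x = β * (c' - c) → |x| ≤ γ * r := by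
        rintro β γ _ h0 h1 rfl
        rw [abs_mul, abs_of_nonneg h0]
        gcongr
        linarith
      fin_cases i <;> simp [p, digitX, ratio, -abs_mul, -mul_eq_mul_right_iff]
      · exact key α a _ hα.le ha (by ring)
      · exact key (1 - 2 * α) b _ (by linarith) hb' (by ring)
      · exact key α a _ hα.le ha (by ring)
      · exact key α b _ hα.le hb (by ring)
      · exact key α a _ hα.le ha (by ring)
      · rw [if_neg (by decide)]
        exact key (1 - 2 * α) b _ (by linarith) hb' (by ring)
      · rw [if_pos (by decide)]
        exact key α a _ hα.le ha (by ring)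
      · rw [if_neg (by decide)]
        exact key α b _ hα.le hb (by ring)

/-! ### Regime `1/4 < b < 1/3`: Lipschitz data at the points of thirds -/

/-- The twelve points of the boundary of a square with coordinates in thirds of its side. -/
def thirdPoints : List (ℕ × ℕ) :=
  [(0, 0), (1, 0), (2, 0), (3, 0), (3, 1), (3, 2), (3, 3), (2, 3), (1, 3), (0, 3), (0, 2), (0, 1)]

/-- The points of the boundary of a square with coordinates in ninths of its side. -/
def ninthPoints : List (ℕ × ℕ) :=
  (List.range 9).flatMap fun i => [(i, 0), (9, i), (9 - i, 9), (0, 9 - i)]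

/-- The Chebyshev distance. -/
def chebyshev (p q : ℕ × ℕ) : ℕ := max (p.1 - q.1 + (q.1 - p.1)) (p.2 - q.2 + (q.2 - p.2))

/-- A second distance on the points `thirdPoints`. -/
def sideDist (p q : ℕ × ℕ) : ℕ :=
  bif chebyshev p q == 0 then 0
  else bif p.1 % 3 == 0 && p.2 % 3 == 0 || q.1 % 3 == 0 && q.2 % 3 == 0 then
    min 4 (1 + chebyshev p q)
  else bif (p.1 % 3 == 0) == (q.1 % 3 == 0) then
    bif (bif p.1 % 3 == 0 then p.1 == q.1 else p.2 == q.2) then 1 else 3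
  else 2

/-- The values of the potentials based at the point `(x, 0)`, packed in six binary digits per point. -/
def potentialTable : ℕ → ℕ → ℕ
  | 0, 0 => 0x30b2892492492492c00090002000082800090001c00072492492071861862400080001400052400070001000042481c61440c30c32400060000c00022400060000c00012481c61440c2040
  | 0, 1 => 0x2cb2892492492492800090002000082400090001c00072082082071861862000070001400052000060001000042071851030c30c3200005000080002200005000080001207185103081001
  | 0, 2 => 0x28a2892492492492400090002000082000080001c00071c71c72071861861c00060001400051c00050001000041c61440c30c30c31c00040000800021c00040000400021c61440c2040042
  | 0, 3 => 0x2492492492492492000080002000081c00070001c00071861861c71861861800050001400051800040001000041851030c30c30c3180003000080003180003000040003185103081001083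
  | 0, 4 => 0x2492492492492492000080002000081c00070001c00071861861c71861861400050001400051400040001000041440c30c30c30c41400020000800041400020000400041440c20400420c4
  | 1, 0 => 0x89e71861861965a78001800058001670001800050001461861859445041160001600038000e60001400034000d61651138d28a28a64001000028000764001000028000469651138d287100
  | 1, 1 => 0x79d6d75d75d86196800170005400156000170004c001351451455340f3d050001200034000d50001000030000c51240d28924924a54000c00018000654000c00018000459240d2891c3004
  | 1, 2 => 0x71b6d75d75d86196000170005400155800150004c001349249255340f3d048001000034000d48000e00030000c49038b20824924a4c000a0001800064c000a00010000651038b2071000c7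
  | 1, 3 => 0x6175d55555575d85000130004c001448001100044001238e38e45138e38e38000c00030000d38000a00028000c38c2871c71c924a40000700014000a4000070000c000a44d2c71430041ca
  | 1, 4 => 0x6175d55555575d85000130004c001448001100044001238e38e45138e38e30000c00030000c30000a00028000c34a2071861c824c34000400010000c3400040000c000c38a2050800c724d
  | 2, 0 => 0x6145104104114535000100003c000f50001000038000f4104103ce30b2cc40000f00028000a40000e00028000a40f38c28a20820844000b00020000644000b0002000044cf3cc28a206100
  | 2, 1 => 0x51248e38e38f3d140000e00034000d40000e00030000d30c30c34c28924a30000b00020000830000a00020000830b2881861861883400070001000043400070001000043cb2c8186182004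
  | 2, 2 => 0x51248e38e38f3d140000e00034000d40000e00030000d30c30c34c28924a30000b00020000830000a00020000830b2881861861883400070001000043400070001000043cb2c8186100086
  | 2, 3 => 0x40e38c30c30e39030000b0002c000c30000a00028000c20820828a2082082000070001c00082000060001800082071841041061882800040000c00082800040000800083082040c2004188
  | 2, 4 => 0x40e38c30c30e39030000b0002c000c30000a00028000c20820828a2082082000070001c00082000060001800082061840c310618820000200008000820000200008000828618304008618a
  | _, _ => 0

/-- Coefficients of potentials on the boundaries of the eight subsquares, in ninths of the side. -/
def potential (k : ℕ) (P z : ℕ × ℕ) : ℕ :=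
  -- The symmetries of the square reduce the base point to the left half of the bottom side, the
  -- only part that is tabulated.
  let aux (x y X Y : ℕ) : ℕ :=
    let Y' := bif y == 0 then Y else 9 - Y
    bif Nat.ble x 4 then (potentialTable k x >>> (6 * (X + 10 * Y'))) % 64
    else (potentialTable k (9 - x) >>> (6 * (9 - X + 10 * Y'))) % 64
  bif P.2 % 9 == 0 then aux P.1 P.2 z.1 z.2 else aux P.2 P.1 z.2 z.1

/-- The coefficients of the distances in the eight subsquares. -/
def childCost (i : Fin 8) (k : ℕ) (p q : ℕ × ℕ) : ℕ :=
  match k with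
  | 0 => chebyshev p q
  | 1 => sideDist p q + bif i.val % 2 == 0 then 2 * chebyshev p q else chebyshev p q
  | _ => bif i.val % 2 == 0 then 2 * sideDist p q else sideDist p q

/-- The point of the subsquare of the letter `i` with local coordinates `p`, in ninths of the side. -/
def shiftPoint (i : Fin 8) (p : ℕ × ℕ) : ℕ × ℕ := (3 * digitX i + p.1, 3 * digitY i + p.2)

/-- The coefficient `k` is that of `u ^ (2 - k) * w ^ k`; the inequality holds coefficientwise, so
it is independent of `u` and `w` and can be checked by evaluation. -/
theorem potential_le (k : Fin 3) (i : Fin 8) :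
    ∀ P ∈ ninthPoints, ∀ p ∈ thirdPoints, ∀ q ∈ thirdPoints,
    potential k P (shiftPoint i p) ≤ potential k P (shiftPoint i q) + childCost i k p q := by
  have : (ninthPoints.all fun P => thirdPoints.all fun p => thirdPoints.all fun q =>
    Nat.ble (potential k P (shiftPoint i p)) (potential k P (shiftPoint i q) + childCost i k p q))
        = true := by
    revert k i
    decide +kernel
  simpa using this

/-- The vertices of the grid of thirds from which the value at a point of `ninthPoints` is
interpolated; the lists for `m = 3` and `m = 4` belong to the two parameters of the distance. -/
def interpNodes (m : ℕ) (P : ℕ × ℕ) : List (ℕ × ℕ) :=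
  let A := (P.1 / 3, P.2 / 3)
  let B := bif P.2 % 9 == 0 then (P.1 / 3 + 1, P.2 / 3) else (P.1 / 3, P.2 / 3 + 1)
  let o := bif P.2 % 9 == 0 then P.1 % 3 else P.2 % 3
  bif P.1 % 3 == 0 && P.2 % 3 == 0 then List.replicate m A
  else bif m == 4 then [A, A, B, B]
  else bif o == 1 then [A, A, B] else [A, B, B]

/-- The coefficients of the cost of a transport plan between interpolation nodes. -/
def transportCost (k : ℕ) (l3 l4 : List ((ℕ × ℕ) × (ℕ × ℕ))) : ℕ :=
  match k with
  | 0 => (l3.map fun p => chebyshev p.1 p.2).sum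
  | 1 => (l3.map fun p => sideDist p.1 p.2).sum + (l4.map fun p => chebyshev p.1 p.2).sum
  | _ => (l4.map fun p => sideDist p.1 p.2).sum

/-- A value at a ninth point is a weighted sum of values at third points. Coupling the nodes of `P`
and `Q` in order, or in reversed order, is a transport plan whose cost is dominated by the
potential. The same plan serves all three coefficients. -/
theorem transportCost_le : ∀ P ∈ ninthPoints, ∀ Q ∈ ninthPoints,
    (∀ k : Fin 3, transportCost k ((interpNodes 3 P).zip (interpNodes 3 Q))
      ((interpNodes 4 P).zip (interpNodes 4 Q)) ≤ potential k Q P) ∨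
    ∀ k : Fin 3, transportCost k ((interpNodes 3 P).zip (interpNodes 3 Q).reverse)
      ((interpNodes 4 P).zip (interpNodes 4 Q).reverse) ≤ potential k Q P := by
  decide +kernel

theorem interpNodes_length (P : ℕ × ℕ) :
    (interpNodes 3 P).length = 3 ∧ (interpNodes 4 P).length = 4 := by
  unfold interpNodes
  simp only [cond_eq_ite]
  constructor <;> split_ifs <;> simp_all

theorem interpNodes_subset : ∀ P ∈ ninthPoints, (∀ p ∈ interpNodes 3 P, p ∈ thirdPoints) ∧
    ∀ p ∈ interpNodes 4 P, p ∈ thirdPoints := by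
  decide +kernel

theorem potential_self : ∀ P ∈ ninthPoints, ∀ k : Fin 3, potential k P P = 0 := by
  decide +kernel

theorem potential_lt (k : ℕ) (P z : ℕ × ℕ) : potential k P z < 64 := by
  unfold potential
  have : ∀ n, n % 64 < 64 := fun n => Nat.mod_lt _ (by norm_num)
  simp only [cond_eq_ite]
  split_ifs <;> exact this _

/-- A function on `thirdPoints` which is Lipschitz with constant `r`. -/
def ThirdLipschitz (u w r : ℝ) (φ : ℕ × ℕ → ℝ) : Prop :=
  ∀ p ∈ thirdPoints, ∀ q ∈ thirdPoints, φ p - φ q ≤ r * (u * chebyshev p q + w * sideDist p q)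

/-- The interpolated value at a point of `ninthPoints`. -/
noncomputable def interp (u w : ℝ) (φ : ℕ × ℕ → ℝ) (P : ℕ × ℕ) : ℝ :=
  u * ((interpNodes 3 P).map φ).sum + w * ((interpNodes 4 P).map φ).sum

/-- The distance-like function `u ^ 2 * ρ₀ + u * w * ρ₁ + w ^ 2 * ρ₂` with the integral potentials `ρ₀`,
`ρ₁`, `ρ₂`. -/
noncomputable def realPotential (u w : ℝ) (P z : ℕ × ℕ) : ℝ :=
  u ^ 2 * potential 0 P z + u * w * potential 1 P z + w ^ 2 * potential 2 P z

theorem ThirdLipschitz.sum_sub_le {u w r : ℝ} {φ : ℕ × ℕ → ℝ} (h : ThirdLipschitz u w r φ)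
    (l : List ((ℕ × ℕ) × (ℕ × ℕ))) (h1 : ∀ p ∈ l, p.1 ∈ thirdPoints)
      (h2 : ∀ p ∈ l, p.2 ∈ thirdPoints) :
    ((l.map Prod.fst).map φ).sum - ((l.map Prod.snd).map φ).sum ≤
      r * (u * (l.map fun p => chebyshev p.1 p.2).sum + w * (l.map fun p => sideDist p.1 p.2).sum)
          := by
  induction l with
  | nil => simp
  | cons p l ih =>
    have := ih (fun q hq => h1 q (List.mem_cons_of_mem _ hq)) (fun q hq => h2 q
        (List.mem_cons_of_mem _ hq))
    have h0 := h p.1 (h1 p List.mem_cons_self) p.2 (h2 p List.mem_cons_self)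
    simp only [List.map_cons, List.sum_cons, Nat.cast_add]
    linarith

/-- The easy half of Kantorovich duality: the difference of two averages of a Lipschitz function is
at most the cost of any transport plan. With `realPotential` as the cost function, this is the
compatibility needed for a McShane extension. -/
theorem ThirdLipschitz.interp_sub_le {u w r : ℝ} (hu : 0 ≤ u) (hw : 0 ≤ w) (hr : 0 ≤ r)
    {φ : ℕ × ℕ → ℝ} (h : ThirdLipschitz u w r φ) {P Q : ℕ × ℕ} (hP : P ∈ ninthPoints)
    (hQ : Q ∈ ninthPoints) : interp u w φ P - interp u w φ Q ≤ r * realPotential u w Q P := by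
  have key : ∀ σ : List (ℕ × ℕ) → List (ℕ × ℕ), (∀ l, (σ l).Perm l) →
      (∀ k : Fin 3, transportCost k ((interpNodes 3 P).zip (σ (interpNodes 3 Q)))
      ((interpNodes 4 P).zip (σ (interpNodes 4 Q))) ≤ potential k Q P) →
      interp u w φ P - interp u w φ Q ≤ r * realPotential u w Q P := by
    intro σ hσ hk
    obtain ⟨lP3, lP4⟩ := interpNodes_length P
    obtain ⟨lQ3, lQ4⟩ := interpNodes_length Q
    obtain ⟨sP3, sP4⟩ := interpNodes_subset P hP
    obtain ⟨sQ3, sQ4⟩ := interpNodes_subset Q hQ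
    have e : ∀ l, ((σ l).map φ).sum = (l.map φ).sum := fun l => ((hσ l).map φ).sum_eq
    have z3 := h.sum_sub_le ((interpNodes 3 P).zip (σ (interpNodes 3 Q)))
      (fun p hp => sP3 _ (List.of_mem_zip hp).1) (fun p hp => sQ3 _ ((hσ _).mem_iff.1
          (List.of_mem_zip hp).2))
    have z4 := h.sum_sub_le ((interpNodes 4 P).zip (σ (interpNodes 4 Q)))
      (fun p hp => sP4 _ (List.of_mem_zip hp).1) (fun p hp => sQ4 _ ((hσ _).mem_iff.1
          (List.of_mem_zip hp).2))
    rw [List.map_fst_zip (by rw [lP3, (hσ _).length_eq, lQ3]), List.map_snd_zip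
      (by rw [lP3, (hσ _).length_eq, lQ3]), e] at z3
    rw [List.map_fst_zip (by rw [lP4, (hσ _).length_eq, lQ4]), List.map_snd_zip
      (by rw [lP4, (hσ _).length_eq, lQ4]), e] at z4
    have k0 : ((transportCost 0 _ _ : ℕ) : ℝ) ≤ potential 0 Q P := Nat.cast_le.2 (hk 0)
    have k1 : ((transportCost 1 _ _ : ℕ) : ℝ) ≤ potential 1 Q P := Nat.cast_le.2 (hk 1)
    have k2 : ((transportCost 2 _ _ : ℕ) : ℝ) ≤ potential 2 Q P := Nat.cast_le.2 (hk 2)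
    simp only [transportCost, Nat.cast_add] at k0 k1 k2
    have m0 := mul_le_mul_of_nonneg_left k0 (mul_nonneg hr (mul_nonneg hu hu))
    have m1 := mul_le_mul_of_nonneg_left k1 (mul_nonneg hr (mul_nonneg hu hw))
    have m2 := mul_le_mul_of_nonneg_left k2 (mul_nonneg hr (mul_nonneg hw hw))
    have n3 := mul_le_mul_of_nonneg_left z3 hu
    have n4 := mul_le_mul_of_nonneg_left z4 hw
    unfold interp realPotential
    linarith
  rcases transportCost_le P hP Q hQ with hk | hk
  · exact key id (fun _ => List.Perm.refl _) hk
  · exact key List.reverse List.reverse_perm hk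

/-- Expanding `(u + 2 * w) * (u * x + w * y)` and `(u + w) * (u * x + w * y)` in `u` and `w` gives
the coefficients in `childCost`. -/
theorem realPotential_le {u w : ℝ} (hu : 0 ≤ u) (hw : 0 ≤ w) (i : Fin 8) {P p q : ℕ × ℕ}
    (hP : P ∈ ninthPoints) (hp : p ∈ thirdPoints) (hq : q ∈ thirdPoints) :
    realPotential u w P (shiftPoint i p) ≤ realPotential u w P (shiftPoint i q) +
      ratio (u + 2 * w) (u + w) i * (u * chebyshev p q + w * sideDist p q) := by
  have k0 := potential_le 0 i P hP p hp q hq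
  have k1 := potential_le 1 i P hP p hp q hq
  have k2 := potential_le 2 i P hP p hp q hq
  have c0 : (((potential 0 P (shiftPoint i p) : ℕ)) : ℝ) ≤
    (potential 0 P (shiftPoint i q) + childCost i 0 p q : ℕ) := Nat.cast_le.2 k0
  have c1 : (((potential 1 P (shiftPoint i p) : ℕ)) : ℝ) ≤
    (potential 1 P (shiftPoint i q) + childCost i 1 p q : ℕ) := Nat.cast_le.2 k1
  have c2 : (((potential 2 P (shiftPoint i p) : ℕ)) : ℝ) ≤
    (potential 2 P (shiftPoint i q) + childCost i 2 p q : ℕ) := Nat.cast_le.2 k2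
  have m0 := mul_le_mul_of_nonneg_left c0 (mul_nonneg hu hu)
  have m1 := mul_le_mul_of_nonneg_left c1 (mul_nonneg hu hw)
  have m2 := mul_le_mul_of_nonneg_left c2 (mul_nonneg hw hw)
  unfold realPotential ratio
  rcases Nat.mod_two_eq_zero_or_one i.val with h | h
  · rw [if_pos (Nat.even_iff.2 h)]
    simp only [childCost, h, beq_self_eq_true, cond_true, Nat.cast_add, Nat.cast_mul] at m0 m1 m2
    push_cast at m0 m1 m2
    linarith
  · rw [if_neg (by rw [Nat.even_iff]; omega)]
    simp only [childCost, h, Nat.cast_add] at m0 m1 m2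
    simp only [Nat.reduceBEq, cond_false] at m0 m1 m2
    linarith

/-- Edge data given by the values at the end points and at the two points which divide the segment
in three equal parts. -/
def thirdEdges (a : ℝ) : EdgeSystem (ℝ × ℝ × ℝ × ℝ) where
  l e := e.1
  r e := e.2.2.2
  sub i e :=
    let f : ℝ → ℝ → ℝ × ℝ × ℝ × ℝ := fun x y => (x, x + a * (y - x), y - a * (y - x), y)
    if i = 0 then f e.1 e.2.1 else if i = 1 then f e.2.1 e.2.2.1 else f e.2.2.1 e.2.2.2
  l_sub_zero _ := rfl
  l_sub_one _ := rfl
  l_sub_two _ := rfl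
  r_sub_two _ := rfl

/-- The function on `thirdPoints` given by data on the four edges. -/
def boundaryFun (B T L R : ℝ × ℝ × ℝ × ℝ) : ℕ × ℕ → ℝ
  | (0, 0) => B.1
  | (1, 0) => B.2.1
  | (2, 0) => B.2.2.1
  | (3, 0) => B.2.2.2
  | (0, 3) => T.1
  | (1, 3) => T.2.1
  | (2, 3) => T.2.2.1
  | (3, 3) => T.2.2.2
  | (0, 1) => L.2.1
  | (0, 2) => L.2.2.1
  | (3, 1) => R.2.1
  | (3, 2) => R.2.2.1
  | _ => 0

/-- The families of edge data of a square which are Lipschitz at scale `r`. -/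
def thirdAdmissibleEdges (u w r : ℝ) (B T L R : ℝ × ℝ × ℝ × ℝ) : Prop :=
  L.1 = B.1 ∧ R.1 = B.2.2.2 ∧ L.2.2.2 = T.1 ∧ R.2.2.2 = T.2.2.2 ∧
    ThirdLipschitz u w r (boundaryFun B T L R)

theorem ninthPoints_nonempty : ninthPoints.toFinset.Nonempty := ⟨(0, 0), by decide⟩

/-- McShane extension of the interpolated boundary values. -/
noncomputable def mcShane (u w r : ℝ) (φ : ℕ × ℕ → ℝ) (z : ℕ × ℕ) : ℝ :=
  ninthPoints.toFinset.inf' ninthPoints_nonempty fun P => interp u w φ P + r * realPotential u w P z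

theorem ThirdLipschitz.mcShane_eq {u w r : ℝ} (hu : 0 ≤ u) (hw : 0 ≤ w) (hr : 0 ≤ r)
    {φ : ℕ × ℕ → ℝ} (h : ThirdLipschitz u w r φ) {P : ℕ × ℕ} (hP : P ∈ ninthPoints) :
    mcShane u w r φ P = interp u w φ P := by
  apply le_antisymm
  · refine (Finset.inf'_le _ (List.mem_toFinset.2 hP)).trans_eq ?_
    have e0 := potential_self P hP 0
    have e1 := potential_self P hP 1
    have e2 := potential_self P hP 2
    simp only [Fin.val_zero, Fin.val_one, Fin.val_two] at e0 e1 e2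
    simp [realPotential, e0, e1, e2]
  · refine Finset.le_inf' _ _ fun Q hQ => ?_
    have := h.interp_sub_le hu hw hr hP (List.mem_toFinset.1 hQ)
    linarith

theorem mcShane_shiftPoint {u w r : ℝ} (hu : 0 ≤ u) (hw : 0 ≤ w) (hr : 0 ≤ r) (φ : ℕ × ℕ → ℝ)
    (i : Fin 8) : ThirdLipschitz u w (ratio (u + 2 * w) (u + w) i * r)
      fun p => mcShane u w r φ (shiftPoint i p) := by
  intro p hp q hq
  beta_reduce
  rw [sub_le_iff_le_add]
  obtain ⟨P, hP, e⟩ := Finset.exists_mem_eq_inf' ninthPoints_nonempty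
    fun P => interp u w φ P + r * realPotential u w P (shiftPoint i q)
  have h1 : mcShane u w r φ (shiftPoint i q) = _ := e
  rw [h1]
  refine (Finset.inf'_le _ hP).trans ?_
  have := mul_le_mul_of_nonneg_left (realPotential_le hu hw i (List.mem_toFinset.1 hP) hp hq) hr
  linarith

/-- The normalization `3 * u + 4 * w = 1` thus makes the diameter of `thirdPoints` at most `1`. -/
theorem thirdLipschitz_cap : ∀ p ∈ thirdPoints, ∀ q ∈ thirdPoints,
    chebyshev p q ≤ 3 ∧ sideDist p q ≤ 4 := by
  decide

theorem ThirdLipschitz.sub_le {u w r : ℝ} (hu : 0 ≤ u) (hw : 0 ≤ w) (hr : 0 ≤ r)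
    (h1 : 3 * u + 4 * w = 1) {φ : ℕ × ℕ → ℝ} (h : ThirdLipschitz u w r φ) {p q : ℕ × ℕ}
    (hp : p ∈ thirdPoints) (hq : q ∈ thirdPoints) : φ p - φ q ≤ r := by
  refine (h p hp q hq).trans (mul_le_of_le_one_right hr ?_)
  obtain ⟨h3, h4⟩ := thirdLipschitz_cap p hp q hq
  have h3' : ((chebyshev p q : ℕ) : ℝ) ≤ 3 := by exact_mod_cast h3
  have h4' : ((sideDist p q : ℕ) : ℝ) ≤ 4 := by exact_mod_cast h4
  have := mul_le_mul_of_nonneg_left h3' hu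
  have := mul_le_mul_of_nonneg_left h4' hw
  linarith

theorem ThirdLipschitz.abs_mcShane_sub_le {u w r : ℝ} (hu : 0 ≤ u) (hw : 0 ≤ w) (hr : 0 ≤ r)
    (h1 : 3 * u + 4 * w = 1) {φ : ℕ × ℕ → ℝ} (h : ThirdLipschitz u w r φ) (z : ℕ × ℕ) :
    |mcShane u w r φ z - φ (0, 0)| ≤ 64 * r := by
  have hu1 : u ≤ 1 := by linarith
  have hw1 : w ≤ 1 := by linarith
  have h0 : interp u w φ (0, 0) = φ (0, 0) := by
    simp [interp, interpNodes]
    linear_combination φ (0, 0) * h1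
  have hpos : ∀ P, 0 ≤ realPotential u w P z := fun P => by unfold realPotential; positivity
  have hle : ∀ P, realPotential u w P z ≤ 64 := fun P => by
    have hb : ∀ k, ((potential k P z : ℕ) : ℝ) ≤ 64 := fun k => by
      exact_mod_cast (potential_lt k P z).le
    have b0 := mul_le_mul_of_nonneg_left (hb 0) (mul_nonneg hu hu)
    have b1 := mul_le_mul_of_nonneg_left (hb 1) (mul_nonneg hu hw)
    have b2 := mul_le_mul_of_nonneg_left (hb 2) (mul_nonneg hw hw)
    unfold realPotential
    nlinarith [mul_nonneg hu hw]
  refine abs_le.2 ⟨?_, ?_⟩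
  -- From below: potentials are nonnegative and each interpolated value is an average of values
  -- within `r` of `φ (0, 0)`. From above, the base point `(0, 0)` is used, where potentials have
  -- six binary digits; this is the origin of `64`.
  · suffices φ (0, 0) - r ≤ mcShane u w r φ z by linarith
    refine Finset.le_inf' _ _ fun P hP => ?_
    have := mul_nonneg hr (hpos P)
    suffices φ (0, 0) - r ≤ interp u w φ P by linarith
    obtain ⟨l3, l4⟩ := interpNodes_length P
    obtain ⟨s3, s4⟩ := interpNodes_subset P (List.mem_toFinset.1 hP)
    have key : ∀ l : List (ℕ × ℕ), (∀ p ∈ l, p ∈ thirdPoints) →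
        l.length * (φ (0, 0) - r) ≤ (l.map φ).sum := by
      intro l hl
      induction l with
      | nil => simp
      | cons p l ih =>
        have := ih fun q hq => hl q (List.mem_cons_of_mem _ hq)
        have := h.sub_le hu hw hr h1 (p := (0, 0)) (by decide) (hl p List.mem_cons_self)
        simp only [List.length_cons, List.map_cons, List.sum_cons]
        push_cast
        linarith
    have q3 := mul_le_mul_of_nonneg_left (key _ s3) hu
    have q4 := mul_le_mul_of_nonneg_left (key _ s4) hw
    rw [l3] at q3
    rw [l4] at q4
    push_cast at q3 q4
    have e : φ (0, 0) - r = u * (3 * (φ (0, 0) - r)) + w * (4 * (φ (0, 0) - r)) := by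
      linear_combination -(φ (0, 0) - r) * h1
    unfold interp
    linarith
  · have := Finset.inf'_le (fun P => interp u w φ P + r * realPotential u w P z)
      (List.mem_toFinset.2 (by decide : (0, 0) ∈ ninthPoints))
    have h2 := mul_le_mul_of_nonneg_left (hle (0, 0)) hr
    change mcShane u w r φ z ≤ _ at this
    linarith

/-- The subdivision rule and `interp` agree: by `3 * u + 4 * w = 1`, the value `x + (u + 2 * w) * (y
- x)` equals `u * (2 * x + y) + w * (2 * x + 2 * y)`. Thus the McShane extension has the prescribed
values on the outer sides, while `mcShane_shiftPoint` gives the Lipschitz bounds on the subsquares.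
-/
theorem extends_thirdEdges {u w : ℝ} (hu : 0 ≤ u) (hw : 0 ≤ w) (h1 : 3 * u + 4 * w = 1) :
    (thirdEdges (u + 2 * w)).Extends (u + 2 * w) (u + w) 64 (thirdAdmissibleEdges u w) where
  corner := fun ⟨h1, h2, h3, h4, _⟩ => ⟨h1, h2, h3, h4⟩
  osc := fun {r B T L R} ⟨_, _, _, _, M⟩ => by
    have hr : 0 ≤ r := by
      by_contra! hn
      have e1 := M (0, 0) (by decide) (3, 0) (by decide)
      have e2 := M (3, 0) (by decide) (0, 0) (by decide)
      have e3 : u * 3 + w * 4 = 1 := by linarith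
      simp [chebyshev, sideDist, e3] at e1 e2
      linarith
    have key : ∀ p ∈ thirdPoints, |boundaryFun B T L R p - boundaryFun B T L R (0, 0)| ≤ 64 * r :=
      fun p hp => by
        have e1 := M.sub_le hu hw hr h1 hp (q := (0, 0)) (by decide)
        have e2 := M.sub_le hu hw hr h1 (p := (0, 0)) (by decide) hp
        exact abs_le.2 ⟨by linarith, by linarith⟩
    exact ⟨key (3, 0) (by decide), key (0, 3) (by decide), key (3, 3) (by decide)⟩
  exists_children := by
    rintro r B T L R hr ⟨c1, c2, c3, c4, M⟩
    set φ := boundaryFun B T L R with hφ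
    obtain ⟨f, hf, hf0, hfi⟩ : ∃ f, (∀ P ∈ ninthPoints, f P = interp u w φ P) ∧
        (∀ z, |f z - φ (0, 0)| ≤ 64 * r) ∧ ∀ i, ThirdLipschitz u w (ratio (u + 2 * w) (u + w) i * r)
          fun p => f (shiftPoint i p) :=
      ⟨mcShane u w r φ, fun P hP => M.mcShane_eq hu hw hr.le hP,
        M.abs_mcShane_sub_le hu hw hr.le h1, mcShane_shiftPoint hu hw hr.le φ⟩
    refine ⟨fun x y => (f (3 * x, 3 * y), f (3 * x + 1, 3 * y), f (3 * x + 2, 3 * y),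
      f (3 * (x + 1), 3 * y)), fun x y => (f (3 * x, 3 * y), f (3 * x, 3 * y + 1),
      f (3 * x, 3 * y + 2), f (3 * x, 3 * (y + 1))), fun x y => f (3 * x, 3 * y),
      fun x _ y _ => ⟨rfl, rfl⟩, fun x _ y _ => ⟨rfl, rfl⟩, fun x hx => ?_,
      fun i => ⟨hf0 _, rfl, rfl, rfl, rfl, ?_⟩⟩
    · have hw4 : 4 * w = 1 - 3 * u := by linarith
      obtain ⟨B0, B1, B2, B3⟩ := B
      obtain ⟨T0, T1, T2, T3⟩ := T
      obtain ⟨L0, L1, L2, L3⟩ := L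
      obtain ⟨R0, R1, R2, R3⟩ := R
      simp only at c1 c2 c3 c4
      obtain rfl : w = (1 - 3 * u) / 4 := by linarith
      subst c1 c2 c3 c4
      interval_cases x
      · refine ⟨?_, ?_, ?_, ?_⟩ <;> simp only [Prod.ext_iff] <;>
          refine ⟨?_, ?_, ?_, ?_⟩ <;> rw [hf _ (by decide)] <;>
          simp [interp, interpNodes, hφ, boundaryFun, thirdEdges] <;> ring
      · refine ⟨?_, ?_, ?_, ?_⟩ <;> simp only [Prod.ext_iff] <;>
          refine ⟨?_, ?_, ?_, ?_⟩ <;> rw [hf _ (by decide)] <;>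
          simp [interp, interpNodes, hφ, boundaryFun, thirdEdges] <;> ring
      · refine ⟨?_, ?_, ?_, ?_⟩ <;> simp only [Prod.ext_iff] <;>
          refine ⟨?_, ?_, ?_, ?_⟩ <;> rw [hf _ (by decide)] <;>
          simp [interp, interpNodes, hφ, boundaryFun, thirdEdges] <;> ring
    · have := hfi i
      intro p hp q hq
      have e : ∀ p ∈ thirdPoints, boundaryFun
          (f (3 * digitX i, 3 * digitY i), f (3 * digitX i + 1, 3 * digitY i),
            f (3 * digitX i + 2, 3 * digitY i), f (3 * (digitX i + 1), 3 * digitY i))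
          (f (3 * digitX i, 3 * (digitY i + 1)), f (3 * digitX i + 1, 3 * (digitY i + 1)),
            f (3 * digitX i + 2, 3 * (digitY i + 1)), f (3 * (digitX i + 1), 3 * (digitY i + 1)))
          (f (3 * digitX i, 3 * digitY i), f (3 * digitX i, 3 * digitY i + 1),
            f (3 * digitX i, 3 * digitY i + 2), f (3 * digitX i, 3 * (digitY i + 1)))
          (f (3 * (digitX i + 1), 3 * digitY i), f (3 * (digitX i + 1), 3 * digitY i + 1),
            f (3 * (digitX i + 1), 3 * digitY i + 2), f (3 * (digitX i + 1), 3 * (digitY i + 1))) p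
                =
          f (shiftPoint i p) := by
        intro p hp
        simp only [thirdPoints, List.mem_cons, List.not_mem_nil, or_false] at hp
        rcases hp with rfl | rfl | rfl | rfl | rfl | rfl | rfl | rfl | rfl | rfl | rfl | rfl <;> rfl
      have h2 := this p hp q hq
      beta_reduce at h2 ⊢
      rw [e p hp, e q hq]
      exact h2

theorem fst_sub_fst_le : ∀ p ∈ thirdPoints, ∀ q ∈ thirdPoints,
    p.1 ≤ q.1 + chebyshev p q ∧ p.1 ≤ q.1 + sideDist p q := by
  decide

/-- The data are those of `(u + w) * x`; both distances dominate the difference of the first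
coordinates. -/
theorem thirdAdmissibleEdges_crossing {u w : ℝ} (hu : 0 ≤ u) (hw : 0 ≤ w) :
    thirdAdmissibleEdges u w 1 (0, u + w, 2 * (u + w), 3 * (u + w))
      (0, u + w, 2 * (u + w), 3 * (u + w)) (0, 0, 0, 0)
      (3 * (u + w), 3 * (u + w), 3 * (u + w), 3 * (u + w)) := by
  refine ⟨rfl, rfl, rfl, rfl, fun p hp q hq => ?_⟩
  have e : ∀ p ∈ thirdPoints, boundaryFun (0, u + w, 2 * (u + w), 3 * (u + w))
      (0, u + w, 2 * (u + w), 3 * (u + w)) (0, 0, 0, 0)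
      (3 * (u + w), 3 * (u + w), 3 * (u + w), 3 * (u + w)) p = (u + w) * p.1 := by
    intro p hp
    simp only [thirdPoints, List.mem_cons, List.not_mem_nil, or_false] at hp
    rcases hp with rfl | rfl | rfl | rfl | rfl | rfl | rfl | rfl | rfl | rfl | rfl | rfl <;>
      simp [boundaryFun] <;> ring
  obtain ⟨h1, h2⟩ := fst_sub_fst_le p hp q hq
  have h1' : (p.1 : ℝ) ≤ q.1 + chebyshev p q := by exact_mod_cast h1
  have h2' : (p.1 : ℝ) ≤ q.1 + sideDist p q := by exact_mod_cast h2
  rw [e p hp, e q hq]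
  linarith [mul_le_mul_of_nonneg_left h1' hu, mul_le_mul_of_nonneg_left h2' hw]

/-! ### Crossing potentials for all parameters in `σ` -/

/-- There are, on all scales, discrete functions which separate the left from the right side and
whose oscillation on the square of a word is controlled by the weight of the word. -/
def HasCrossingPotentials (a b c M : ℝ) : Prop :=
  ∀ N : ℕ, ∃ (F : ℕ → ℕ → ℝ) (m : Word → ℝ), (∀ t ≤ 3 ^ N, F 0 t = 0 ∧ F (3 ^ N) t = c) ∧
    ∀ w v : Word, w.length + v.length = N → ∀ p ≤ 1, ∀ q ≤ 1,
      |F (coordX (w ++ v) + p) (coordY (w ++ v) + q) - m w| ≤ M * weight a b w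

theorem weight_mono {a a' b : ℝ} (ha : 0 ≤ a') (hb : 0 ≤ b) (h : a' ≤ a) (w : Word) :
    weight a' b w ≤ weight a b w := by
  have h0 : ∀ i, 0 ≤ ratio a' b i := fun i => by
    unfold ratio
    split_ifs <;> assumption
  have h1 : ∀ i, ratio a' b i ≤ ratio a b i := fun i => by
    unfold ratio
    split_ifs
    exacts [h, le_rfl]
  have hp : ∀ w, 0 ≤ weight a' b w := fun w => by
    induction w with
    | nil => simp
    | cons i w ih => exact mul_nonneg (h0 i) ih
  induction w with
  | nil => simp
  | cons i w ih => exact mul_le_mul (h1 i) ih (hp w) ((h0 i).trans (h1 i))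

theorem EdgeSystem.Extends.hasCrossingPotentials {E : Type*} {S : EdgeSystem E} {a b K : ℝ}
    {A : ℝ → E → E → E → E → Prop} (h : S.Extends a b K A) (ha : 0 < a) (hb : 0 < b) (ha1 : a < 1)
    (hb1 : b < 1) (hK : 0 < K) {B T L R : E} (hA : A 1 B T L R) (hL : ∀ i, S.sub i L = L)
    (hL0 : S.l L = 0) (hL1 : S.r L = 0) (hR : ∀ i, S.sub i R = R) (hR0 : S.r R = S.l R) :
    ∃ M, 0 < M ∧ HasCrossingPotentials a b (S.l R) M := by
  have hm : max a b < 1 := max_lt ha1 hb1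
  refine ⟨K / (1 - max a b), div_pos hK (by linarith), fun N => ?_⟩
  obtain ⟨F, m, -, h1, h2⟩ := h.exists_potential ha hb ha1 hb1 hK.le N one_pos hA
  refine ⟨F, m, fun t ht => ?_, fun w v hwv p hp q hq => ?_⟩
  · obtain ⟨-, -, h3, h4⟩ := h1 t ht
    rw [h3, h4, S.eval_const hL (by rw [hL0, hL1]), S.eval_const hR hR0]
    exact ⟨hL0, rfl⟩
  · simpa using h2 w v hwv p hp q hq

theorem HasCrossingPotentials.mono {a a' b c M : ℝ} (h : HasCrossingPotentials a' b c M)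
    (ha : 0 ≤ a')
    (hb : 0 ≤ b) (haa : a' ≤ a) (hM : 0 ≤ M) : HasCrossingPotentials a b c M := by
  intro N
  obtain ⟨F, m, h1, h2⟩ := h N
  exact ⟨F, m, h1, fun w v hwv p hp q hq => (h2 w v hwv p hp q hq).trans
    (mul_le_mul_of_nonneg_left (weight_mono ha hb haa w) hM)⟩

/-- For `b < 1/3` it suffices to treat `a = 1 - 2 * b`, since weights increase with `a`. For `b ≥
1/3` the choice `α = min a (1/3)` satisfies all requirements of `extends_endEdges`. -/
theorem exists_crossingPotentials {a b : ℝ} (hab : (a, b) ∈ paramSet) :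
    ∃ c M, 0 < c ∧ 0 < M ∧ HasCrossingPotentials a b c M := by
  obtain ⟨ha, ha1, hb, hb1, h1, h2⟩ := hab
  simp only at *
  rcases le_or_gt (1 / 3) b with hb3 | hb3
  · have hα : 0 < min a (1 / 3) := lt_min ha (by norm_num)
    have hb' : 1 - 2 * min a (1 / 3) ≤ b := by
      rcases min_choice a (1 / 3) with h | h <;> rw [h] <;> linarith
    obtain ⟨M, hM, h⟩ := (extends_endEdges hα (min_le_right _ _) (min_le_left _ _)
      ((min_le_right _ _).trans hb3) hb').hasCrossingPotentials ha hb ha1 hb1 one_pos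
      (B := (0, 1)) (T := (0, 1)) (L := (0, 0)) (R := (1, 1))
      ⟨rfl, rfl, rfl, by simp⟩ (fun i => by simp [endEdges]) rfl rfl (fun i => by simp [endEdges])
          rfl
    exact ⟨_, M, one_pos, hM, h⟩
  · have ha' : 0 < 1 - 2 * b := by linarith
    have haa : 1 - 2 * b ≤ a := by linarith
    rcases le_or_gt b (1 / 4) with hb4 | hb4
    · obtain ⟨M, hM, h⟩ := (extends_midEdges hb hb4).hasCrossingPotentials ha' hb (by linarith) hb1
        two_pos (midAdmissibleEdges_crossing hb hb4)
        (fun i => by simp [midEdges]) rfl rfl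
        (fun i => by simp only [midEdges]; split_ifs <;> simp <;> ring) rfl
      exact ⟨_, M, by simpa [midEdges] using hb, hM, h.mono ha'.le hb.le haa hM.le⟩
    -- `u = 4 * b - 1` and `w = 1 - 3 * b` solve `u + w = b` and `u + 2 * w = 1 - 2 * b`; they are
    -- nonnegative precisely for `b` between `1/4` and `1/3`.
    · have hu : 0 ≤ 4 * b - 1 := by linarith
      have hw : 0 ≤ 1 - 3 * b := by linarith
      have E := extends_thirdEdges hu hw (by ring)
      have C := thirdAdmissibleEdges_crossing hu hw
      rw [show 4 * b - 1 + 2 * (1 - 3 * b) = 1 - 2 * b by ring,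
        show 4 * b - 1 + (1 - 3 * b) = b by ring] at E
      rw [show 4 * b - 1 + (1 - 3 * b) = b by ring] at C
      obtain ⟨M, hM, h⟩ := E.hasCrossingPotentials ha' hb (by linarith) hb1 (by norm_num) C
        (fun i => by simp [thirdEdges]) rfl rfl (fun i => by simp [thirdEdges]) rfl
      exact ⟨_, M, by simpa [thirdEdges] using hb, hM, h.mono ha'.le hb.le haa hM.le⟩

/-! ### Cells and their grid squares -/

theorem coordX_append (w v : Word) : coordX (w ++ v) = coordX w * 3 ^ v.length + coordX v := by
  induction w with
  | nil => simp [coordX]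
  | cons i w ih =>
    rw [List.cons_append, coordX, coordX, ih, List.length_append, pow_add]
    ring

theorem coordY_append (w v : Word) : coordY (w ++ v) = coordY w * 3 ^ v.length + coordY v := by
  induction w with
  | nil => simp [coordY]
  | cons i w ih =>
    rw [List.cons_append, coordY, coordY, ih, List.length_append, pow_add]
    ring

theorem weight_append (a b : ℝ) (w v : Word) : weight a b (w ++ v) = weight a b w * weight a b v :=
    by
  simp [weight]

theorem contr_eq (i : Fin 8) (x : ℝ × ℝ) :
    contr i x = ((digitX i + x.1) / 3, (digitY i + x.2) / 3) := by
  ext <;> fin_cases i <;> simp [contr, vertex, digitX, digitY] <;> ring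

theorem wordMap_eq (w : Word) (x : ℝ × ℝ) :
    wordMap w x = ((coordX w + x.1) / 3 ^ w.length, (coordY w + x.2) / 3 ^ w.length) := by
  induction w with
  | nil => simp [wordMap, coordX, coordY]
  | cons i w ih =>
    change contr i (wordMap w x) = _
    rw [ih, contr_eq, coordX, coordY, List.length_cons]
    have : (3 : ℝ) ^ w.length ≠ 0 := by positivity
    ext <;> push_cast <;> field_simp <;> ring

theorem wordMap_append (w v : Word) (x : ℝ × ℝ) : wordMap (w ++ v) x = wordMap w (wordMap v x) := by
  simp [wordMap]

theorem cell_nil : cell [] = carpet := by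
  have : wordMap [] = id := rfl
  rw [cell, this, Set.image_id]

theorem carpet_subset {x : ℝ × ℝ} (hx : x ∈ carpet) : (0 ≤ x.1 ∧ x.1 ≤ 1) ∧ 0 ≤ x.2 ∧ x.2 ≤ 1 :=
  Set.mem_iInter.1 hx 0

theorem exists_mem_cell {x : ℝ × ℝ} (hx : x ∈ carpet) (n : ℕ) :
    ∃ w : Word, w.length = n ∧ x ∈ cell w := by
  induction n generalizing x with
  | zero => exact ⟨[], rfl, by rwa [cell_nil]⟩
  | succ n ih =>
    rw [carpet_selfSimilar] at hx
    obtain ⟨i, y, hy, rfl⟩ := Set.mem_iUnion.1 hx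
    obtain ⟨w, hw, z, hz, rfl⟩ := ih hy
    exact ⟨i :: w, by simp [hw], z, hz, rfl⟩

theorem contr_mem {x : ℝ × ℝ} (hx : x ∈ carpet) (i : Fin 8) : contr i x ∈ carpet := by
  rw [carpet_selfSimilar]
  exact Set.mem_iUnion.2 ⟨i, x, hx, rfl⟩

theorem wordMap_mem {x : ℝ × ℝ} (hx : x ∈ carpet) (w : Word) : wordMap w x ∈ carpet := by
  induction w with
  | nil => exact hx
  | cons i w ih => exact contr_mem ih i

theorem cell_append_subset (w v : Word) : cell (w ++ v) ⊆ cell w := by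
  rintro _ ⟨x, hx, rfl⟩
  rw [wordMap_append]
  exact ⟨_, wordMap_mem hx v, rfl⟩

theorem exists_mem_cell_append {x : ℝ × ℝ} {w : Word} (hx : x ∈ cell w) (n : ℕ) :
    ∃ v : Word, v.length = n ∧ x ∈ cell (w ++ v) := by
  obtain ⟨y, hy, rfl⟩ := hx
  obtain ⟨v, hv, z, hz, rfl⟩ := exists_mem_cell hy n
  exact ⟨v, hv, z, hz, wordMap_append w v z⟩

theorem mem_cell_bounds {x : ℝ × ℝ} {w : Word} (hx : x ∈ cell w) :
    (coordX w ≤ x.1 * 3 ^ w.length ∧ x.1 * 3 ^ w.length ≤ coordX w + 1) ∧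
      coordY w ≤ x.2 * 3 ^ w.length ∧ x.2 * 3 ^ w.length ≤ coordY w + 1 := by
  obtain ⟨y, hy, rfl⟩ := hx
  obtain ⟨⟨h1, h2⟩, h3, h4⟩ := carpet_subset hy
  have : (3 : ℝ) ^ w.length ≠ 0 := by positivity
  rw [wordMap_eq]
  simp only [div_mul_cancel₀ _ this]
  exact ⟨⟨by linarith, by linarith⟩, by linarith, by linarith⟩

theorem corner_mem {p q : ℕ} (hp : p ≤ 1) (hq : q ≤ 1) : ((p : ℝ), (q : ℝ)) ∈ carpet := by
  -- The corner `(p, q)` is the fixed point of the contraction with digits `2 * p` and `2 * q`.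
  obtain ⟨i, hi1, hi2⟩ : ∃ i, digitX i = 2 * p ∧ digitY i = 2 * q :=
    exists_letter (by omega) (by omega) (by omega)
  refine Set.mem_iInter.2 fun n => ?_
  induction n with
  | zero =>
    refine ⟨⟨?_, ?_⟩, ?_, ?_⟩
    · exact Nat.cast_nonneg p
    · exact Nat.cast_le_one.2 hp
    · exact Nat.cast_nonneg q
    · exact Nat.cast_le_one.2 hq
  | succ n ih =>
    refine Set.mem_iUnion.2 ⟨i, _, ih, ?_⟩
    rw [contr_eq, hi1, hi2]
    push_cast
    ext <;> dsimp only <;> ring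

theorem exists_add_eq_add {x y : ℕ} (h1 : x ≤ y + 1) (h2 : y ≤ x + 1) :
    ∃ p q, p ≤ 1 ∧ q ≤ 1 ∧ x + p = y + q := by
  obtain h | h | h : x = y + 1 ∨ x = y ∨ y = x + 1 := by omega
  · exact ⟨0, 1, by omega⟩
  · exact ⟨0, 0, by omega⟩
  · exact ⟨1, 0, by omega⟩

/-- Touching squares of equal level share a corner, and corners of squares belong to the cells. -/
theorem cell_inter_nonempty {w v : Word} (hl : w.length = v.length) (h1 : coordX w ≤ coordX v + 1)
    (h2 : coordX v ≤ coordX w + 1) (h3 : coordY w ≤ coordY v + 1)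
    (h4 : coordY v ≤ coordY w + 1) : (cell w ∩ cell v).Nonempty := by
  obtain ⟨p, p', hp, hp', e⟩ := exists_add_eq_add h1 h2
  obtain ⟨q, q', hq, hq', f⟩ := exists_add_eq_add h3 h4
  refine ⟨wordMap w (p, q), ⟨_, corner_mem hp hq, rfl⟩, _, corner_mem hp' hq', ?_⟩
  rw [wordMap_eq, wordMap_eq, hl]
  have e' : (coordX w : ℝ) + p = coordX v + p' := by exact_mod_cast e
  have f' : (coordY w : ℝ) + q = coordY v + q' := by exact_mod_cast f
  simp only [e', f']

theorem coord_le_of_abs_sub_lt {x y : ℝ} {m n N : ℕ} (hx : m ≤ x * 3 ^ N) (hy : y * 3 ^ N ≤ n + 1)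
    (h : x - y < 1 / 3 ^ N) : m ≤ n + 1 := by
  have h3 : (0 : ℝ) < 3 ^ N := by positivity
  have := mul_lt_mul_of_pos_right h h3
  rw [one_div, inv_mul_cancel₀ h3.ne'] at this
  have : (m : ℝ) < n + 1 + 1 := by linarith
  have : m < n + 1 + 1 := by exact_mod_cast this
  omega

theorem coord_adjacent {x y : ℝ × ℝ} {w v : Word} (hl : w.length = v.length) (hx : x ∈ cell w)
    (hy : y ∈ cell v) (h1 : |x.1 - y.1| < 1 / 3 ^ w.length) (h2 : |x.2 - y.2| < 1 / 3 ^ w.length) :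
    (coordX w ≤ coordX v + 1 ∧ coordX v ≤ coordX w + 1) ∧
      coordY w ≤ coordY v + 1 ∧ coordY v ≤ coordY w + 1 := by
  obtain ⟨⟨a1, a2⟩, a3, a4⟩ := mem_cell_bounds hx
  obtain ⟨⟨b1, b2⟩, b3, b4⟩ := mem_cell_bounds hy
  rw [← hl] at b1 b2 b3 b4
  rw [abs_lt] at h1 h2
  exact ⟨⟨coord_le_of_abs_sub_lt a1 b2 h1.2, coord_le_of_abs_sub_lt b1 a2 (by linarith)⟩,
    coord_le_of_abs_sub_lt a3 b4 h2.2, coord_le_of_abs_sub_lt b3 a4 (by linarith)⟩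

/-! ### Comparable weights of neighbouring squares -/

theorem ratio_eq_of_digits (a b : ℝ) : ∀ i j : Fin 8, (digitX i = 1 ↔ digitX j = 1) →
    (digitY i = 1 ↔ digitY j = 1) → ratio a b i = ratio a b j := by
  intro i j h1 h2
  have : ∀ i j : Fin 8, (digitX i = 1 ↔ digitX j = 1) → (digitY i = 1 ↔ digitY j = 1) →
    (Even i.val ↔ Even j.val) := by decide
  simp only [ratio, this i j h1 h2]

theorem ratio_le_mul {a b M : ℝ} (hM1 : 1 ≤ M) (ha : 0 < a) (hb : 0 < b) (hab : a ≤ M * b)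
    (hba : b ≤ M * a) (i j : Fin 8) : ratio a b i ≤ M * ratio a b j := by
  unfold ratio
  split_ifs
  · nlinarith
  · exact hab
  · exact hba
  · nlinarith

/-- Removing the last digit of two adjacent indices either keeps their distance, and then both
digits are `1` or neither is, or lowers it by one. -/
theorem adjacent_of_adjacent {m n d e : ℕ} (hd : d ≤ 2) (he : e ≤ 2)
    (h1 : m * 3 + d ≤ n * 3 + e + 1) (h2 : n * 3 + e ≤ m * 3 + d + 1) :
    (m ≤ n + 1 ∧ n ≤ m + 1) ∧
    ((m - n) + (n - m) = (m * 3 + d - (n * 3 + e)) + (n * 3 + e - (m * 3 + d)) ∧ (d = 1 ↔ e = 1) ∨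
      (m - n) + (n - m) + 1 = (m * 3 + d - (n * 3 + e)) + (n * 3 + e - (m * 3 + d))) := by
  omega

/-- The ratio of a letter depends only on which of its digits equal `1`. Going up from two adjacent
squares, letters can have different ratios only when the distance in one of the coordinates drops;
this happens at most twice, whence the exponent. -/
theorem weight_le_of_adjacent {a b M : ℝ} (hM1 : 1 ≤ M) (ha : 0 < a) (hb : 0 < b) (hab : a ≤ M * b)
    (hba : b ≤ M * a) {w v : Word} (hl : w.length = v.length)
    (h1 : coordX w ≤ coordX v + 1) (h2 : coordX v ≤ coordX w + 1) (h3 : coordY w ≤ coordY v + 1)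
    (h4 : coordY v ≤ coordY w + 1) : weight a b w ≤ M ^ 2 * weight a b v := by
  suffices weight a b w ≤ M ^ ((coordX w - coordX v) + (coordX v - coordX w) +
      ((coordY w - coordY v) + (coordY v - coordY w))) * weight a b v from
    this.trans (mul_le_mul_of_nonneg_right (pow_le_pow_right₀ hM1 (by omega)) (weight_pos ha hb
        v).le)
  induction w using List.reverseRecOn generalizing v with
  | nil =>
    obtain rfl := List.length_eq_zero_iff.1 hl.symm
    simp
  | append_singleton w i ih =>
    rcases List.eq_nil_or_concat' v with rfl | ⟨v, j, rfl⟩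
    · simp at hl
    · have hl' : w.length = v.length := by simpa using hl
      have eX : ∀ (w : Word) i, coordX (w ++ [i]) = coordX w * 3 + digitX i := fun w i => by
        rw [coordX_append]; simp [coordX]
      have eY : ∀ (w : Word) i, coordY (w ++ [i]) = coordY w * 3 + digitY i := fun w i => by
        rw [coordY_append]; simp [coordY]
      rw [eX, eX] at h1 h2
      rw [eY, eY] at h3 h4
      obtain ⟨⟨x1, x2⟩, x3⟩ := adjacent_of_adjacent (digitX_le i) (digitX_le j) h1 h2
      obtain ⟨⟨y1, y2⟩, y3⟩ := adjacent_of_adjacent (digitY_le i) (digitY_le j) h3 h4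
      have key := ih hl' x1 x2 y1 y2
      rw [eX, eX, eY, eY, weight_append, weight_append, weight_cons, weight_cons, weight_nil,
          mul_one,
        mul_one]
      have hr := ratio_le_mul hM1 ha hb hab hba i j
      have hi := ratio_pos ha hb i
      have hj := ratio_pos ha hb j
      have hw := weight_pos ha hb w
      have hv := weight_pos ha hb v
      generalize hex : (coordX w - coordX v) + (coordX v - coordX w) = ex at *
      generalize hey : (coordY w - coordY v) + (coordY v - coordY w) = ey at *
      generalize hex' : (coordX w * 3 + digitX i - (coordX v * 3 + digitX j)) +
        (coordX v * 3 + digitX j - (coordX w * 3 + digitX i)) = ex' at *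
      generalize hey' : (coordY w * 3 + digitY i - (coordY v * 3 + digitY j)) +
        (coordY v * 3 + digitY j - (coordY w * 3 + digitY i)) = ey' at *
      by_cases hs : ex' + ey' = ex + ey
      · rw [hs, ratio_eq_of_digits a b i j (by omega) (by omega), ← mul_assoc]
        exact mul_le_mul_of_nonneg_right key hj.le
      · calc weight a b w * ratio a b i ≤ M ^ (ex + ey) * weight a b v * (M * ratio a b j) := by
              gcongr
          _ = M ^ (ex + ey + 1) * (weight a b v * ratio a b j) := by ring
          _ ≤ M ^ (ex' + ey') * (weight a b v * ratio a b j) := by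
              exact mul_le_mul_of_nonneg_right (pow_le_pow_right₀ hM1 (by omega)) (by positivity)

/-! ### Functions rising around a given square -/

/-- A discrete function on the grid of level `k` whose oscillation on the square of each word is
controlled by the weight of the word. -/
def OscBounded (a b M : ℝ) (k : ℕ) (G : ℕ → ℕ → ℝ) : Prop :=
  ∃ m : Word → ℝ, ∀ w v : Word, w.length + v.length = k → ∀ p ≤ 1, ∀ q ≤ 1,
    |G (coordX (w ++ v) + p) (coordY (w ++ v) + q) - m w| ≤ M * weight a b w

namespace OscBounded

variable {a b M : ℝ} {k : ℕ} {G G' : ℕ → ℕ → ℝ}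

theorem congr (h : OscBounded a b M k G) (hG : ∀ x ≤ 3 ^ k, ∀ y ≤ 3 ^ k, G' x y = G x y) :
    OscBounded a b M k G' := by
  obtain ⟨m, hm⟩ := h
  refine ⟨m, fun w v hl p hp q hq => ?_⟩
  have hX := coordX_lt (w ++ v)
  have hY := coordY_lt (w ++ v)
  rw [List.length_append, hl] at hX hY
  rw [hG _ (by omega) _ (by omega)]
  exact hm w v hl p hp q hq

theorem const (ha : 0 < a) (hb : 0 < b) (hM : 0 ≤ M) (k : ℕ) (c : ℝ) :
    OscBounded a b M k fun _ _ => c :=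
  ⟨fun _ => c, fun w v hl p hp q hq => by
    rw [sub_self, abs_zero]
    exact mul_nonneg hM (weight_pos ha hb w).le⟩

theorem max (h : OscBounded a b M k G) (h' : OscBounded a b M k G') :
    OscBounded a b M k fun x y => max (G x y) (G' x y) := by
  obtain ⟨m, hm⟩ := h
  obtain ⟨m', hm'⟩ := h'
  exact ⟨fun w => Max.max (m w) (m' w), fun w v hl p hp q hq =>
    (abs_max_sub_max_le_max _ _ _ _).trans (max_le (hm w v hl p hp q hq) (hm' w v hl p hp q hq))⟩

theorem comp_lipschitz (h : OscBounded a b M k G) (f : ℝ → ℝ) (hf : ∀ x y, |f x - f y| ≤ |x - y|) :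
    OscBounded a b M k fun x y => f (G x y) := by
  obtain ⟨m, hm⟩ := h
  exact ⟨fun w => f (m w), fun w v hl p hp q hq => (hf _ _).trans (hm w v hl p hp q hq)⟩

theorem exists_swap (i : Fin 8) : ∃ j, digitX j = digitY i ∧ digitY j = digitX i ∧
    (Even j.val ↔ Even i.val) := by
  revert i
  decide

theorem exists_flip (i : Fin 8) : ∃ j, digitX j = 2 - digitX i ∧ digitY j = digitY i ∧
    (Even j.val ↔ Even i.val) := by
  revert i
  decide

/-- Reflections of the square act on words letter by letter and preserve the parity of letters,
hence the weights. -/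
theorem swap (h : OscBounded a b M k G) : OscBounded a b M k fun x y => G y x := by
  obtain ⟨m, hm⟩ := h
  choose σ h1 h2 h3 using exists_swap
  have cX : ∀ w : Word, coordX (w.map σ) = coordY w := fun w => by
    induction w with
    | nil => rfl
    | cons i w ih => simp [coordX, coordY, h1, ih]
  have cY : ∀ w : Word, coordY (w.map σ) = coordX w := fun w => by
    induction w with
    | nil => rfl
    | cons i w ih => simp [coordX, coordY, h2, ih]
  have hg : ∀ w : Word, weight a b (w.map σ) = weight a b w := fun w => by
    induction w with
    | nil => rfl
    | cons i w ih => rw [List.map_cons, weight_cons, weight_cons, ih]; simp only [ratio, h3]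
  refine ⟨fun w => m (w.map σ), fun w v hl p hp q hq => ?_⟩
  have := hm (w.map σ) (v.map σ) (by simpa using hl) q hq p hp
  rwa [← List.map_append, cX, cY, hg] at this

theorem flip (h : OscBounded a b M k G) : OscBounded a b M k fun x y => G (3 ^ k - x) y := by
  obtain ⟨m, hm⟩ := h
  choose σ h1 h2 h3 using exists_flip
  have cX : ∀ w : Word, coordX (w.map σ) + coordX w + 1 = 3 ^ w.length := fun w => by
    induction w with
    | nil => rfl
    | cons i w ih =>
      have := digitX_le i
      obtain ⟨d, hd⟩ : ∃ d, digitX (σ i) = d ∧ digitX i + d = 2 := ⟨_, rfl, by rw [h1]; omega⟩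
      have e : (digitX i + d) * 3 ^ w.length = 2 * 3 ^ w.length := by rw [hd.2]
      rw [List.map_cons, coordX, coordX, List.length_map, List.length_cons, pow_succ, hd.1]
      linarith
  have cY : ∀ w : Word, coordY (w.map σ) = coordY w := fun w => by
    induction w with
    | nil => rfl
    | cons i w ih => simp [coordY, h2, ih]
  have hg : ∀ w : Word, weight a b (w.map σ) = weight a b w := fun w => by
    induction w with
    | nil => rfl
    | cons i w ih => rw [List.map_cons, weight_cons, weight_cons, ih]; simp only [ratio, h3]
  refine ⟨fun w => m (w.map σ), fun w v hl p hp q hq => ?_⟩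
  -- The reflection exchanges left and right corners, hence `1 - p`.
  have := hm (w.map σ) (v.map σ) (by simpa using hl) (1 - p) (by omega) q hq
  rw [← List.map_append, cY, hg] at this
  have e := cX (w ++ v)
  rw [List.length_append, hl] at e
  convert this using 5
  omega

theorem flip' (h : OscBounded a b M k G) : OscBounded a b M k fun x y => G x (3 ^ k - y) :=
  h.swap.flip.swap

end OscBounded

/-- The triangle wave on `ℕ` with slopes `± 1` and extrema at the multiples of `B`. -/
def fold (B j : ℕ) : ℕ := if j / B % 2 = 0 then j % B else B - j % B

/-- The distance to the interval `[X * B, (X + 1) * B]`, truncated at `B`. -/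
def blockDist (B X i : ℕ) : ℕ := min (X * B - i + (i - (X + 1) * B)) B

theorem fold_le {B : ℕ} (hB : 0 < B) (j : ℕ) : fold B j ≤ B := by
  have := (Nat.mod_lt j hB).le
  unfold fold
  split_ifs <;> omega

theorem fold_mul_add {B Y y : ℕ} (hB : 0 < B) (hy : y ≤ B) :
    fold B (Y * B + y) = if Y % 2 = 0 then y else B - y := by
  unfold fold
  rcases hy.lt_or_eq with hy | rfl
  · rw [Nat.mul_comm, Nat.mul_add_div hB, Nat.mul_add_mod, Nat.div_eq_of_lt hy,
      Nat.mod_eq_of_lt hy, Nat.add_zero]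
  · rw [show Y * y + y = y * (Y + 1) by ring, Nat.mul_div_cancel_left _ hB, Nat.mul_mod_right]
    split_ifs <;> omega

theorem blockDist_self {B X x : ℕ} (hx : x ≤ B) : blockDist B X (X * B + x) = 0 := by
  unfold blockDist
  rw [Nat.add_mul, Nat.one_mul]
  omega

theorem blockDist_succ {B X x : ℕ} (hx : x ≤ B) : blockDist B X ((X + 1) * B + x) = x := by
  unfold blockDist
  rw [Nat.add_mul, Nat.one_mul]
  omega

theorem blockDist_pred {B X x : ℕ} (hx : x ≤ B) : blockDist B (X + 1) (X * B + x) = B - x := by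
  have h1 : (X + 1) * B = X * B + B := by ring
  have h2 : (X + 1 + 1) * B = X * B + 2 * B := by ring
  unfold blockDist
  omega

theorem blockDist_of_le {B X i : ℕ} (h : i + B ≤ X * B ∨ (X + 2) * B ≤ i) : blockDist B X i = B :=
    by
  have h1 : (X + 1) * B = X * B + B := by ring
  have h2 : (X + 2) * B = X * B + 2 * B := by ring
  unfold blockDist
  omega

theorem blockDist_far {B X X' x : ℕ} (h : X' + 2 ≤ X ∨ X + 2 ≤ X') (hx : x ≤ B) :
    blockDist B X (X' * B + x) = B := by
  refine blockDist_of_le (h.imp (fun h => ?_) fun h => ?_)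
  · have := Nat.mul_le_mul_right B h
    rw [Nat.add_mul] at this
    omega
  · have := Nat.mul_le_mul_right B h
    omega

/-- On a single block the function is constant, when the block is not next to column `X`, or a
reflected copy of `F`. The reflections by `fold` make the copies match across the boundaries of
blocks. -/
theorem OscBounded.strip {a b M c : ℝ} {k : ℕ} {F : ℕ → ℕ → ℝ} (ha : 0 < a) (hb : 0 < b)
    (hM : 0 ≤ M) (h : OscBounded a b M k F)
    (h0 : ∀ t ≤ 3 ^ k, F 0 t = 0 ∧ F (3 ^ k) t = c) (X X' Y' : ℕ) :
    OscBounded a b M k fun x y =>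
      F (blockDist (3 ^ k) X (X' * 3 ^ k + x)) (fold (3 ^ k) (Y' * 3 ^ k + y)) := by
  have h3 : 0 < 3 ^ k := by positivity
  have h1 : ∃ G, OscBounded a b M k G ∧ ∀ x y, y ≤ 3 ^ k → F x (fold (3 ^ k) (Y' * 3 ^ k + y)) = G
      x y := by
    by_cases hY : Y' % 2 = 0
    · exact ⟨F, h, fun x y hy => by rw [fold_mul_add h3 hy, if_pos hY]⟩
    · exact ⟨_, h.flip', fun x y hy => by rw [fold_mul_add h3 hy, if_neg hY]⟩
  obtain ⟨G, hG, hFG⟩ := h1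
  by_cases hfar : X' + 2 ≤ X ∨ X + 2 ≤ X'
  · refine (OscBounded.const ha hb hM k c).congr fun x hx y hy => ?_
    rw [blockDist_far hfar hx, (h0 _ (fold_le h3 _)).2]
  · obtain rfl | rfl | rfl : X' = X ∨ X' = X + 1 ∨ X = X' + 1 := by omega
    · refine (OscBounded.const ha hb hM k 0).congr fun x hx y hy => ?_
      rw [blockDist_self hx, (h0 _ (fold_le h3 _)).1]
    · refine hG.congr fun x hx y hy => ?_
      rw [blockDist_succ hx, hFG _ _ hy]
    · refine hG.flip.congr fun x hx y hy => ?_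
      rw [blockDist_pred hx, hFG _ _ hy]

/-- A function which vanishes on the square with indices `(X, Y)`, and is equal to its maximal value
outside of the neighbouring squares. -/
noncomputable def tent (F : ℕ → ℕ → ℝ) (B X Y i j : ℕ) : ℝ :=
  max (F (blockDist B X i) (fold B j)) (F (blockDist B Y j) (fold B i))

/-- Words longer than `w` are governed by the oscillation of `F` inside one block, shorter ones by
the bound `c` on the whole range. Both are compared with `weight w` through the neighbours of `w`,
the only blocks where the tent may be neither `0` nor `c`. -/
theorem exists_tent_osc {a b c M Q : ℝ} (ha : 0 < a) (hb : 0 < b) (ha1 : a ≤ 1) (hb1 : b ≤ 1)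
    (hc : 0 ≤ c) (hM : 0 ≤ M) {k : ℕ} {F : ℕ → ℕ → ℝ} (hF : OscBounded a b M k F)
    (h0 : ∀ t ≤ 3 ^ k, F 0 t = 0 ∧ F (3 ^ k) t = c) (hF0 : ∀ x y, 0 ≤ F x y)
      (hFc : ∀ x y, F x y ≤ c)
    {w : Word} (hQ : ∀ v : Word, w.length = v.length → coordX w ≤ coordX v + 1 →
      coordX v ≤ coordX w + 1 → coordY w ≤ coordY v + 1 → coordY v ≤ coordY w + 1 →
      weight a b w ≤ Q * weight a b v) (v : Word) :
    ∃ μ, ∀ v' : Word, v.length + v'.length = w.length + k → ∀ p ≤ 1, ∀ q ≤ 1,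
      |tent F (3 ^ k) (coordX w) (coordY w) (coordX (v ++ v') + p) (coordY (v ++ v') + q) - μ| ≤
        (M + c) * Q / weight a b w * weight a b v := by
  have h3 : 0 < 3 ^ k := by positivity
  have hw := weight_pos ha hb w
  have hQ0 : 0 ≤ Q := by
    have := hQ w rfl (by omega) (by omega) (by omega) (by omega)
    nlinarith
  have hle1 : ∀ v : Word, weight a b v ≤ 1 := fun v => by
    induction v with
    | nil => simp
    | cons i v ih =>
      rw [weight_cons]
      refine mul_le_one₀ ?_ (weight_pos ha hb v).le ih
      unfold ratio
      split_ifs <;> assumption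
  have blk : ∀ u v : Word, v.length = k → ∀ p ≤ 1, ∀ q ≤ 1,
      coordX (u ++ v) + p = coordX u * 3 ^ k + (coordX v + p) ∧ coordX v + p ≤ 3 ^ k ∧
      coordY (u ++ v) + q = coordY u * 3 ^ k + (coordY v + q) ∧ coordY v + q ≤ 3 ^ k := by
    intro u v hv p hp q hq
    have hX := coordX_lt v
    have hY := coordY_lt v
    rw [coordX_append, coordY_append, hv]
    rw [hv] at hX hY
    omega
  have far : ∀ u : Word, ¬(coordX w ≤ coordX u + 1 ∧ coordX u ≤ coordX w + 1 ∧
      coordY w ≤ coordY u + 1 ∧ coordY u ≤ coordY w + 1) → ∀ v : Word, v.length = k →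
      ∀ p ≤ 1, ∀ q ≤ 1, tent F (3 ^ k) (coordX w) (coordY w) (coordX (u ++ v) + p)
        (coordY (u ++ v) + q) = c := by
    intro u hu v hv p hp q hq
    obtain ⟨e1, e2, e3, e4⟩ := blk u v hv p hp q hq
    rw [tent, e1, e3]
    obtain h | h : (coordX u + 2 ≤ coordX w ∨ coordX w + 2 ≤ coordX u) ∨
      (coordY u + 2 ≤ coordY w ∨ coordY w + 2 ≤ coordY u) := by omega
    · rw [blockDist_far h e2, (h0 _ (fold_le h3 _)).2, max_eq_left (hFc _ _)]
    · rw [blockDist_far h e4, (h0 _ (fold_le h3 _)).2, max_eq_right (hFc _ _)]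
  have hM' : ∀ u : Word, 0 ≤ (M + c) * Q / weight a b w * weight a b u := fun u => by
    have := weight_pos ha hb u
    positivity
  rcases le_or_gt w.length v.length with hl | hl
  · obtain ⟨u, v2, rfl, hu⟩ : ∃ u v2, v = u ++ v2 ∧ w.length = u.length :=
      ⟨v.take w.length, v.drop w.length, (List.take_append_drop _ _).symm, by simp [hl]⟩
    by_cases hadj : coordX w ≤ coordX u + 1 ∧ coordX u ≤ coordX w + 1 ∧
      coordY w ≤ coordY u + 1 ∧ coordY u ≤ coordY w + 1
    -- On the block of the neighbour `u` the oscillation is `M * weight v2`, where `weight v2` is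
    -- `weight v / weight u`.
    · obtain ⟨m, hm⟩ := ((hF.strip ha hb hM h0 (coordX w) (coordX u) (coordY u)).max
        (hF.strip ha hb hM h0 (coordY w) (coordY u) (coordX u)).swap)
      refine ⟨m v2, fun v' hv' p hp q hq => ?_⟩
      have hk : (v2 ++ v').length = k := by simp at hv' ⊢; omega
      obtain ⟨e1, e2, e3, e4⟩ := blk u (v2 ++ v') hk p hp q hq
      rw [List.append_assoc, tent, e1, e3]
      refine (hm v2 v' (by simpa using hk) p hp q hq).trans ?_
      have h1 := hQ u hu hadj.1 hadj.2.1 hadj.2.2.1 hadj.2.2.2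
      have h2 := weight_pos ha hb v2
      rw [weight_append, div_mul_eq_mul_div, le_div_iff₀ hw]
      calc M * weight a b v2 * weight a b w ≤ (M + c) * weight a b v2 * (Q * weight a b u) := by
            gcongr
            linarith
        _ = _ := by ring
    · refine ⟨c, fun v' hv' p hp q hq => ?_⟩
      have hk : (v2 ++ v').length = k := by simp at hv' ⊢; omega
      rw [List.append_assoc, far u hadj _ hk p hp q hq, sub_self, abs_zero]
      exact hM' _
  -- Now the square of `v` is larger than that of `w`. If it contains a neighbour `v ++ u` of `w`,
  -- then `weight w ≤ Q * weight v` and the trivial bound `c` suffices; otherwise the tent is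
  -- constantly `c` on it.
  · by_cases hadj : ∃ u : Word, w.length = (v ++ u).length ∧ coordX w ≤ coordX (v ++ u) + 1 ∧
        coordX (v ++ u) ≤ coordX w + 1 ∧ coordY w ≤ coordY (v ++ u) + 1 ∧
        coordY (v ++ u) ≤ coordY w + 1
    · obtain ⟨u, hu, h1, h2, h4, h5⟩ := hadj
      refine ⟨0, fun v' hv' p hp q hq => ?_⟩
      rw [sub_zero, tent, abs_of_nonneg (le_max_of_le_left (hF0 _ _))]
      refine (max_le (hFc _ _) (hFc _ _)).trans ?_
      have h6 := hQ _ hu h1 h2 h4 h5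
      have h7 : weight a b (v ++ u) ≤ weight a b v := by
        rw [weight_append]
        exact mul_le_of_le_one_right (weight_pos ha hb v).le (hle1 u)
      rw [div_mul_eq_mul_div, le_div_iff₀ hw]
      calc c * weight a b w ≤ (M + c) * (Q * weight a b v) := by
            gcongr
            · linarith
            · exact h6.trans (mul_le_mul_of_nonneg_left h7 hQ0)
        _ = _ := by ring
    · push Not at hadj
      refine ⟨c, fun v' hv' p hp q hq => ?_⟩
      obtain ⟨u, v3, rfl, hu⟩ : ∃ u v3, v' = u ++ v3 ∧ w.length = (v ++ u).length :=
        ⟨v'.take (w.length - v.length), v'.drop (w.length - v.length),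
          (List.take_append_drop _ _).symm, by simp; omega⟩
      have hk : v3.length = k := by simp at hv' hu; omega
      rw [← List.append_assoc, far (v ++ u) _ _ hk p hp q hq, sub_self, abs_zero]
      · exact hM' _
      · rintro ⟨h1, h2, h4, h5⟩
        exact absurd h5 (not_le.2 (hadj u hu h1 h2 h4))

/-! ### Lower bound for the weight of a chain -/

/-- Every weight enters two steps except those at the ends; their spare copies on the left absorb
the errors at the two end points of a chain. -/
theorem abs_sub_le_sum_of_isChain {α : Type*} {R : α → α → Prop} {m G : α → ℝ}
    (hR : ∀ x y, R x y → |m x - m y| ≤ G x + G y) (x : α) (l : List α) (h : (x :: l).IsChain R) :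
    |m x - m ((x :: l).getLast (List.cons_ne_nil x l))| + G x +
      G ((x :: l).getLast (List.cons_ne_nil x l)) ≤ 2 * ((x :: l).map G).sum := by
  induction l generalizing x with
  | nil => simp; linarith
  | cons y l ih =>
    rw [List.isChain_cons_cons] at h
    have h1 := ih y h.2
    have h2 := hR x y h.1
    rw [List.getLast_cons (List.cons_ne_nil y l)]
    rw [List.map_cons, List.sum_cons]
    have := abs_sub_le (m x) (m y) (m ((y :: l).getLast (List.cons_ne_nil y l)))
    linarith

/-- A distance above two blocks leaves at least one block between the point and block `X`; of the
two end points of the grid interval of `y`, the one farther from `X` is taken. -/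
theorem exists_blockDist_eq {x y : ℝ} {n k X i : ℕ} (h1 : (X : ℝ) ≤ x * 3 ^ n)
    (h2 : x * 3 ^ n ≤ X + 1) (h3 : (i : ℝ) ≤ y * 3 ^ (n + k)) (h4 : y * 3 ^ (n + k) ≤ i + 1)
    (h : 2 / 3 ^ n < |x - y|) : ∃ p ≤ 1, blockDist (3 ^ k) X (i + p) = 3 ^ k := by
  have hn : (0 : ℝ) < 3 ^ n := by positivity
  have hk : (0 : ℝ) < 3 ^ k := by positivity
  rw [div_lt_iff₀ hn] at h
  rw [pow_add, ← mul_assoc] at h3 h4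
  rcases abs_cases (x - y) with ⟨e, -⟩ | ⟨e, -⟩ <;> rw [e] at h
  · refine ⟨0, zero_le_one, blockDist_of_le (Or.inl ?_)⟩
    have : (i : ℝ) + 3 ^ k < X * 3 ^ k := by
      have := mul_lt_mul_of_pos_right (show y * 3 ^ n + 1 < X by linarith) hk
      linarith
    rw [Nat.add_zero]
    exact_mod_cast this.le
  · refine ⟨1, le_rfl, blockDist_of_le (Or.inr ?_)⟩
    have : ((X : ℝ) + 2) * 3 ^ k < i + 1 := by
      have := mul_lt_mul_of_pos_right (show (X : ℝ) + 2 < y * 3 ^ n by linarith) hk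
      linarith
    exact_mod_cast this.le

theorem exists_corner_eq {z : ℝ × ℝ} {w v : Word} (hl : w.length = v.length) (hw : z ∈ cell w)
    (hv : z ∈ cell v) : ∃ p p' q q', p ≤ 1 ∧ p' ≤ 1 ∧ q ≤ 1 ∧ q' ≤ 1 ∧
      coordX w + p = coordX v + p' ∧ coordY w + q = coordY v + q' := by
  obtain ⟨⟨h1, h2⟩, h3, h4⟩ := coord_adjacent hl hw hv (by simp) (by simp)
  obtain ⟨p, p', hp, hp', e⟩ := exists_add_eq_add h1 h2
  obtain ⟨q, q', hq, hq', f⟩ := exists_add_eq_add h3 h4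
  exact ⟨p, p', q, q', hp, hp', hq, hq', e, f⟩

/-- The tent around `w` is `0` near `x` and `c` near `y`, while passing between two cells `v`, `u`
of the chain changes it by at most `D * (weight v + weight u)`. Summation gives `c ≤ 2 * D * (total
weight)`, where `D` is inversely proportional to `weight w`. -/
theorem exists_le_weight_sum {a b : ℝ} (hab : (a, b) ∈ paramSet) : ∃ δ, 0 < δ ∧
    ∀ (w : Word) (x y : ℝ × ℝ) (γ : List Word), x ∈ cell w → IsChainBetween γ x y →
      (2 / 3 ^ w.length < |x.1 - y.1| ∨ 2 / 3 ^ w.length < |x.2 - y.2|) →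
      δ * weight a b w ≤ (γ.map (weight a b)).sum := by
  obtain ⟨c, M, hc, hM, hpot⟩ := exists_crossingPotentials hab
  obtain ⟨ha, ha1, hb, hb1, -, -⟩ := hab
  simp only at ha ha1 hb hb1
  set R := max 1 (max (a / b) (b / a)) with hR
  have hR1 : 1 ≤ R := le_max_left _ _
  have hRa : a ≤ R * b := by
    rw [← div_le_iff₀ hb]
    exact (le_max_left _ _).trans (le_max_right _ _)
  have hRb : b ≤ R * a := by
    rw [← div_le_iff₀ ha]
    exact (le_max_right _ _).trans (le_max_right _ _)
  have hD : 0 < 2 * ((M + c) * R ^ 2) := by positivity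
  refine ⟨c / (2 * ((M + c) * R ^ 2)), div_pos hc hD, fun w x y γ hx hγ hfar => ?_⟩
  -- The grid has to be fine enough to resolve all cells of the chain; the constants do not depend
  -- on `k`.
  obtain ⟨k, hk⟩ : ∃ k, ∀ v ∈ γ, v.length ≤ k := by
    refine ⟨(γ.map List.length).sum, fun v hv => List.single_le_sum (by simp) _
        (List.mem_map_of_mem hv)⟩
  obtain ⟨F₀, m₀, hF0, hosc⟩ := hpot k
  have h3 : 0 < 3 ^ k := by positivity
  obtain ⟨F, hF, h0, hFp, hFc⟩ : ∃ F, OscBounded a b M k F ∧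
      (∀ t ≤ 3 ^ k, F 0 t = 0 ∧ F (3 ^ k) t = c) ∧ (∀ x y, 0 ≤ F x y) ∧ ∀ x y, F x y ≤ c := by
    refine ⟨fun x y => max 0 (min c (F₀ x y)),
      OscBounded.comp_lipschitz ⟨m₀, hosc⟩ (fun t => max 0 (min c t)) fun s t => ?_,
      fun t ht => ?_, fun x y => le_max_left _ _, fun x y => max_le hc.le (min_le_left _ _)⟩
    · refine (abs_max_sub_max_le_max _ _ _ _).trans (max_le (by simp) ?_)
      exact (abs_min_sub_min_le_max _ _ _ _).trans (max_le (by simp) le_rfl)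
    · simp [hF0 t ht, hc.le]
  have osc := exists_tent_osc ha hb ha1.le hb1.le hc.le hM.le hF h0 hFp hFc (w := w) (Q := R ^ 2)
    fun v hl h1 h2 h3 h4 => weight_le_of_adjacent hR1 ha hb hRa hRb hl h1 h2 h3 h4
  choose μ hμ using osc
  set T := tent F (3 ^ k) (coordX w) (coordY w) with hT
  have hw := weight_pos ha hb w
  set D := (M + c) * R ^ 2 / weight a b w with hDdef
  have ext : ∀ v ∈ γ, ∀ z ∈ cell v, ∃ v' : Word, v.length + v'.length = w.length + k ∧
      z ∈ cell (v ++ v') := fun v hv z hz => by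
    obtain ⟨v', h1, h2⟩ := exists_mem_cell_append hz (w.length + k - v.length)
    have := hk v hv
    exact ⟨v', by omega, h2⟩
  have step : ∀ v ∈ γ, ∀ u ∈ γ, (cell v ∩ cell u).Nonempty →
      |μ v - μ u| ≤ D * weight a b v + D * weight a b u := by
    rintro v hv u hu ⟨z, hz1, hz2⟩
    obtain ⟨v', hv', hz1'⟩ := ext v hv z hz1
    obtain ⟨u', hu', hz2'⟩ := ext u hu z hz2
    -- The refined cells that contain `z` have touching squares; the tent is evaluated at a common
    -- corner, which need not be `z`.
    obtain ⟨p, p', q, q', hp, hp', hq, hq', e, f⟩ := exists_corner_eq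
      (by rw [List.length_append, List.length_append, hv', hu']) hz1' hz2'
    have e1 := hμ v v' hv' p hp q hq
    have e2 := hμ u u' hu' p' hp' q' hq'
    rw [← e, ← f] at e2
    rw [abs_sub_comm] at e1
    exact (abs_sub_le _ _ _).trans (add_le_add e1 e2)
  obtain ⟨hne, hch, hl, hr⟩ := hγ
  rcases γ with _ | ⟨v₀, γ⟩
  · exact absurd rfl hne
  have sum := abs_sub_le_sum_of_isChain (m := fun v => μ v) (G := fun v => D * weight a b v)
    (R := fun v u => (v ∈ v₀ :: γ ∧ u ∈ v₀ :: γ) ∧ (cell v ∩ cell u).Nonempty)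
    (fun v u h => step v h.1.1 u h.1.2 h.2) v₀ γ (by
      rw [List.isChain_iff_getElem] at hch ⊢
      exact fun i hi => ⟨⟨List.getElem_mem _, List.getElem_mem _⟩, hch i hi⟩)
  have left : |μ v₀| ≤ D * weight a b v₀ := by
    obtain ⟨v', hv', hz⟩ := ext v₀ List.mem_cons_self x hl
    obtain ⟨w', hw', hzw⟩ := exists_mem_cell_append hx k
    obtain ⟨p, p', q, q', hp, hp', hq, hq', e, f⟩ := exists_corner_eq
      (by rw [List.length_append, List.length_append, hv', hw']) hz hzw
    have e1 := hμ v₀ v' hv' p hp q hq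
    have hX := coordX_lt w'
    have hY := coordY_lt w'
    rw [hw'] at hX hY
    rw [e, f, coordX_append, coordY_append, hw', add_assoc, add_assoc, hT, tent,
      blockDist_self (by omega), blockDist_self (by omega), (h0 _ (fold_le h3 _)).1,
      (h0 _ (fold_le h3 _)).1, max_self, zero_sub, abs_neg] at e1
    exact e1
  generalize hlast : (v₀ :: γ).getLast (List.cons_ne_nil v₀ γ) = l at *
  have right : |c - μ l| ≤ D * weight a b l := by
    have hlm : l ∈ v₀ :: γ := hlast ▸ List.getLast_mem _
    obtain ⟨v', hv', hz⟩ := ext l hlm y hr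
    obtain ⟨⟨b1, b2⟩, b3, b4⟩ := mem_cell_bounds hz
    obtain ⟨⟨c1, c2⟩, c3, c4⟩ := mem_cell_bounds hx
    rw [List.length_append, hv'] at b1 b2 b3 b4
    rcases hfar with h | h
    · obtain ⟨p, hp, e⟩ := exists_blockDist_eq c1 c2 b1 b2 h
      have := hμ l v' hv' p hp 0 zero_le_one
      rwa [hT, tent, e, (h0 _ (fold_le h3 _)).2, max_eq_left (hFc _ _)] at this
    · obtain ⟨p, hp, e⟩ := exists_blockDist_eq c3 c4 b3 b4 h
      have := hμ l v' hv' 0 zero_le_one p hp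
      rwa [hT, tent, e, (h0 _ (fold_le h3 _)).2, max_eq_right (hFc _ _)] at this
  have total : c ≤ 2 * (D * ((v₀ :: γ).map (weight a b)).sum) := by
    have e : ((v₀ :: γ).map fun v => D * weight a b v).sum = D * ((v₀ :: γ).map (weight a b)).sum :=
      List.sum_map_mul_left _ _ _
    rw [e] at sum
    refine le_trans ?_ sum
    have t1 := abs_sub_abs_le_abs_sub c (μ v₀)
    have t2 := abs_sub_le c (μ l) (μ v₀)
    rw [abs_of_pos hc] at t1
    rw [abs_sub_comm (μ l)] at t2
    linarith
  rw [div_mul_eq_mul_div, div_le_iff₀ hD]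
  rw [hDdef, div_mul_eq_mul_div, ← mul_div_assoc, le_div_iff₀ hw] at total
  linarith

/-! ### The chain distance is a metric -/

section Metric

variable {a b : ℝ}

theorem IsChainBetween.single {w : Word} {x y : ℝ × ℝ} (hx : x ∈ cell w) (hy : y ∈ cell w) :
    IsChainBetween [w] x y :=
  ⟨by simp, by simp, hx, hy⟩

theorem IsChainBetween.pair {w v : Word} {x y : ℝ × ℝ} (hx : x ∈ cell w) (hy : y ∈ cell v)
    (h : (cell w ∩ cell v).Nonempty) : IsChainBetween [w, v] x y :=
  ⟨by simp, by simpa using h, hx, hy⟩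

theorem IsChainBetween.reverse {γ : List Word} {x y : ℝ × ℝ} (h : IsChainBetween γ x y) :
    IsChainBetween γ.reverse y x := by
  obtain ⟨h1, h2, h3, h4⟩ := h
  refine ⟨by simpa using h1, ?_, by simpa using h4, by simpa using h3⟩
  rw [List.isChain_reverse]
  exact h2.imp fun w v h => by rwa [Set.inter_comm]

theorem IsChainBetween.append {γ γ' : List Word} {x y z : ℝ × ℝ} (h : IsChainBetween γ x y)
    (h' : IsChainBetween γ' y z) : IsChainBetween (γ ++ γ') x z := by
  obtain ⟨h1, h2, h3, h4⟩ := h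
  obtain ⟨k1, k2, k3, k4⟩ := h'
  refine ⟨by simp [h1], h2.append k2 fun u hu v hv => ⟨y, ?_, ?_⟩, ?_, ?_⟩
  · rw [List.getLast?_eq_some_getLast h1] at hu
    cases hu
    exact h4
  · rw [List.head?_eq_some_head k1] at hv
    cases hv
    exact k3
  · rwa [List.head_append_of_ne_nil h1]
  · rwa [List.getLast_append_of_ne_nil (by simp [h1]) k1]

theorem weight_sum_nonneg (ha : 0 < a) (hb : 0 < b) (γ : List Word) :
    0 ≤ (γ.map (weight a b)).sum :=
  List.sum_nonneg fun r hr => by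
    obtain ⟨w, -, rfl⟩ := List.mem_map.1 hr
    exact (weight_pos ha hb w).le

theorem chainDist_le (ha : 0 < a) (hb : 0 < b) {γ : List Word} {x y : carpet}
    (h : IsChainBetween γ x y) : chainDist (weight a b) x y ≤ (γ.map (weight a b)).sum :=
  csInf_le ⟨0, by rintro _ ⟨γ, -, rfl⟩; exact weight_sum_nonneg ha hb γ⟩ ⟨γ, h, rfl⟩

theorem chain_nil (x y : carpet) : IsChainBetween [[]] x y :=
  .single (by rw [cell_nil]; exact x.2) (by rw [cell_nil]; exact y.2)

theorem le_chainDist {x y : carpet} {r : ℝ}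
    (h : ∀ γ, IsChainBetween γ x y → r ≤ (γ.map (weight a b)).sum) :
    r ≤ chainDist (weight a b) x y :=
  le_csInf ⟨_, _, chain_nil x y, rfl⟩ (by rintro _ ⟨γ, hγ, rfl⟩; exact h γ hγ)

theorem weight_le_pow (ha : 0 < a) (hb : 0 < b) (w : Word) :
    weight a b w ≤ max a b ^ w.length := by
  induction w with
  | nil => simp
  | cons i w ih =>
    rw [weight_cons, List.length_cons, pow_succ']
    exact mul_le_mul (ratio_le_max a b i) ih (weight_pos ha hb w).le (le_max_of_le_left ha.le)

theorem min_le_ratio (a b : ℝ) (i : Fin 8) : min a b ≤ ratio a b i := by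
  unfold ratio
  split_ifs
  exacts [min_le_left _ _, min_le_right _ _]

theorem pow_le_weight (ha : 0 < a) (hb : 0 < b) (w : Word) :
    min a b ^ w.length ≤ weight a b w := by
  induction w with
  | nil => simp
  | cons i w ih =>
    rw [weight_cons, List.length_cons, pow_succ']
    exact mul_le_mul (min_le_ratio a b i) ih (by positivity) (ratio_pos ha hb i).le

theorem supDist_nonneg (x y : carpet) : 0 ≤ supDist x y := le_max_of_le_left (abs_nonneg _)

theorem supDist_pos {x y : carpet} (h : x ≠ y) : 0 < supDist x y := by
  by_contra! h0
  have h1 := (le_max_left _ _).trans h0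
  have h2 := (le_max_right _ _).trans h0
  refine h (Subtype.ext (Prod.ext ?_ ?_))
  · exact sub_eq_zero.1 (abs_eq_zero.1 (le_antisymm h1 (abs_nonneg _)))
  · exact sub_eq_zero.1 (abs_eq_zero.1 (le_antisymm h2 (abs_nonneg _)))

theorem exists_le_chainDist (hab : (a, b) ∈ paramSet) : ∃ δ, 0 < δ ∧
    ∀ (w : Word) (x y : carpet), (x : ℝ × ℝ) ∈ cell w → 2 / 3 ^ w.length < supDist x y →
      δ * weight a b w ≤ chainDist (weight a b) x y := by
  obtain ⟨δ, hδ, h⟩ := exists_le_weight_sum hab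
  exact ⟨δ, hδ, fun w x y hx hxy => le_chainDist fun γ hγ => h w x y γ hx hγ (lt_max_iff.1 hxy)⟩

/-- A chain of two cells of the level of `w` suffices, and the second has comparable weight. -/
theorem exists_chainDist_le (ha : 0 < a) (hb : 0 < b) : ∃ C, 0 < C ∧
    ∀ (w : Word) (x y : carpet), (x : ℝ × ℝ) ∈ cell w → supDist x y < 1 / 3 ^ w.length →
      chainDist (weight a b) x y ≤ C * weight a b w := by
  set R := max 1 (max (a / b) (b / a)) with hR
  have hR1 : 1 ≤ R := le_max_left _ _
  have hRa : a ≤ R * b := by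
    rw [← div_le_iff₀ hb]
    exact (le_max_left _ _).trans (le_max_right _ _)
  have hRb : b ≤ R * a := by
    rw [← div_le_iff₀ ha]
    exact (le_max_right _ _).trans (le_max_right _ _)
  refine ⟨1 + R ^ 2, by positivity, fun w x y hx hxy => ?_⟩
  obtain ⟨v, hv, hy⟩ := exists_mem_cell y.2 w.length
  obtain ⟨⟨h1, h2⟩, h3, h4⟩ := coord_adjacent hv.symm hx hy ((le_max_left _ _).trans_lt hxy)
    ((le_max_right _ _).trans_lt hxy)
  refine (chainDist_le ha hb (.pair hx hy (cell_inter_nonempty hv.symm h1 h2 h3 h4))).trans ?_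
  have := weight_le_of_adjacent hR1 ha hb hRa hRb hv h2 h1 h4 h3
  simp only [List.map_cons, List.map_nil, List.sum_cons, List.sum_nil]
  linarith

theorem chainDist_nonneg (ha : 0 < a) (hb : 0 < b) (x y : carpet) :
    0 ≤ chainDist (weight a b) x y :=
  le_chainDist fun γ _ => weight_sum_nonneg ha hb γ

theorem chainDist_self (ha : 0 < a) (hb : 0 < b) (ha1 : a < 1) (hb1 : b < 1) (x : carpet) :
    chainDist (weight a b) x x = 0 := by
  refine le_antisymm (le_of_forall_pos_le_add fun ε hε => ?_) (chainDist_nonneg ha hb x x)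
  obtain ⟨n, hn⟩ := exists_pow_lt_of_lt_one hε (max_lt ha1 hb1)
  obtain ⟨w, hw, hx⟩ := exists_mem_cell x.2 n
  have h1 := chainDist_le (a := a) (b := b) ha hb (.single hx hx)
  have h2 := weight_le_pow ha hb w
  rw [hw] at h2
  simp only [List.map_cons, List.map_nil, List.sum_cons, List.sum_nil] at h1
  linarith

theorem chainDist_pos (hab : (a, b) ∈ paramSet) {x y : carpet} (h : x ≠ y) :
    0 < chainDist (weight a b) x y := by
  obtain ⟨δ, hδ, hle⟩ := exists_le_chainDist hab
  obtain ⟨n, hn⟩ := exists_pow_lt_of_lt_one (half_pos (supDist_pos h))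
    (show (1 / 3 : ℝ) < 1 by norm_num)
  obtain ⟨w, hw, hx⟩ := exists_mem_cell x.2 n
  refine lt_of_lt_of_le (mul_pos hδ (weight_pos hab.1 hab.2.2.1 w)) (hle w x y hx ?_)
  rw [hw]
  rw [one_div, inv_pow, lt_div_iff₀ two_pos] at hn
  rwa [div_eq_mul_inv, mul_comm]

theorem chainDist_comm_le (ha : 0 < a) (hb : 0 < b) (x y : carpet) :
    chainDist (weight a b) x y ≤ chainDist (weight a b) y x :=
  le_chainDist fun γ hγ => by
    refine (chainDist_le ha hb hγ.reverse).trans_eq ?_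
    rw [List.map_reverse, List.sum_reverse]

theorem isMetric_chainDist (hab : (a, b) ∈ paramSet) : IsMetric (chainDist (weight a b)) := by
  obtain ⟨ha, ha1, hb, hb1, -, -⟩ := id hab
  simp only at ha ha1 hb hb1
  refine ⟨chainDist_nonneg ha hb, fun x y => ⟨fun h => ?_, ?_⟩, fun x y =>
    le_antisymm (chainDist_comm_le ha hb x y) (chainDist_comm_le ha hb y x), fun x y z => ?_⟩
  · by_contra hne
    exact (chainDist_pos hab hne).ne' h
  · rintro rfl
    exact chainDist_self ha hb ha1 hb1 x
  · rw [← sub_le_iff_le_add]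
    refine le_chainDist fun γ hγ => ?_
    rw [sub_le_comm]
    refine le_chainDist fun γ' hγ' => ?_
    have := chainDist_le ha hb (hγ.append hγ')
    rw [List.map_append, List.sum_append] at this
    linarith

end Metric

/-! ### Scales and quasisymmetry -/

/-- For a positive number `d ≤ 1` there is `n` with `3 ^ (-(n + 1)) < d ≤ 3 ^ (-n)`. -/
theorem exists_scale {d : ℝ} (h0 : 0 < d) (h1 : d ≤ 1) : ∃ n : ℕ, 1 / 3 ^ (n + 1) < d ∧ d ≤ 1 / 3 ^
    n := by
  have hex : ∃ n : ℕ, 1 / 3 ^ (n + 1) < d := by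
    obtain ⟨n, hn⟩ := exists_pow_lt_of_lt_one h0 (show (1 / 3 : ℝ) < 1 by norm_num)
    refine ⟨n, lt_of_le_of_lt ?_ hn⟩
    rw [one_div, one_div, inv_pow]
    gcongr
    · norm_num
    · omega
  classical
  refine ⟨Nat.find hex, Nat.find_spec hex, ?_⟩
  rcases h : Nat.find hex with _ | m
  · simpa using h1
  · exact not_lt.1 (Nat.find_min hex (by omega : m < Nat.find hex))

theorem supDist_le_one (x y : carpet) : supDist x y ≤ 1 := by
  obtain ⟨⟨h1, h2⟩, h3, h4⟩ := carpet_subset x.2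
  obtain ⟨⟨k1, k2⟩, k3, k4⟩ := carpet_subset y.2
  exact max_le (abs_le.2 ⟨by linarith, by linarith⟩) (abs_le.2 ⟨by linarith, by linarith⟩)

theorem supDist_le_euclDist (x y : carpet) : supDist x y ≤ euclDist x y := by
  refine max_le (Real.abs_le_sqrt ?_) (Real.abs_le_sqrt ?_)
  · linarith [sq_nonneg (x.1.2 - y.1.2)]
  · linarith [sq_nonneg (x.1.1 - y.1.1)]

theorem euclDist_le_supDist (x y : carpet) : euclDist x y ≤ 2 * supDist x y := by
  have h1 : |x.1.1 - y.1.1| ≤ supDist x y := le_max_left _ _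
  have h2 : |x.1.2 - y.1.2| ≤ supDist x y := le_max_right _ _
  have h0 := supDist_nonneg x y
  refine Real.sqrt_le_iff.2 ⟨by linarith, ?_⟩
  have e1 := sq_le_sq' (neg_le_of_abs_le h1) (le_of_abs_le h1)
  have e2 := sq_le_sq' (neg_le_of_abs_le h2) (le_of_abs_le h2)
  nlinarith

section Quasisymmetry

variable {a b : ℝ}

theorem weight_append_le (ha : 0 < a) (hb : 0 < b) (w v : Word) :
    weight a b (w ++ v) ≤ max a b ^ v.length * weight a b w := by
  rw [weight_append, mul_comm]
  exact mul_le_mul_of_nonneg_right (weight_le_pow ha hb v) (weight_pos ha hb w).le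

theorem le_weight_append (ha : 0 < a) (hb : 0 < b) (w v : Word) :
    min a b ^ v.length * weight a b w ≤ weight a b (w ++ v) := by
  rw [weight_append, mul_comm (weight a b w)]
  exact mul_le_mul_of_nonneg_right (pow_le_weight ha hb v) (weight_pos ha hb w).le

theorem exists_take_eq (w : Word) {m n : ℕ} (hmn : m ≤ n) (hn : n ≤ w.length) :
    ∃ v : Word, w.take n = w.take m ++ v ∧ v.length = n - m :=
  ⟨(w.take n).drop m, by
    conv_lhs => rw [← List.take_append_drop m (w.take n)]
    rw [List.take_take, min_eq_left hmn], by simp [hn]⟩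

theorem three_rpow_log {x : ℝ} (hx : 0 < x) : (3 : ℝ) ^ (Real.log x / (-Real.log 3)) = x⁻¹ := by
  have h3 : Real.log 3 ≠ 0 := (Real.log_pos (by norm_num)).ne'
  rw [Real.rpow_def_of_pos (by norm_num), show Real.log 3 * (Real.log x / -Real.log 3) = -Real.log
      x by
    field_simp, Real.exp_neg, Real.exp_log hx]

theorem exponent_pos {x : ℝ} (hx : 0 < x) (hx1 : x < 1) : 0 < Real.log x / (-Real.log 3) :=
  div_pos_of_neg_of_neg (Real.log_neg hx hx1) (neg_lt_zero.2 (Real.log_pos (by norm_num)))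

/-- Let `n₁`, `n₂` be the scales of the distances from `p` to `s` and to `q`. Up to constants, the
chain distances are at most, respectively at least, the weights of the prefixes of lengths `n₁`,
`n₂` of one address of `p`. These weights are compared through the letters in between: at most `max
a b` each if `n₂ ≤ n₁`, at least `min a b` each if `n₁ ≤ n₂`. -/
theorem exists_chainDist_le_mul (hab : (a, b) ∈ paramSet) : ∃ C, 0 < C ∧
    ∀ (t : ℝ) (p q s : carpet), 0 < t → supDist p s < t * supDist p q →
      chainDist (weight a b) p s ≤ C * max (t ^ (Real.log (max a b) / (-Real.log 3)))
        (t ^ (Real.log (min a b) / (-Real.log 3))) * chainDist (weight a b) p q := by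
  obtain ⟨δ, hδ, hlow⟩ := exists_le_chainDist hab
  obtain ⟨ha, ha1, hb, hb1, -, -⟩ := hab
  simp only at ha ha1 hb hb1
  obtain ⟨K, hK, hup⟩ := exists_chainDist_le (a := a) (b := b) ha hb
  have hA0 : 0 < max a b := lt_max_of_lt_left ha
  have hA1 : max a b < 1 := max_lt ha1 hb1
  have hm0 : 0 < min a b := lt_min ha hb
  have hm1 : min a b < 1 := min_lt_of_left_lt ha1
  have hmA : min a b ≤ max a b := min_le_max
  have hκ1 := exponent_pos hA0 hA1
  have hκ2 := exponent_pos hm0 hm1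
  have e1 := three_rpow_log hA0
  have e2 := three_rpow_log hm0
  generalize Real.log (max a b) / (-Real.log 3) = κ₁ at *
  generalize Real.log (min a b) / (-Real.log 3) = κ₂ at *
  set A := max a b
  set m := min a b
  refine ⟨(K + 1) / m * (1 / m) * (1 / (δ * m ^ 2)), by positivity, fun t p q s ht hps => ?_⟩
  have hq : p ≠ q := by
    rintro rfl
    have : supDist p p = 0 := by simp [supDist]
    rw [this, mul_zero] at hps
    exact absurd hps (not_lt.2 (supDist_nonneg _ _))
  have hDq := chainDist_nonneg ha hb p q
  rcases eq_or_ne p s with rfl | hs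
  · rw [chainDist_self ha hb ha1 hb1]
    positivity
  obtain ⟨n₁, hn1, hn1'⟩ := exists_scale (supDist_pos hs) (supDist_le_one p s)
  obtain ⟨n₂, hn2, hn2'⟩ := exists_scale (supDist_pos hq) (supDist_le_one p q)
  obtain ⟨w, hw, hp⟩ := exists_mem_cell p.2 (n₁ + n₂ + 2)
  have hpn : ∀ n, (p : ℝ × ℝ) ∈ cell (w.take n) := fun n =>
    cell_append_subset (w.take n) (w.drop n) (by rwa [List.take_append_drop])
  have hlen : ∀ n ≤ n₁ + n₂ + 2, (w.take n).length = n := fun n hn => by simp [hw, hn]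
  have hg : ∀ n, 0 < weight a b (w.take n) := fun n => weight_pos ha hb _
  have upper : chainDist (weight a b) p s ≤ (K + 1) / m * weight a b (w.take n₁) := by
    -- The bound `hup` needs a strict inequality, so it is applied one level higher; at level `0`
    -- the chain consisting of the empty word does.
    rcases n₁ with _ | n
    · refine (chainDist_le ha hb (chain_nil p s)).trans ?_
      simp only [List.map_cons, List.map_nil, List.sum_cons, List.sum_nil, weight_nil,
          List.take_zero,
        mul_one, add_zero]
      rw [le_div_iff₀ hm0]
      linarith
    · have h1 := hup (w.take n) p s (hpn n) (hn1'.trans_lt (by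
        rw [hlen n (by omega)]
        gcongr
        · norm_num
        · omega))
      obtain ⟨v, hv, hvl⟩ := exists_take_eq w (Nat.le_add_right n 1) (by omega)
      have h2 := le_weight_append ha hb (w.take n) v
      rw [← hv, hvl, Nat.add_sub_cancel_left, pow_one] at h2
      rw [div_mul_eq_mul_div, le_div_iff₀ hm0]
      calc chainDist (weight a b) p s * m ≤ K * weight a b (w.take n) * m := by gcongr
        _ = K * (m * weight a b (w.take n)) := by ring
        _ ≤ (K + 1) * weight a b (w.take (n + 1)) :=
          mul_le_mul (by linarith) h2 (mul_pos hm0 (hg n)).le (by linarith)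
  have lower : δ * m ^ 2 * weight a b (w.take n₂) ≤ chainDist (weight a b) p q := by
    -- Two further levels make `2 / 3 ^ (n₂ + 2)` smaller than `1 / 3 ^ (n₂ + 1)`.
    have h1 := hlow (w.take (n₂ + 2)) p q (hpn _) (by
      rw [hlen _ (by omega)]
      refine lt_of_le_of_lt ?_ hn2
      rw [div_le_div_iff₀ (by positivity) (by positivity), pow_succ _ (n₂ + 1)]
      have : (0 : ℝ) < 3 ^ (n₂ + 1) := by positivity
      linarith)
    obtain ⟨v, hv, hvl⟩ := exists_take_eq w (show n₂ ≤ n₂ + 2 by omega) (by omega)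
    have h2 := le_weight_append ha hb (w.take n₂) v
    rw [← hv, hvl, Nat.add_sub_cancel_left] at h2
    rw [mul_assoc]
    exact (mul_le_mul_of_nonneg_left h2 hδ.le).trans h1
  have scale : (3 : ℝ) ^ n₂ < t * 3 ^ (n₁ + 1) := by
    have h1 : 1 / (3 : ℝ) ^ (n₁ + 1) < t * (1 / 3 ^ n₂) :=
      (hn1.trans hps).trans_le (mul_le_mul_of_nonneg_left hn2' ht.le)
    rwa [mul_one_div, div_lt_div_iff₀ (by positivity) (by positivity), one_mul] at h1
  have ratio : weight a b (w.take n₁) ≤ 1 / m * max (t ^ κ₁) (t ^ κ₂) * weight a b (w.take n₂) := by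
    rcases le_total n₂ n₁ with h | h
    · obtain ⟨j, rfl⟩ := Nat.exists_eq_add_of_le h
      obtain ⟨v, hv, hvl⟩ := exists_take_eq w h (by omega)
      have h2 := weight_append_le ha hb (w.take n₂) v
      rw [← hv, hvl, Nat.add_sub_cancel_left] at h2
      refine h2.trans (mul_le_mul_of_nonneg_right ?_ (hg n₂).le)
      have h3 : 1 < t * 3 ^ (j + 1) := by
        have h0 : (0 : ℝ) < 3 ^ n₂ := by positivity
        rw [show n₂ + j + 1 = n₂ + (j + 1) by ring, pow_add] at scale
        refine lt_of_mul_lt_mul_left ?_ h0.le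
        linarith
      -- Raising `1 < t * 3 ^ (j + 1)` to the power `κ₁` turns `3` into `A⁻¹`.
      have h4 : 1 ≤ t ^ κ₁ * (A⁻¹) ^ (j + 1) := by
        have := Real.one_le_rpow h3.le hκ1.le
        rwa [Real.mul_rpow ht.le (by positivity), ← Real.rpow_natCast, ← Real.rpow_mul (by
            norm_num),
          mul_comm ((j + 1 : ℕ) : ℝ), Real.rpow_mul (by norm_num), Real.rpow_natCast, e1] at this
      rw [inv_pow, ← div_eq_mul_inv, one_le_div (by positivity), pow_succ] at h4
      rw [div_mul_eq_mul_div, one_mul, le_div_iff₀ hm0]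
      calc A ^ j * m ≤ A ^ j * A := by gcongr
        _ ≤ t ^ κ₁ := h4
        _ ≤ _ := le_max_left _ _
    · obtain ⟨j, rfl⟩ := Nat.exists_eq_add_of_le h
      obtain ⟨v, hv, hvl⟩ := exists_take_eq w h (by omega)
      have h2 := le_weight_append ha hb (w.take n₁) v
      rw [← hv, hvl, Nat.add_sub_cancel_left] at h2
      have h3 : (3 : ℝ) ^ j ≤ t * 3 := by
        have h0 : (0 : ℝ) < 3 ^ n₁ := by positivity
        rw [pow_add, pow_succ] at scale
        refine le_of_mul_le_mul_left ?_ h0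
        linarith
      have h4 : (m⁻¹) ^ j ≤ t ^ κ₂ * m⁻¹ := by
        have := Real.rpow_le_rpow (by positivity) h3 hκ2.le
        rwa [Real.mul_rpow ht.le (by positivity), ← Real.rpow_natCast, ← Real.rpow_mul (by
            norm_num),
          mul_comm ((j : ℕ) : ℝ), Real.rpow_mul (by norm_num), Real.rpow_natCast, e2] at this
      calc weight a b (w.take n₁) = (m⁻¹) ^ j * (m ^ j * weight a b (w.take n₁)) := by
            rw [← mul_assoc, ← mul_pow, inv_mul_cancel₀ hm0.ne', one_pow, one_mul]
        _ ≤ (t ^ κ₂ * m⁻¹) * weight a b (w.take (n₁ + j)) := by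
            refine mul_le_mul h4 h2 ?_ ?_
            · have := hg n₁; positivity
            · positivity
        _ ≤ 1 / m * max (t ^ κ₁) (t ^ κ₂) * weight a b (w.take (n₁ + j)) := by
            refine mul_le_mul_of_nonneg_right ?_ (hg _).le
            rw [one_div, mul_comm]
            exact mul_le_mul_of_nonneg_left (le_max_right _ _) (by positivity)
  have hmax : 0 < max (t ^ κ₁) (t ^ κ₂) := lt_max_of_lt_left (by positivity)
  calc chainDist (weight a b) p s ≤ (K + 1) / m * weight a b (w.take n₁) := upper
    _ ≤ (K + 1) / m * (1 / m * max (t ^ κ₁) (t ^ κ₂) * weight a b (w.take n₂)) := by gcongr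
    _ = (K + 1) / m * (1 / m) * (1 / (δ * m ^ 2)) * max (t ^ κ₁) (t ^ κ₂) *
        (δ * m ^ 2 * weight a b (w.take n₂)) := by field_simp
    _ ≤ _ := by gcongr

/-- The homeomorphism `t ↦ C * max (t ^ κ₁) (t ^ κ₂)` of `[0, ∞)`. -/
theorem exists_homeomorph_max_rpow {C κ₁ κ₂ : ℝ} (hC : 0 < C) (h1 : 0 < κ₁) (h2 : 0 < κ₂) :
    ∃ h : ℝ≥0 ≃ₜ ℝ≥0, ∀ t : ℝ≥0, (h t : ℝ) = C * max ((t : ℝ) ^ κ₁) ((t : ℝ) ^ κ₂) := by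
  lift C to ℝ≥0 using hC.le
  have hC' : 0 < C := by exact_mod_cast hC
  let f : ℝ≥0 → ℝ≥0 := fun t => C * max (t ^ κ₁) (t ^ κ₂)
  have hf : StrictMono f := fun x y hxy =>
    mul_lt_mul_of_pos_left (max_lt_max (NNReal.rpow_lt_rpow hxy h1) (NNReal.rpow_lt_rpow hxy h2))
        hC'
  have hs : Function.Surjective f := fun y => by
    have r1 : ((y / C) ^ (1 / κ₁)) ^ κ₁ = y / C := by
      rw [← NNReal.rpow_mul, one_div_mul_cancel h1.ne', NNReal.rpow_one]
    have r2 : ((y / C) ^ (1 / κ₂)) ^ κ₂ = y / C := by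
      rw [← NNReal.rpow_mul, one_div_mul_cancel h2.ne', NNReal.rpow_one]
    -- The preimage of `y` is the smaller of the solutions of the two single-power equations: there
    -- the other power is at most `y / C`.
    rcases le_total ((y / C) ^ (1 / κ₁)) ((y / C) ^ (1 / κ₂)) with h | h
    · refine ⟨(y / C) ^ (1 / κ₁), ?_⟩
      have := NNReal.rpow_le_rpow h h2.le
      rw [r2] at this
      simp only [f]
      rw [r1, max_eq_left this, mul_div_cancel₀ _ hC'.ne']
    · refine ⟨(y / C) ^ (1 / κ₂), ?_⟩
      have := NNReal.rpow_le_rpow h h1.le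
      rw [r1] at this
      simp only [f]
      rw [r2, max_eq_right this, mul_div_cancel₀ _ hC'.ne']
  refine ⟨(hf.orderIsoOfSurjective f hs).toHomeomorph, fun t => ?_⟩
  change ((f t : ℝ≥0) : ℝ) = _
  simp only [f]
  push_cast
  rfl

end Quasisymmetry

end SierpinskiCarpet

/-- For `(a, b) ∈ σ`, the function `D_{g_{a,b}}` is a metric on the carpet that is quasisymmetric to
the sup-metric and to the Euclidean metric, with a control function
`h(t) = C max {t ^ κ₁, t ^ κ₂}`, `κ₁ = log (a ∨ b) / (-log 3)`, `κ₂ = log (a ∧ b) / (-log 3)`. -/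
theorem proposition1p3 (a b : ℝ) (hab : (a, b) ∈ paramSet) :
    IsMetric (chainDist (weight a b)) ∧
    Quasisymmetric (chainDist (weight a b)) supDist ∧
    Quasisymmetric (chainDist (weight a b)) euclDist ∧
    ∃ (C : ℝ) (h : ℝ≥0 ≃ₜ ℝ≥0), 0 < C ∧
      (∀ t : ℝ≥0, (h t : ℝ) =
        C * max ((t : ℝ) ^ (Real.log (max a b) / (-Real.log 3)))
          ((t : ℝ) ^ (Real.log (min a b) / (-Real.log 3)))) ∧
      QuasisymmetricWith h (chainDist (weight a b)) supDist ∧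
      QuasisymmetricWith h (chainDist (weight a b)) euclDist := by
  have hmet := isMetric_chainDist hab
  obtain ⟨C, hC, key⟩ := exists_chainDist_le_mul hab
  suffices main : ∃ (C : ℝ) (h : ℝ≥0 ≃ₜ ℝ≥0), 0 < C ∧
      (∀ t : ℝ≥0, (h t : ℝ) =
        C * max ((t : ℝ) ^ (Real.log (max a b) / (-Real.log 3)))
          ((t : ℝ) ^ (Real.log (min a b) / (-Real.log 3)))) ∧
      QuasisymmetricWith h (chainDist (weight a b)) supDist ∧
      QuasisymmetricWith h (chainDist (weight a b)) euclDist by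
    obtain ⟨C, h, hC, e, h1, h2⟩ := main
    exact ⟨hmet, ⟨h, h1⟩, ⟨h, h2⟩, C, h, hC, e, h1, h2⟩
  have hpos := fun x y hxy => chainDist_pos hab (x := x) (y := y) hxy
  obtain ⟨ha, ha1, hb, hb1, -, -⟩ := hab
  simp only at ha ha1 hb hb1
  have hκ1 := exponent_pos (lt_max_of_lt_left ha : 0 < max a b) (max_lt ha1 hb1)
  have hκ2 := exponent_pos (lt_min ha hb) (min_lt_of_left_lt ha1)
  generalize Real.log (max a b) / (-Real.log 3) = κ₁ at *
  generalize Real.log (min a b) / (-Real.log 3) = κ₂ at *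
  -- The estimate is applied with `2 * t`, which covers the factor `2` between the Euclidean and the
  -- sup-metric; `E` bounds the effect on both powers.
  set E := (2 : ℝ) ^ κ₁ + 2 ^ κ₂ with hE
  have p1 : (1 : ℝ) ≤ 2 ^ κ₁ := Real.one_le_rpow one_le_two hκ1.le
  have p2 : (1 : ℝ) ≤ 2 ^ κ₂ := Real.one_le_rpow one_le_two hκ2.le
  -- The summand `1` makes the final inequality strict, as `p` and `q` are distinct.
  have hCE : 0 < C * E + 1 := by positivity
  obtain ⟨h, hh⟩ := exists_homeomorph_max_rpow hCE hκ1 hκ2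
  have h0 : h 0 = 0 := by
    have := hh 0
    rw [NNReal.coe_zero, Real.zero_rpow hκ1.ne', Real.zero_rpow hκ2.ne', max_self, mul_zero] at this
    exact_mod_cast this
  have strict : ∀ t : ℝ≥0, 0 < t → ∀ p q s : carpet, supDist p s < 2 * t * supDist p q →
      chainDist (weight a b) p s < h t * chainDist (weight a b) p q := by
    intro t ht p q s hps
    have ht' : (0 : ℝ) < t := by exact_mod_cast ht
    have hpq : p ≠ q := by
      rintro rfl
      have : supDist p p = 0 := by simp [supDist]
      rw [this, mul_zero] at hps
      exact absurd hps (not_lt.2 (supDist_nonneg _ _))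
    have hmax : 0 < max ((t : ℝ) ^ κ₁) ((t : ℝ) ^ κ₂) := lt_max_of_lt_left (by positivity)
    have hq := hpos p q hpq
    have h2 : max ((2 * t : ℝ) ^ κ₁) ((2 * t : ℝ) ^ κ₂) ≤ E * max ((t : ℝ) ^ κ₁) ((t : ℝ) ^ κ₂) :=
        by
      rw [Real.mul_rpow two_pos.le ht'.le, Real.mul_rpow two_pos.le ht'.le]
      refine max_le ?_ ?_
      · exact mul_le_mul (by linarith) (le_max_left _ _) (by positivity) (by positivity)
      · exact mul_le_mul (by linarith) (le_max_right _ _) (by positivity) (by positivity)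
    rw [hh]
    calc chainDist (weight a b) p s
        ≤ C * max ((2 * t : ℝ) ^ κ₁) ((2 * t : ℝ) ^ κ₂) * chainDist (weight a b) p q :=
          key _ p q s (by positivity) hps
      _ ≤ C * (E * max ((t : ℝ) ^ κ₁) ((t : ℝ) ^ κ₂)) * chainDist (weight a b) p q := by gcongr
      _ = C * E * max ((t : ℝ) ^ κ₁) ((t : ℝ) ^ κ₂) * chainDist (weight a b) p q := by ring
      _ < (C * E + 1) * max ((t : ℝ) ^ κ₁) ((t : ℝ) ^ κ₂) * chainDist (weight a b) p q := by
          gcongr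
          linarith
  refine ⟨C * E + 1, h, hCE, hh, ⟨h0, fun t ht p q s hps => strict t ht p q s ?_⟩,
    ⟨h0, fun t ht p q s hps => strict t ht p q s ?_⟩⟩
  · have := supDist_nonneg p q
    have ht' : (0 : ℝ) < t := by exact_mod_cast ht
    nlinarith
  · have ht' : (0 : ℝ) < t := by exact_mod_cast ht
    calc supDist p s ≤ euclDist p s := supDist_le_euclDist p s
      _ < t * euclDist p q := hps
      _ ≤ t * (2 * supDist p q) := by
          gcongr
          exact euclDist_le_supDist p q
      _ = 2 * t * supDist p q := by ring
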